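/- **Setting.** Let $(X,\mathcal S,w)$ be a weighted set system: $X$ is a finite nonempty set with $n$ elements, $\mathcal S$ is a finite family of $m$ subsets of $X$ with $\bigcup\mathcal S=X$, and $w:\mathcal S\to[0,\infty)$. For $\mathcal A\subseteq\mathcal S$ put $\mathcal U(\mathcal A)=\bigcup_{S\in\mathcal A}S$, $w(\mathcal A)=\sum_{S\in\mathcal A}w(S)$ and $\mathcal N_{\mathcal A}(e)=\{S\in\mathcal A: e\in S\}$. Let $\mathrm{opt}$ be the least weight of a set cover, that is, of an $\mathcal A$ with $\mathcal U(\mathcal A)=X$. Two elements are neighbors in $\mathcal A$ if some $S\in\mathcal A$ contains both. For $X'\subseteq X$, a *base group set* of $e$ restricted to $(X',\mathcal A)$ is a collection $\mathcal B(e)\subseteq\mathcal N_{\mathcal A}(e)$ of at most $\tau$ sets with $\mathcal U(\mathcal N_{\mathcal A}(e))\cap X'\subseteq\mathcal U(\mathcal B(e))$. An element $e\in X'$ is a *$\tau$-SNC element in $X'$* if for every $\mathcal A\subseteq\mathcal N_{\mathcal S}(e)$ there is a base group set of $e$ restricted to $(X',\mathcal A)$. The system has the *$\tau$-SNC property* if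 every nonempty $X'\subseteq X$ contains a $\tau$-SNC element in $X'$. Its *layer decomposition* is $X=Z_1\cup\dots\cup Z_L$, where $Z_k$ is the set of all $\tau$-SNC elements in $X\setminus(Z_1\cup\dots\cup Z_{k-1})$ and all $Z_k$ are nonempty; $L$ is the layer depth. Fix $0<\varepsilon<\frac12$. **Modified-ParaMinSC-SNC.** Put $\beta=\max_{e\in X}\min_{S\ni e}w(S)$, $\mathcal S^{(1)}=\{S: w(S)<\beta\varepsilon/n\}$, $\mathcal S^{(2)}=\{S:\beta\varepsilon/n\le w(S)\le n\beta\}$, $X^{(1)}=\mathcal U(\mathcal S^{(1)})$ and $X^{(2)}=X\setminus X^{(1)}$. Let $\mathcal B_1$ consist of one arbitrarily chosen set of $\mathcal N_{\mathcal S^{(1)}}(e)$ for each $e\in X^{(1)}$. Let $\mathcal B_2$ be the output of ParaMinSC-SNC on $(X^{(2)},\mathcal S^{(2)},w)$ (each set standing for its intersection with $X^{(2)}$). Output $\mathcal B_1\cup\mathcal B_2$. **ParaMinSC-SNC, forward phase.** Compute the layer decomposition $Z_1,\dots,Z_{L'}$ of the given instance $(E,\mathcal F,w)$. Start with $y=0$,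 $w'=w$, $X'=E$, $\mathcal S'=\mathcal F$, $\mathcal A=\emptyset$. For $k=1,\dots,L'$: put $\mathcal C_k=\emptyset$, $q_k=\min w'(S)/|S\cap X'\cap Z_k|$ over all $S\in\mathcal S'$ that meet $X'\cap Z_k$, and $\alpha=q_k$. While $\mathcal A$ does not cover $Z_k$, do the following in the $t$-th pass ($t=1,2,\dots$): add $\alpha$ to $y(e)$ for all $e\in X'\cap Z_k$; set $w'(S)=w(S)-\sum_{e\in S}y(e)$ for $S\in\mathcal S'$; let $\mathcal C'=\{S\in\mathcal S': w'(S)\le\varepsilon w(S)\}$; add $\mathcal C'$ to $\mathcal C_k$ and $\mathcal A$; remove $\mathcal U(\mathcal C')$ from $X'$ and $\mathcal C'$ from $\mathcal S'$; set $\alpha=q_k\varepsilon(1+\varepsilon)^{t-1}$ for the next pass. **ParaMinSC-SNC, deletion phase.** Start with $\mathcal A'=\emptyset$. For $k=L',\dots,1$: 1. Put $\mathcal B_k=\mathcal A'\cup\mathcal C_k$ and $I=\emptyset$. For $j=k,\dots,L'$ let $G_j$ be the graph on the elements of $Z_j$ that are not neighbors in $\mathcal B_k$ of elements of $I$, two distinct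 vertices being adjacent if they are neighbors in $\mathcal B_k$; find a maximal independent set $I_j$ of $G_j$ and add it to $I$. 2. For each $j\ge k$ and each $e\in I_j$ find a base group set $\mathcal B(e)$ of $e$ restricted to $(\bigcup_{i\ge j}Z_i,\mathcal N_{\mathcal B_k}(e))$, and replace $\mathcal B_k$ by $\bigcup_{e\in I}\mathcal B(e)$. 3. For each integer $i$ with $0\le i\le 4\tau^32^\tau\log_2 n$ do the following. Independently for each $e\in I$ flip a fair coin; if it shows heads, let $\mathcal Q(e)$ be a uniformly random subcollection of $|\mathcal N_{\mathcal B_k}(e)|-1$ sets of $\mathcal N_{\mathcal B_k}(e)$ (empty if $\mathcal N_{\mathcal B_k}(e)=\emptyset$), otherwise let $\mathcal Q(e)=\mathcal N_{\mathcal B_k}(e)$. Then delete simultaneously from $\mathcal B_k$ all sets $S\in\mathcal B_k\setminus\bigcup_{e\in I}\mathcal Q(e)$ with $S\cap\bigcup_{j\ge k}Z_j\subseteq\mathcal U(\bigcup_{e\in I}\mathcal Q(e))$. 4. Put $\mathcal A'=\mathcal B_k$. The output is $\mathcal A'$. **Cost.** In a parallel round, every machine reads the shared memory, computes locally (local computation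 is not charged) and writes its result. In the steps of the algorithm, a machine handles one element, one set, one pair of an element and a $\tau$-tuple of sets (in the layer decomposition and in the search for base group sets), or one global value (such as a minimum, a loop test or a random ranking of the elements). The number of machines is the largest number used in one round. Luby's procedure finds a maximal independent set as follows: while vertices are left, draw a uniformly random ranking of the elements, select every remaining vertex that ranks before all its remaining neighbors, and discard the selected vertices and their neighbors. **Theorem.** There is an absolute constant $K>0$ such that for every $(X,\mathcal S,w)$ as above with the $\tau$-SNC property, every $0<\varepsilon<\frac12$ and all rules for the arbitrary choices of sets and of base group sets, the following holds. 1. With any (possibly randomized) procedure that always ends with a maximal independent set, Modified-ParaMinSC-SNC always ends with a set cover $\mathcal B$ of $X$, and with probability at least $1-\frac1n$ its weight satisfies $w(\mathcal B)\le\tau(1+3\varepsilon)\,\mathrm{opt}$. 2. Luby's procedure always ends with a maximal independent set. If it is used, the algorithm always uses at most $K\,n\,m^\tau$ machines, and with probability at least $1-\frac1n$ both $w(\mathcal B)\le\tau(1+3\varepsilon)\,\mathrm{opt}$ and the number of parallel rounds is at most $$K\Bigl(L\log_{1+\varepsilon}\frac{n^3}{\varepsilon^2}+4\tau^32^\tau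 L^2\log_2 n\Bigr),$$ where $L$ is the layer depth of $(X,\mathcal S)$. -/

import Mathlib

open scoped ENNReal

namespace SetCover

noncomputable section

open scoped Classical

/-! ### Synchronous parallel computation

In one round, every machine reads the shared memory, computes locally and writes its result.
The rounds of consecutive computations add up; the number of machines is the largest number
of machines that work in one round. -/

/-- The result of one execution, with the number of rounds it took (`⊤` if it never ends) and
the number of machines it used. -/
structure Run (α : Type) where
  val : α
  rounds : ℕ∞
  machines : ℕ

namespace Run

instance : Monad Run where
  pure a := ⟨a, 0, 0⟩
  bind r f := ⟨(f r.val).val, r.rounds + (f r.val).rounds, max r.machines (f r.val).machines⟩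

/-- One round in which machine `i` computes `f i`, for every `i : ι`. -/
def par {ι β : Type} [Fintype ι] (f : ι → β) : Run (ι → β) := ⟨f, 1, Fintype.card ι⟩

/-- One round in which machine `i` decides `p i`, for every `i : ι`; the result is the set of
all `i` that satisfy `p`. -/
def select {ι : Type} [Fintype ι] (p : ι → Prop) : Run (Finset ι) :=
  ⟨Finset.univ.filter p, 1, Fintype.card ι⟩

/-- One round of a single machine. -/
def solo {α : Type} (a : α) : Run α := ⟨a, 1, 1⟩

/-- `t` consecutive executions of `body`. -/
def iter {σ : Type} (body : σ → Run σ) : ℕ → σ → Run σ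
  | 0, s => pure s
  | t + 1, s => do
      let s' ← body s
      iter body t s'

/-- `while cond do body`. Every test of the condition takes a round of one machine. A loop whose
condition never fails takes infinitely many rounds. -/
def whileLoop {σ : Type} (cond : σ → Prop) (body : σ → Run σ) (s : σ) : Run σ :=
  if h : ∃ t, ¬ cond (iter body t s).val then do
    let s' ← iter (fun x => do let _ ← solo (); body x) (Nat.find h) s
    solo s'
  else ⟨s, ⊤, 0⟩

/-- The execution ends after at most `b` rounds. -/
def RoundsLE {α : Type} (r : Run α) (b : ℝ) : Prop := ∃ k : ℕ, r.rounds = k ∧ (k : ℝ) ≤ b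

end Run

/-- A randomized parallel computation: a probability distribution on executions. -/
def Par (α : Type) : Type := PMF (Run α)

/-- The law of independent random variables with laws `p i`. -/
def prodPMF {ι β : Type} [Fintype ι] [Fintype β] (p : ι → PMF β) : PMF (ι → β) :=
  PMF.ofFintype (fun f => ∏ i, p i (f i)) (by
    rw [← Fintype.prod_sum]
    refine Finset.prod_eq_one fun i _ => ?_
    rw [← tsum_fintype (L := .unconditional β)]
    exact (p i).tsum_coe)

namespace Par

/-- A deterministic computation as a randomized one. -/
def lift {α : Type} (r : Run α) : Par α := PMF.pure r

instance : Monad Par where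
  pure a := lift (pure a)
  bind p f := PMF.bind p fun r => PMF.map
    (fun r' => ⟨r'.val, r.rounds + r'.rounds, max r.machines r'.machines⟩) (f r.val)

instance : MonadLift Run Par := ⟨lift⟩

/-- One round in which machine `i` draws a sample of `p i`, independently of the other machines. -/
def draw {ι β : Type} [Fintype ι] [Fintype β] (p : ι → PMF β) : Par (ι → β) :=
  PMF.map Run.par (prodPMF p)

/-- One round in which a single machine draws a sample of `p`. -/
def soloDraw {α : Type} (p : PMF α) : Par α := PMF.map Run.solo p

/-- The set of executions of positive probability. -/
def outcomes {α : Type} (p : Par α) : Set (Run α) := PMF.support p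

/-- The probability that the execution satisfies `E`. -/
def prob {α : Type} (p : Par α) (E : Run α → Prop) : ℝ≥0∞ := PMF.toOuterMeasure p {r | E r}

end Par

/-! ### Weighted set systems -/

/-- A finite family of subsets of `X`, indexed by `S`, with nonnegative weights. -/
structure WeightedSetSystem (X S : Type) where
  carrier : S → Finset X
  weight : S → ℝ
  weight_nonneg : ∀ s, 0 ≤ weight s

namespace WeightedSetSystem

variable {X S : Type} (G : WeightedSetSystem X S)

/-- The elements covered by the collection `A`. -/
def covered (A : Finset S) : Finset X := A.biUnion G.carrier

/-- The sets of the collection `A` that contain `e`. -/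
def containing (A : Finset S) (e : X) : Finset S := A.filter fun s => e ∈ G.carrier s

/-- The total weight of a collection. -/
def totalWeight (A : Finset S) : ℝ := ∑ s ∈ A, G.weight s

/-- `A` is a set cover of the whole ground set. -/
def IsCover (A : Finset S) : Prop := ∀ e, e ∈ G.covered A

/-- The least weight of a set cover. -/
def opt : ℝ := ⨅ A : {A : Finset S // G.IsCover A}, G.totalWeight A.1

/-- The neighborhood of `e` restricted to the elements of `X'` and the collection `A`. -/
def restrictedNbhd (e : X) (X' : Finset X) (A : Finset S) : Finset X :=
  G.covered (G.containing A e) ∩ X'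

/-- `B` is a base group set of `e` restricted to `X'` and `A`. -/
def IsBaseGroup (τ : ℕ) (e : X) (X' : Finset X) (A B : Finset S) : Prop :=
  B ⊆ G.containing A e ∧ B.card ≤ τ ∧ G.restrictedNbhd e X' A ⊆ G.covered B

/-- `e` is a `τ`-SNC element in `X'`. -/
def IsSNC (τ : ℕ) (X' : Finset X) (e : X) : Prop :=
  e ∈ X' ∧ ∀ A : Finset S, (∀ s ∈ A, e ∈ G.carrier s) → ∃ B, G.IsBaseGroup τ e X' A B

/-- The `τ`-SNC property. -/
def HasSNC (τ : ℕ) : Prop := ∀ X' : Finset X, X'.Nonempty → ∃ e, G.IsSNC τ X' e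

/-- What is left of the ground set after the removal of the first `k` layers; a layer consists
of all `τ`-SNC elements in the set of elements that are left. -/
def residual [Fintype X] (τ : ℕ) : ℕ → Finset X
  | 0 => Finset.univ
  | k + 1 => (residual τ k).filter fun e => ¬ G.IsSNC τ (residual τ k) e

/-- The number of layers of the layer decomposition. -/
def layerDepth [Fintype X] (τ : ℕ) : ℕ := sInf {k | G.residual τ k = ∅}

/-- Two different elements are adjacent if they are neighbors in `B`. -/
def nbrGraph (B : Finset S) : SimpleGraph X where
  Adj e e' := e ≠ e' ∧ ∃ s ∈ B, e ∈ G.carrier s ∧ e' ∈ G.carrier s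
  symm := ⟨fun _ _ h => ⟨h.1.symm, h.2.imp fun _ hs => ⟨hs.1, hs.2.2, hs.2.1⟩⟩⟩
  loopless := ⟨fun _ h => h.1 rfl⟩

end WeightedSetSystem

/-! ### Maximal independent sets -/

/-- `I` is a maximal independent set of the subgraph of `H` induced on `V`. -/
def IsMIS {X : Type} (H : SimpleGraph X) (V I : Finset X) : Prop :=
  Maximal (fun J : Finset X => J ⊆ V ∧ H.IsIndepSet (J : Set X)) I

/-- A randomized parallel procedure whose input is an induced subgraph. -/
abbrev MISProc (X : Type) : Type := SimpleGraph X → Finset X → Par (Finset X)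

/-- The procedure always ends and returns a maximal independent set. -/
def MISProc.Correct {X : Type} (M : MISProc X) : Prop :=
  ∀ (H : SimpleGraph X) (V : Finset X), ∀ r ∈ (M H V).outcomes,
    r.rounds ≠ ⊤ ∧ IsMIS H V r.val

/-- The uniformly random ranking of all elements. -/
def randomRanking (X : Type) [Fintype X] : PMF (X ≃ Fin (Fintype.card X)) :=
  haveI : Nonempty (X ≃ Fin (Fintype.card X)) := ⟨Fintype.equivFin X⟩
  PMF.uniformOfFintype _

/-- Luby's procedure: while vertices are left, draw a random ranking, select every vertex that
ranks before all its neighbors, and discard the selected vertices and their neighbors. The first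
argument bounds the number of passes; every pass discards at least one vertex, so that the number
of vertices suffices. -/
def lubyLoop {X : Type} [Fintype X] (H : SimpleGraph X) : ℕ → Finset X → Par (Finset X)
  | 0, _ => pure ∅
  | fuel + 1, V => do
      let left ← Run.solo (decide V.Nonempty)
      if left then
        let π ← Par.soloDraw (randomRanking X)
        let J ← Run.select fun e => e ∈ V ∧ ∀ e' ∈ V, H.Adj e e' → π e < π e'
        let V' ← Run.select fun e => e ∈ V ∧ e ∉ J ∧ ∀ e' ∈ J, ¬ H.Adj e e'
        let I ← lubyLoop H fuel V'
        Run.select fun e => e ∈ J ∨ e ∈ I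
      else
        pure ∅

/-- Luby's procedure as a maximal independent set procedure. -/
def luby (X : Type) [Fintype X] : MISProc X := fun H V => lubyLoop H V.card V

/-! ### The algorithm

All procedures work on the instance with ground set `E` and collection `F`, in which every set of
`F` stands for its intersection with `E`. -/

/-- The rules by which the algorithm picks one of several admissible sets and one of several
admissible tuples of sets. -/
structure ChoiceRule (X S : Type) (τ : ℕ) where
  pickSet : X → Finset S → S
  pickSet_mem : ∀ e A, A.Nonempty → pickSet e A ∈ A
  pickTuple : X → Finset (Fin τ → S) → Fin τ → S
  pickTuple_mem : ∀ e T, T.Nonempty → pickTuple e T ∈ T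

/-- The variables of the forward phase: the dual variables `y`, the residual weights `w'`, the
uncovered elements `X'`, the sets `S'` not picked so far, the picked sets `A`, the sets `C` picked
in the current epoch, the current increment `α`, and the number `t` of passes of the current
epoch so far. -/
structure ForwardState (X S : Type) where
  dual : X → ℝ
  resid : S → ℝ
  uncov : Finset X
  avail : Finset S
  picked : Finset S
  epoch : Finset S
  incr : ℝ
  passes : ℕ

section Algorithm

variable {X S : Type} [Fintype X] [Fintype S] (G : WeightedSetSystem X S)

/-- One pass of the layer decomposition. Machine `(e, f)` tests whether, for every further set `s`
of `F` that contains `e`, the collection of those among `s` and the sets `f i` that belong to `F`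
and contain `e` can be replaced by at most `τ` of its members. The state consists of the elements
that are left and of the list of layers found so far. -/
def layerPass (τ : ℕ) (F : Finset S) (s : Finset X × List (Finset X)) :
    Run (Finset X × List (Finset X)) := do
  let good ← Run.select fun p : X × (Fin τ → S) =>
    ∀ s' ∈ G.containing F p.1, ∃ B,
      G.IsBaseGroup τ p.1 s.1
        (G.containing F p.1 ∩ insert s' (Finset.univ.image p.2)) B
  let Z ← Run.select fun e => e ∈ s.1 ∧ ∀ f : Fin τ → S, (e, f) ∈ good
  let R ← Run.select fun e => e ∈ s.1 ∧ e ∉ Z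
  pure (R, s.2 ++ [Z])

/-- The list of the layers of the instance `(E, F)`. -/
def layerDecomposition (τ : ℕ) (E : Finset X) (F : Finset S) : Run (List (Finset X)) := do
  let s ← Run.whileLoop (fun s => s.1.Nonempty) (layerPass G τ F) (E, [])
  pure s.2

/-- One pass of the while loop of the forward phase in the epoch of the layer `Z`. -/
def forwardPass (ε q : ℝ) (Z : Finset X) (s : ForwardState X S) : Run (ForwardState X S) := do
  let y ← Run.par fun e => if e ∈ s.uncov ∧ e ∈ Z then s.dual e + s.incr else s.dual e
  let w' ← Run.par fun i =>
    if i ∈ s.avail then G.weight i - ∑ e ∈ G.carrier i, y e else s.resid i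
  let C' ← Run.select fun i => i ∈ s.avail ∧ w' i ≤ ε * G.weight i
  let C ← Run.select fun i => i ∈ s.epoch ∨ i ∈ C'
  let A ← Run.select fun i => i ∈ s.picked ∨ i ∈ C'
  let X' ← Run.select fun e => e ∈ s.uncov ∧ e ∉ G.covered C'
  let S' ← Run.select fun i => i ∈ s.avail ∧ i ∉ C'
  let α ← Run.solo (q * ε * (1 + ε) ^ s.passes)
  pure ⟨y, w', X', S', A, C, α, s.passes + 1⟩

/-- The epoch of the layer `Z`. The minimum `q` is over the sets that meet `X' ∩ Z`. -/
def forwardEpoch (ε : ℝ) (Z : Finset X) (s : ForwardState X S) : Run (ForwardState X S) := do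
  let ratio ← Run.par fun i => s.resid i / ((G.carrier i ∩ s.uncov ∩ Z).card : ℝ)
  let q ← Run.solo
    (⨅ i : {i : S // i ∈ s.avail ∧ (G.carrier i ∩ s.uncov ∩ Z).Nonempty}, ratio i.1)
  Run.whileLoop (fun s' => ¬ Z ⊆ G.covered s'.picked) (forwardPass G ε q Z)
    { s with epoch := ∅, incr := q, passes := 0 }

/-- The forward phase; it returns every layer together with the collection picked in its epoch. -/
def forwardPhase (ε : ℝ) :
    List (Finset X) → ForwardState X S → Run (List (Finset X × Finset S))
  | [], _ => pure []
  | Z :: Zs, s => do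
      let s' ← forwardEpoch G ε Z s
      let rest ← forwardPhase ε Zs s'
      pure ((Z, s'.epoch) :: rest)

/-- The union of a list of layers. -/
def layerUnion : List (Finset X) → Finset X
  | [] => ∅
  | Z :: Zs => Z ∪ layerUnion Zs

/-- The union of the layer of `e` and all later layers. -/
def fromLayerOf (e : X) : List (Finset X) → Finset X
  | [] => ∅
  | Z :: Zs => if e ∈ Z then layerUnion (Z :: Zs) else fromLayerOf e Zs

/-- Starting from the independent set `I`, go through the layers and add to `I` a maximal
independent set of the graph of those elements of the layer that are not adjacent to `I`. -/
def independentSet (M : MISProc X) (B : Finset S) :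
    List (Finset X) → Finset X → Par (Finset X)
  | [], I => pure I
  | Z :: Zs, I => do
      let V ← Run.select fun e => e ∈ Z ∧ ∀ e' ∈ I, ¬ (G.nbrGraph B).Adj e e'
      let J ← M (G.nbrGraph B) V
      let I' ← Run.select fun e => e ∈ I ∨ e ∈ J
      independentSet M B Zs I'

/-- Replace `B` by the union of base group sets `B(e)` of the elements `e` of `I`. Machine `(e, f)`
tests whether those among the sets `f i` that belong to `B` and contain `e` form a base group set
of `e`, restricted to the elements of the layer of `e` and of the later layers. -/
def baseGroups {τ : ℕ} (c : ChoiceRule X S τ) (Zs : List (Finset X)) (I : Finset X)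
    (B : Finset S) : Run (Finset S) := do
  let good ← Run.select fun p : X × (Fin τ → S) =>
    G.IsBaseGroup τ p.1 (fromLayerOf p.1 Zs) B
      (G.containing B p.1 ∩ Finset.univ.image p.2)
  let base ← Run.par fun e =>
    G.containing B e ∩ Finset.univ.image (c.pickTuple e (Finset.univ.filter fun f => (e, f) ∈ good))
  Run.select fun i => ∃ e ∈ I, i ∈ base e

/-- The random collection `Q(e)` for a collection `N`: with probability one half it is `N`,
otherwise it consists of all but one set of `N`, chosen uniformly. -/
def randomSub (N : Finset S) : PMF (Finset S) :=
  (PMF.uniformOfFintype Bool).bind fun head =>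
    if head then
      PMF.uniformOfFinset (N.powersetCard (N.card - 1))
        (Finset.powersetCard_nonempty.2 (Nat.sub_le _ _))
    else PMF.pure N

/-- One pass of the while loop of the deletion phase; `U` is the union of the current layer and
the later ones. -/
def trimPass (U I : Finset X) (B : Finset S) : Par (Finset S) := do
  let Q ← Par.draw fun e => if e ∈ I then randomSub (G.containing B e) else PMF.pure ∅
  let K ← Run.select fun i => ∃ e ∈ I, i ∈ Q e
  let R ← Run.select fun i => i ∈ B ∧ i ∉ K ∧ G.carrier i ∩ U ⊆ G.covered K
  Run.select fun i => i ∈ B ∧ i ∉ R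

/-- `N` passes of the while loop of the deletion phase. -/
def trimLoop (U I : Finset X) : ℕ → Finset S → Par (Finset S)
  | 0, B => pure B
  | N + 1, B => do
      let B' ← trimPass G U I B
      trimLoop U I N B'

/-- The number of integers `i` with `0 ≤ i ≤ 4 τ³ 2^τ log₂ n`. -/
def trimCount (τ n : ℕ) : ℕ := ⌊4 * (τ : ℝ) ^ 3 * 2 ^ τ * Real.logb 2 n⌋₊ + 1

/-- The deletion phase, on the list of the layers `k, …, L` with their collections: it first
treats the later layers, then layer `k`. -/
def deletionPhase {τ : ℕ} (c : ChoiceRule X S τ) (M : MISProc X) (n : ℕ) :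
    List (Finset X × Finset S) → Par (Finset S)
  | [] => pure ∅
  | (Z, C) :: rest => do
      let A ← deletionPhase c M n rest
      let B ← Run.select fun i => i ∈ A ∨ i ∈ C
      let I ← independentSet G M B (Z :: rest.map Prod.fst) ∅
      let B' ← baseGroups G c (Z :: rest.map Prod.fst) I B
      trimLoop G (layerUnion (Z :: rest.map Prod.fst)) I (trimCount τ n) B'

/-- The algorithm ParaMinSC-SNC on the instance `(E, F)`; `n` is the parameter that governs the
number of passes of the deletion phase. -/
def paraMinSC {τ : ℕ} (c : ChoiceRule X S τ) (M : MISProc X) (ε : ℝ) (n : ℕ)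
    (E : Finset X) (F : Finset S) : Par (Finset S) := do
  let Zs ← layerDecomposition G τ E F
  let CZ ← forwardPhase G ε Zs ⟨fun _ => 0, G.weight, E, F, ∅, ∅, 0, 0⟩
  deletionPhase G c M n CZ

/-- The algorithm Modified-ParaMinSC-SNC. -/
def modifiedParaMinSC {τ : ℕ} (c : ChoiceRule X S τ) (M : MISProc X) (ε : ℝ) :
    Par (Finset S) := do
  let n := Fintype.card X
  let cheapest ← Run.par fun e => ⨅ i : {i : S // e ∈ G.carrier i}, G.weight i.1
  let β ← Run.solo (⨆ e, cheapest e)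
  let S1 ← Run.select fun i => G.weight i < β * ε / n
  let S2 ← Run.select fun i => β * ε / n ≤ G.weight i ∧ G.weight i ≤ n * β
  let X1 ← Run.select fun e => e ∈ G.covered S1
  let X2 ← Run.select fun e => e ∉ X1
  let choice ← Run.par fun e => c.pickSet e (G.containing S1 e)
  let B1 ← Run.select fun i => ∃ e ∈ X1, choice e = i
  let B2 ← paraMinSC G c M ε n X2 S2
  Run.select fun i => i ∈ B1 ∨ i ∈ B2

end Algorithm

end

end SetCover

/-!
The proof follows the primal-dual method. All costs are tracked by `Par.Spec`: up to an event of
probability at most `δ`, an execution ends with a result that satisfies `V`, after at most `R`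
rounds and with at most `N` machines. Specifications compose along `>>=`, with failure
probabilities and rounds adding up. The algorithm is specified once, for an arbitrary specification
of the maximal independent set procedure, in `spec_modifiedParaMinSC`; the parts of the theorem
are instances of it.

*Layers.* By adding the sets of a collection one by one, the test of `τ + 1` sets at a time decides
the `τ`-SNC property (`isSNCIn_iff_forall_tuple`). A subinstance has at most as many layers as the
whole system (`ok_layerDecomposition`).

*Forward phase.* The dual variables stay feasible, they are tight up to the factor `1 - ε` on every
picked set (`ForwardInv`), and an element of positive dual variable is in no set picked before the
epoch of its layer (`DualFits`). The dual variables of the uncovered elements of the current layer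
grow by the factor `1 + ε` per pass and are bounded by the weights, hence the logarithmic number of
passes (`lt_passBound`).

*Deletion phase.* Every element is in the independent set `I` or adjacent to an element of `I` of the
same or an earlier layer, so the base group sets of the elements of `I` cover what was covered
before. Every remaining set
contains exactly one element of `I` (`Anchored`), so an element of the current layer is in at most
`τ * τ` sets. While it is in more than `τ` sets, one of them is redundant given `τ` of the others,
and a pass deletes it with probability at least `1 / (τ 2 ^ (τ + 1))` (`le_prob_card_containing_lt`).
Thus the expectation of a potential that is exponential in the number of sets decreases
geometrically, and Markov's inequality bounds the failure probability of each element by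
`1 / n ^ 3` (`prob_trimLoop_le`, `trimFactor_pow_trimCount_le`). If no element fails, every element
of positive dual variable is in at most `τ` sets of the output, and weak duality gives the
approximation ratio (`totalWeight_le_of_dual`).

*Luby's procedure.* A pass removes at least half of the edges on average
(`two_mul_sum_card_darts_le`), so that `O(log n)` passes suffice for all of the at most `L ^ 2` calls
at once with probability at least `1 - 1 / n ^ 2` (`spec_luby_rounds`).
-/

namespace SetCover

noncomputable section

open scoped Classical

/-! ### Expectations and specifications of computations -/

/-- The execution ends, its result satisfies `V`, and it uses at most `R` rounds and `N` machines.
The bounds `⊤` make no claim. -/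
def Run.Ok {α : Type} (r : Run α) (V : α → Prop) (R N : ℕ∞) : Prop :=
  V r.val ∧ r.rounds ≠ ⊤ ∧ r.rounds ≤ R ∧ (r.machines : ℕ∞) ≤ N

/-- The expectation of `φ` over the executions of `p`. -/
def Par.expect {α : Type} (p : Par α) (φ : Run α → ℝ≥0∞) : ℝ≥0∞ :=
  ∑' r, (show PMF (Run α) from p) r * φ r

/-- Up to an event of probability at most `δ`, the executions of `p` satisfy `Run.Ok`. -/
def Par.Spec {α : Type} (p : Par α) (δ : ℝ≥0∞) (V : α → Prop) (R N : ℕ∞) : Prop :=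
  p.prob (fun r => ¬ r.Ok V R N) ≤ δ

namespace Run

variable {α β : Type}

theorem Ok.mono {r : Run α} {V V' : α → Prop} {R R' N N' : ℕ∞} (h : r.Ok V R N)
    (hV : ∀ a, V a → V' a) (hR : R ≤ R') (hN : N ≤ N') : r.Ok V' R' N' :=
  ⟨hV _ h.1, h.2.1, h.2.2.1.trans hR, h.2.2.2.trans hN⟩

theorem cast_max_le {a b : ℕ} {N : ℕ∞} (ha : (a : ℕ∞) ≤ N) (hb : (b : ℕ∞) ≤ N) :
    ((max a b : ℕ) : ℕ∞) ≤ N := by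
  rcases max_choice a b with h | h <;> rwa [h]

theorem Ok.bind {r : Run α} {f : α → Run β} {V : α → Prop} {V' : β → Prop} {R R' N : ℕ∞}
    (h : r.Ok V R N) (hf : ∀ a, V a → (f a).Ok V' R' N) : (r >>= f).Ok V' (R + R') N := by
  obtain ⟨h1, h2, h3, h4⟩ := h
  obtain ⟨g1, g2, g3, g4⟩ := hf _ h1
  refine ⟨g1, ?_, add_le_add h3 g3, ?_⟩
  · show r.rounds + (f r.val).rounds ≠ ⊤
    simp [h2, g2]
  · show ((max r.machines (f r.val).machines : ℕ) : ℕ∞) ≤ N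
    exact cast_max_le h4 g4

theorem ok_pure {a : α} {V : α → Prop} {N : ℕ∞} (h : V a) : (pure a : Run α).Ok V 0 N :=
  ⟨h, ENat.zero_ne_top, le_rfl, by simp [pure]⟩

theorem ok_par {ι : Type} [Fintype ι] {f : ι → β} {N : ℕ∞} (hN : (Fintype.card ι : ℕ∞) ≤ N) :
    (par f).Ok (fun g => g = f) 1 N := ⟨rfl, ENat.one_ne_top, le_rfl, hN⟩

theorem ok_select {ι : Type} [Fintype ι] {p : ι → Prop} {N : ℕ∞}
    (hN : (Fintype.card ι : ℕ∞) ≤ N) :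
    (select p).Ok (fun s => ∀ i, i ∈ s ↔ p i) 1 N :=
  ⟨fun i => by simp [select], ENat.one_ne_top, le_rfl, hN⟩

theorem ok_solo {a : α} {N : ℕ∞} (hN : 1 ≤ N) : (solo a).Ok (fun b => b = a) 1 N :=
  ⟨rfl, ENat.one_ne_top, le_rfl, by simpa [solo] using hN⟩

theorem iter_invariant {σ : Type} {cond : σ → Prop} {body : σ → Run σ} {Inv : ℕ → σ → Prop}
    (hbody : ∀ t s, Inv t s → cond s → Inv (t + 1) (body s).val) :
    ∀ t k s, Inv k s → (∀ j < t, cond (iter body j s).val) → Inv (k + t) (iter body t s).val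
  | 0, k, s, h, _ => h
  | t + 1, k, s, h, hc => by
    have h1 := hbody k s h (hc 0 (by omega))
    have h2 := iter_invariant hbody t (k + 1) (body s).val h1
      fun j hj => hc (j + 1) (by omega)
    have e : k + (t + 1) = k + 1 + t := by omega
    rw [e]
    exact h2

theorem iter_val_congr {σ : Type} {body body' : σ → Run σ}
    (h : ∀ s, (body s).val = (body' s).val) : ∀ t s, (iter body t s).val = (iter body' t s).val
  | 0, _ => rfl
  | t + 1, s => by
    show (iter body t (body s).val).val = (iter body' t (body' s).val).val
    rw [h, iter_val_congr h t]

theorem iter_ok {σ : Type} {cond : σ → Prop} {body : σ → Run σ} {Inv : ℕ → σ → Prop} {R N : ℕ∞}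
    (hbody : ∀ t s, Inv t s → cond s → (body s).Ok (Inv (t + 1)) R N) :
    ∀ t k s, Inv k s → (∀ j < t, cond (iter body j s).val) →
      (iter body t s).Ok (Inv (k + t)) (t * R) N
  | 0, k, s, h, _ => by
    have := ok_pure (N := N) h
    simpa [iter] using this
  | t + 1, k, s, h, hc => by
    have h1 := hbody k s h (hc 0 (by omega))
    have h2 : ∀ a, (a = (body s).val) → (iter body t a).Ok (Inv (k + 1 + t)) (t * R) N := by
      rintro a rfl
      exact iter_ok hbody t (k + 1) (body s).val h1.1 fun j hj => hc (j + 1) (by omega)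
    have h3 : (body s).Ok (fun a => a = (body s).val) R N := ⟨rfl, h1.2⟩
    refine (h3.bind h2).mono ?_ ?_ le_rfl
    · intro a ha
      rwa [show k + (t + 1) = k + 1 + t by omega]
    · push_cast
      rw [add_mul, one_mul, add_comm]

/-- A loop with an invariant that depends on the number of passes, and that contradicts the loop
condition after `T` passes. -/
theorem ok_whileLoop {σ : Type} {cond : σ → Prop} {body : σ → Run σ} {Inv : ℕ → σ → Prop}
    {R N : ℕ∞} {T : ℕ} (hN : 1 ≤ N)
    (hbody : ∀ t s, Inv t s → cond s → (body s).Ok (Inv (t + 1)) R N)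
    (hT : ∀ t s, Inv t s → cond s → t < T) {s : σ} (hs : Inv 0 s) :
    (whileLoop cond body s).Ok (fun s' => ¬ cond s' ∧ ∃ t ≤ T, Inv t s') (T * (1 + R) + 1) N := by
  have hbody' : ∀ t s, Inv t s → cond s →
      ((do let _ ← solo (); body s : Run σ)).Ok (Inv (t + 1)) (1 + R) N := fun t s h1 h2 =>
    (ok_solo hN).bind fun _ _ => hbody t s h1 h2
  have hv : ∀ t s', (iter (fun x => do let _ ← solo (); body x) t s').val
      = (iter body t s').val := iter_val_congr fun s => rfl
  have hbv : ∀ t s, Inv t s → cond s → Inv (t + 1) (body s).val :=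
    fun t s h1 h2 => (hbody t s h1 h2).1
  have hex : ∃ t, ¬ cond (iter body t s).val := by
    by_contra! hcon
    have h1 := iter_invariant hbv T 0 s hs fun j _ => hcon j
    rw [zero_add] at h1
    exact lt_irrefl _ (hT _ _ h1 (hcon T))
  have hmin : ∀ j < Nat.find hex, cond (iter body j s).val := fun j hj =>
    not_not.1 (Nat.find_min hex hj)
  have hle : Nat.find hex ≤ T := by
    by_contra! hlt
    have h1 := iter_invariant hbv T 0 s hs fun j hj => hmin j (hj.trans hlt)
    rw [zero_add] at h1
    exact lt_irrefl _ (hT _ _ h1 (hmin T hlt))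
  have h1 := iter_ok hbody' (Nat.find hex) 0 s hs fun j hj => by
    rw [hv]; exact hmin j hj
  rw [zero_add] at h1
  have h2 : (iter (fun x => do let _ ← solo (); body x) (Nat.find hex) s).Ok
      (fun s' => ¬ cond s' ∧ ∃ t ≤ T, Inv t s') (Nat.find hex * (1 + R)) N := by
    refine ⟨⟨?_, Nat.find hex, hle, h1.1⟩, h1.2⟩
    rw [hv]
    exact Nat.find_spec hex
  have h3 := h2.bind (f := fun s' => solo s') (V' := fun s' => ¬ cond s' ∧ ∃ t ≤ T, Inv t s')
    (R' := 1) fun a ha => (ok_solo hN).mono (by rintro b rfl; exact ha) le_rfl le_rfl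
  rw [whileLoop, dif_pos hex]
  refine h3.mono (fun _ h => h) ?_ le_rfl
  gcongr

end Run

namespace Par

variable {α β : Type}

theorem prob_eq_expect (p : Par α) (E : Run α → Prop) :
    p.prob E = p.expect fun r => if E r then 1 else 0 := by
  refine (PMF.toOuterMeasure_apply (show PMF (Run α) from p) _).trans ?_
  refine tsum_congr fun r => ?_
  by_cases h : E r
  · rw [Set.indicator_of_mem (by exact h)]; simp [h]
  · rw [Set.indicator_of_notMem (by exact h)]; simp [h]

theorem tsum_bind_mul {γ δ : Type} (p : PMF γ) (f : γ → PMF δ) (φ : δ → ℝ≥0∞) :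
    ∑' b, (p.bind f) b * φ b = ∑' a, p a * ∑' b, f a b * φ b := by
  simp_rw [PMF.bind_apply, ← ENNReal.tsum_mul_right, ← ENNReal.tsum_mul_left]
  rw [ENNReal.tsum_comm]
  simp_rw [mul_assoc]

theorem tsum_pure_mul {δ : Type} (r : δ) (φ : δ → ℝ≥0∞) :
    ∑' b, (PMF.pure r) b * φ b = φ r := by
  rw [tsum_eq_single r]
  · simp
  · intro b hb; simp [hb]

theorem tsum_map_mul {γ δ : Type} (p : PMF γ) (f : γ → δ) (φ : δ → ℝ≥0∞) :
    ∑' b, (p.map f) b * φ b = ∑' a, p a * φ (f a) := by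
  rw [← PMF.bind_pure_comp, tsum_bind_mul]
  refine tsum_congr fun a => ?_
  congr 1
  exact tsum_pure_mul (f a) φ

theorem expect_pmf_pure (r : Run α) (φ : Run α → ℝ≥0∞) :
    expect (PMF.pure r : Par α) φ = φ r := tsum_pure_mul r φ

theorem expect_bind (p : Par α) (f : α → Par β) (φ : Run β → ℝ≥0∞) :
    expect (p >>= f) φ = expect p fun r => expect (f r.val) fun r' =>
      φ ⟨r'.val, r.rounds + r'.rounds, max r.machines r'.machines⟩ := by
  refine (tsum_bind_mul (show PMF (Run α) from p) _ φ).trans ?_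
  refine tsum_congr fun r => ?_
  congr 1
  exact tsum_map_mul _ _ _

theorem expect_lift (r : Run α) (φ : Run α → ℝ≥0∞) :
    expect (liftM r : Par α) φ = φ r := expect_pmf_pure r φ

theorem expect_pure (a : α) (φ : Run α → ℝ≥0∞) :
    expect (pure a : Par α) φ = φ (pure a) := expect_pmf_pure _ φ

theorem expect_mono {p : Par α} {φ ψ : Run α → ℝ≥0∞} (h : ∀ r ∈ p.outcomes, φ r ≤ ψ r) :
    p.expect φ ≤ p.expect ψ := by
  refine ENNReal.tsum_le_tsum fun r => ?_
  by_cases hr : r ∈ p.outcomes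
  · gcongr; exact h r hr
  · have : (show PMF (Run α) from p) r = 0 := by
      by_contra hne
      exact hr ((PMF.mem_support_iff _ _).2 hne)
    rw [this]; simp

theorem expect_add (p : Par α) (φ ψ : Run α → ℝ≥0∞) :
    p.expect (fun r => φ r + ψ r) = p.expect φ + p.expect ψ := by
  simp_rw [expect, mul_add]
  exact ENNReal.tsum_add

theorem expect_const (p : Par α) (c : ℝ≥0∞) : p.expect (fun _ => c) = c := by
  rw [expect, ENNReal.tsum_mul_right, PMF.tsum_coe, one_mul]

theorem expect_mul_left (p : Par α) (c : ℝ≥0∞) (φ : Run α → ℝ≥0∞) :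
    p.expect (fun r => c * φ r) = c * p.expect φ := by
  simp_rw [expect, mul_left_comm _ c, ENNReal.tsum_mul_left]

theorem prob_le_one (p : Par α) (E : Run α → Prop) : p.prob E ≤ 1 := by
  rw [prob_eq_expect]
  refine le_trans (expect_mono fun r _ => ?_) (expect_const p 1).le
  split_ifs <;> simp

theorem prob_add_prob_not (p : Par α) (E : Run α → Prop) :
    p.prob E + p.prob (fun r => ¬ E r) = 1 := by
  rw [prob_eq_expect, prob_eq_expect, ← expect_add]
  refine Eq.trans ?_ (expect_const p 1)
  congr 1
  funext r
  by_cases h : E r <;> simp [h]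

theorem prob_mono {p : Par α} {E E' : Run α → Prop} (h : ∀ r, E r → E' r) :
    p.prob E ≤ p.prob E' := by
  rw [prob_eq_expect, prob_eq_expect]
  refine expect_mono fun r _ => ?_
  by_cases h1 : E r
  · simp [h1, h r h1]
  · simp [h1]

theorem prob_or_le (p : Par α) (E E' : Run α → Prop) :
    p.prob (fun r => E r ∨ E' r) ≤ p.prob E + p.prob E' := by
  rw [prob_eq_expect, prob_eq_expect, prob_eq_expect, ← expect_add]
  refine expect_mono fun r _ => ?_
  by_cases h1 : E r <;> by_cases h2 : E' r <;> simp [h1, h2]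

theorem prob_eq_zero_iff (p : Par α) (E : Run α → Prop) :
    p.prob (fun r => ¬ E r) = 0 ↔ ∀ r ∈ p.outcomes, E r := by
  rw [prob_eq_expect, expect, ENNReal.tsum_eq_zero]
  refine forall_congr' fun r => ?_
  rw [mul_eq_zero]
  have h : (show PMF (Run α) from p) r = 0 ↔ r ∉ p.outcomes := PMF.apply_eq_zero_iff _ _
  rw [h]
  by_cases h1 : E r <;> by_cases h2 : r ∈ p.outcomes <;> simp [h1, h2]

/-- Markov's inequality. -/
theorem prob_mul_le_expect {p : Par α} {E : Run α → Prop} {c : ℝ≥0∞} {φ : Run α → ℝ≥0∞}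
    (h : ∀ r, E r → c ≤ φ r) : c * p.prob E ≤ p.expect φ := by
  rw [prob_eq_expect, ← expect_mul_left]
  refine expect_mono fun r _ => ?_
  by_cases h1 : E r
  · simpa [h1] using h r h1
  · simp [h1]

theorem spec_zero_iff {p : Par α} {V : α → Prop} {R N : ℕ∞} :
    p.Spec 0 V R N ↔ ∀ r ∈ p.outcomes, r.Ok V R N := by
  rw [Spec, nonpos_iff_eq_zero, prob_eq_zero_iff]

theorem Spec.mono {p : Par α} {δ δ' : ℝ≥0∞} {V V' : α → Prop} {R R' N N' : ℕ∞}
    (h : p.Spec δ V R N) (hδ : δ ≤ δ') (hV : ∀ a, V a → V' a) (hR : R ≤ R') (hN : N ≤ N') :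
    p.Spec δ' V' R' N' :=
  (prob_mono fun _ h1 h2 => h1 (h2.mono hV hR hN)).trans (h.trans hδ)

theorem Spec.bind {p : Par α} {f : α → Par β} {δ δ' : ℝ≥0∞} {V : α → Prop} {V' : β → Prop}
    {R R' N : ℕ∞} (h : p.Spec δ V R N) (hf : ∀ a, V a → (f a).Spec δ' V' R' N) :
    (p >>= f).Spec (δ + δ') V' (R + R') N := by
  rw [Spec, prob_eq_expect, expect_bind]
  rw [Spec, prob_eq_expect] at h
  calc _ ≤ p.expect (fun r => (if ¬ r.Ok V R N then 1 else 0) + δ') := by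
        refine expect_mono fun r _ => ?_
        by_cases hr : r.Ok V R N
        · simp only [hr, not_true_eq_false, if_false, zero_add]
          refine le_trans (expect_mono fun r' _ => ?_) ((prob_eq_expect _ _).symm.le.trans
            (hf _ hr.1))
          by_cases hr' : r'.Ok V' R' N
          · have : Run.Ok ⟨r'.val, r.rounds + r'.rounds, max r.machines r'.machines⟩
                V' (R + R') N := by
              refine ⟨hr'.1, ?_, add_le_add hr.2.2.1 hr'.2.2.1, ?_⟩
              · simp [hr.2.1, hr'.2.1]
              · exact Run.cast_max_le hr.2.2.2 hr'.2.2.2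
            simp [this]
          · simp only [hr', not_false_eq_true, if_true]
            split_ifs <;> simp
        · simp only [hr, not_false_eq_true, if_true]
          refine le_trans ?_ (le_self_add)
          rw [← prob_eq_expect]
          exact prob_le_one _ _
    _ ≤ δ + δ' := by
        rw [expect_add, expect_const]
        refine add_le_add_left (le_of_eq_of_le ?_ h) _
        congr 1
        funext r
        congr

theorem spec_lift {r : Run α} {V : α → Prop} {R N : ℕ∞} (h : r.Ok V R N) :
    (liftM r : Par α).Spec 0 V R N := by
  rw [Spec, prob_eq_expect, expect_lift]
  simp [h]

theorem spec_pure {a : α} {V : α → Prop} {N : ℕ∞} (h : V a) : (pure a : Par α).Spec 0 V 0 N :=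
  spec_lift (Run.ok_pure h)

theorem spec_lift_bind {r : Run α} {f : α → Par β} {δ : ℝ≥0∞} {V : α → Prop} {V' : β → Prop}
    {R R' N : ℕ∞} (h : r.Ok V R N) (hf : ∀ a, V a → (f a).Spec δ V' R' N) :
    ((liftM r : Par α) >>= f).Spec δ V' (R + R') N := by
  simpa using (spec_lift h).bind hf

end Par

/-! ### The layer decomposition -/

section Layers

variable {X S : Type} (G : WeightedSetSystem X S)

namespace WeightedSetSystem

variable {G}

theorem mem_covered {A : Finset S} {e : X} : e ∈ G.covered A ↔ ∃ s ∈ A, e ∈ G.carrier s :=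
  Finset.mem_biUnion

theorem mem_containing {A : Finset S} {e : X} {s : S} :
    s ∈ G.containing A e ↔ s ∈ A ∧ e ∈ G.carrier s := Finset.mem_filter

theorem mem_restrictedNbhd {A : Finset S} {e x : X} {Y : Finset X} :
    x ∈ G.restrictedNbhd e Y A ↔ (∃ s ∈ A, e ∈ G.carrier s ∧ x ∈ G.carrier s) ∧ x ∈ Y := by
  simp [restrictedNbhd, mem_covered, mem_containing, and_assoc]

theorem covered_union (A B : Finset S) : G.covered (A ∪ B) = G.covered A ∪ G.covered B := by
  ext e
  simp [mem_covered, or_and_right, exists_or]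

theorem covered_mono {A B : Finset S} (h : A ⊆ B) : G.covered A ⊆ G.covered B :=
  Finset.biUnion_subset_biUnion_of_subset_left _ h

theorem containing_mono {A B : Finset S} (h : A ⊆ B) (e : X) :
    G.containing A e ⊆ G.containing B e := Finset.filter_subset_filter _ h

variable (G)

/-- Every subcollection of `F` all of whose sets contain `e` has a base group set of `e`, restricted
to the elements of `Y`. In contrast to `IsSNC`, the collection is `F`, and `e ∈ Y` is not
required. -/
def IsSNCIn (τ : ℕ) (F : Finset S) (Y : Finset X) (e : X) : Prop :=
  ∀ A ⊆ F, (∀ s ∈ A, e ∈ G.carrier s) → ∃ B, G.IsBaseGroup τ e Y A B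

variable {G}

theorem IsSNC.isSNCIn {τ : ℕ} {F : Finset S} {Y Y' : Finset X} {e : X} (h : G.IsSNC τ Y e)
    (hY : Y' ⊆ Y) : G.IsSNCIn τ F Y' e := fun A _ hA => by
  obtain ⟨B, h1, h2, h3⟩ := h.2 A hA
  exact ⟨B, h1, h2, (Finset.inter_subset_inter_left hY).trans h3⟩

end WeightedSetSystem

open WeightedSetSystem

/-- A small collection is the set of values of a tuple, up to a given further set. -/
theorem exists_tuple_of_card_le {τ : ℕ} (B : Finset S) (hB : B.card ≤ τ) (s : S) :
    ∃ f : Fin τ → S, (∀ i, f i ∈ insert s B) ∧ ∀ b ∈ B, ∃ i, f i = b := by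
  refine ⟨fun i => if h : i.1 < B.card then (B.equivFin.symm ⟨i.1, h⟩ : S) else s, fun i => ?_,
    fun b hb => ?_⟩
  · dsimp only
    split_ifs with h
    · exact Finset.mem_insert_of_mem (B.equivFin.symm ⟨i.1, h⟩).2
    · exact Finset.mem_insert_self _ _
  · have h := (B.equivFin ⟨b, hb⟩).2
    refine ⟨⟨_, h.trans_le hB⟩, ?_⟩
    simp

/-- The test with `τ + 1` sets at a time decides the `τ`-SNC property: a base group set of a large
collection arises by adding its sets one by one and reducing each time. -/
theorem isSNCIn_iff_forall_tuple {τ : ℕ} {F : Finset S} {Y : Finset X} {e : X} :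
    (∀ f : Fin τ → S, ∀ s' ∈ G.containing F e, ∃ B, G.IsBaseGroup τ e Y
      (G.containing F e ∩ insert s' (Finset.univ.image f)) B) ↔ G.IsSNCIn τ F Y e := by
  constructor
  · intro h A
    induction A using Finset.induction_on with
    | empty =>
      intro _ _
      refine ⟨∅, by simp, by simp, fun x hx => ?_⟩
      simp [mem_restrictedNbhd] at hx
    | insert s A _ ih =>
      intro hAF hA
      obtain ⟨B, hB, hBτ, hBc⟩ := ih ((Finset.subset_insert _ _).trans hAF)
        fun s hs => hA s (Finset.mem_insert_of_mem hs)
      obtain ⟨f, hf1, hf2⟩ := exists_tuple_of_card_le B hBτ s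
      have hs : s ∈ G.containing F e := mem_containing.2
        ⟨hAF (Finset.mem_insert_self _ _), hA _ (Finset.mem_insert_self _ _)⟩
      have hBA : ∀ b ∈ B, b ∈ A := fun b hb => (mem_containing.1 (hB hb)).1
      obtain ⟨C, hC, hCτ, hCc⟩ := h f s hs
      have hmem : ∀ b, b ∈ insert s (Finset.univ.image f) → b ∈ insert s B := by
        intro b hb
        rcases Finset.mem_insert.1 hb with rfl | hb
        · exact Finset.mem_insert_self _ _
        · obtain ⟨i, _, rfl⟩ := Finset.mem_image.1 hb
          exact hf1 i
      have hsub : insert s B ⊆ G.containing F e ∩ insert s (Finset.univ.image f) := by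
        intro b hb
        rcases Finset.mem_insert.1 hb with rfl | hb
        · exact Finset.mem_inter.2 ⟨hs, Finset.mem_insert_self _ _⟩
        · refine Finset.mem_inter.2 ⟨mem_containing.2
            ⟨hAF (Finset.mem_insert_of_mem (hBA b hb)), (mem_containing.1 (hB hb)).2⟩, ?_⟩
          obtain ⟨i, rfl⟩ := hf2 b hb
          exact Finset.mem_insert_of_mem (Finset.mem_image_of_mem _ (Finset.mem_univ _))
      have hCe : ∀ b ∈ insert s B, ∀ x ∈ G.carrier b, x ∈ Y → x ∈ G.covered C := by
        intro b hb x hx hxY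
        have hb' := hsub hb
        exact hCc (mem_restrictedNbhd.2
          ⟨⟨b, hb', (mem_containing.1 (Finset.mem_inter.1 hb').1).2, hx⟩, hxY⟩)
      refine ⟨C, fun b hb => ?_, hCτ, fun x hx => ?_⟩
      · obtain ⟨h1, h2⟩ := mem_containing.1 (hC hb)
        refine mem_containing.2 ⟨?_, h2⟩
        rcases Finset.mem_insert.1 (hmem b (Finset.mem_inter.1 h1).2) with rfl | h3
        · exact Finset.mem_insert_self _ _
        · exact Finset.mem_insert_of_mem (hBA b h3)
      · obtain ⟨⟨a, ha, hae, hax⟩, hxY⟩ := mem_restrictedNbhd.1 hx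
        rcases Finset.mem_insert.1 ha with rfl | ha
        · exact hCe _ (Finset.mem_insert_self _ _) x hax hxY
        · obtain ⟨b, hb, hbx⟩ := mem_covered.1
            (hBc (mem_restrictedNbhd.2 ⟨⟨a, ha, hae, hax⟩, hxY⟩))
          exact hCe b (Finset.mem_insert_of_mem hb) x hbx hxY
  · intro h f s' _
    exact h _ (fun s hs => (mem_containing.1 (Finset.mem_inter.1 hs).1).1)
      fun s hs => (mem_containing.1 (Finset.mem_inter.1 hs).1).2

/-- The sets of the list are disjoint from each other and from `R`, and every element of a member
of the list is `τ`-SNC among the elements of that member, of the later ones and of `R`. -/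
def Layered (τ : ℕ) (F : Finset S) (R : Finset X) : List (Finset X) → Prop
  | [] => True
  | Z :: Zs => Disjoint Z (layerUnion Zs ∪ R) ∧
      (∀ e ∈ Z, G.IsSNCIn τ F (Z ∪ (layerUnion Zs ∪ R)) e) ∧ Layered τ F R Zs

theorem layerUnion_append (l : List (Finset X)) (Z : Finset X) :
    layerUnion (l ++ [Z]) = layerUnion l ∪ Z := by
  induction l with
  | nil => simp [layerUnion]
  | cons W l ih => simp [layerUnion, ih]

variable {G}

theorem Layered.append {τ : ℕ} {F : Finset S} {R R' Z : Finset X} (hR : R = Z ∪ R')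
    (hd : Disjoint Z R') (hZ : ∀ e ∈ Z, G.IsSNCIn τ F R e) :
    ∀ {l : List (Finset X)}, Layered G τ F R l → Layered G τ F R' (l ++ [Z])
  | [], _ => by
    subst hR
    simpa [Layered, layerUnion, hd] using hZ
  | W :: l, ⟨h1, h2, h3⟩ => by
    have e : layerUnion (l ++ [Z]) ∪ R' = layerUnion l ∪ R := by
      rw [layerUnion_append, hR, Finset.union_assoc]
    refine ⟨?_, ?_, Layered.append hR hd hZ h3⟩
    · rw [← e] at h1
      exact h1
    · rw [← e] at h2
      exact h2

variable [Fintype X]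

theorem residual_card_le {τ : ℕ} (h : G.HasSNC τ) (k : ℕ) :
    (G.residual τ k).card ≤ Fintype.card X - k := by
  induction k with
  | zero => simp [WeightedSetSystem.residual]
  | succ k ih =>
    rcases (G.residual τ k).eq_empty_or_nonempty with he | hne
    · simp [WeightedSetSystem.residual, he]
    · obtain ⟨e, he⟩ := h _ hne
      have : (G.residual τ (k + 1)).card < (G.residual τ k).card := by
        refine Finset.card_lt_card ⟨Finset.filter_subset _ _, fun hs => ?_⟩
        exact (Finset.mem_filter.1 (hs he.1)).2 he
      omega

theorem residual_card_eq_empty {τ : ℕ} (h : G.HasSNC τ) :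
    G.residual τ (Fintype.card X) = ∅ := by
  have := residual_card_le h (Fintype.card X)
  rw [Nat.sub_self, Nat.le_zero] at this
  exact Finset.card_eq_zero.1 this

theorem layerDepth_le_card {τ : ℕ} (h : G.HasSNC τ) : G.layerDepth τ ≤ Fintype.card X :=
  Nat.sInf_le (residual_card_eq_empty h)

theorem residual_layerDepth {τ : ℕ} (h : G.HasSNC τ) : G.residual τ (G.layerDepth τ) = ∅ :=
  Nat.sInf_mem (s := {k | G.residual τ k = ∅}) ⟨_, residual_card_eq_empty h⟩

theorem one_le_layerDepth [Nonempty X] {τ : ℕ} (h : G.HasSNC τ) : 1 ≤ G.layerDepth τ := by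
  by_contra! hlt
  have h0 : G.layerDepth τ = 0 := by omega
  have := residual_layerDepth h
  rw [h0] at this
  exact Finset.univ_nonempty.ne_empty this

/-- With collections of at most `0` sets, no element has a base group set of a single set. -/
theorem one_le_of_hasSNC [Nonempty X] {τ : ℕ} (hc : ∀ e : X, ∃ i : S, e ∈ G.carrier i)
    (h : G.HasSNC τ) : 1 ≤ τ := by
  obtain ⟨e, he, hA⟩ := h Finset.univ Finset.univ_nonempty
  obtain ⟨i, hi⟩ := hc e
  obtain ⟨B, h1, h2, h3⟩ := hA {i} (by simpa using hi)
  have h4 : e ∈ G.covered B :=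
    h3 (mem_restrictedNbhd.2 ⟨⟨i, Finset.mem_singleton_self i, hi, hi⟩, he⟩)
  obtain ⟨b, hb, _⟩ := mem_covered.1 h4
  exact (Finset.card_pos.2 ⟨b, hb⟩).trans_le h2

variable [Fintype S]

/-- The layer decomposition of a subinstance has at most as many layers as that of the whole
system, because the elements left after `t` passes are left in the whole system as well. -/
theorem ok_layerDecomposition {τ : ℕ} (h : G.HasSNC τ) (E : Finset X) (F : Finset S) {N : ℕ∞}
    (hX : (Fintype.card X : ℕ∞) ≤ N) (hP : (Fintype.card (X × (Fin τ → S)) : ℕ∞) ≤ N)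
    (h1 : 1 ≤ N) :
    (layerDecomposition G τ E F).Ok
      (fun l => layerUnion l = E ∧ Layered G τ F ∅ l ∧ l.length ≤ G.layerDepth τ)
      (G.layerDepth τ * 4 + 1) N := by
  let Inv : ℕ → Finset X × List (Finset X) → Prop := fun t s =>
    s.2.length = t ∧ s.1 ⊆ G.residual τ t ∧ layerUnion s.2 ∪ s.1 = E ∧ Layered G τ F s.1 s.2
  have hbody : ∀ t s, Inv t s → s.1.Nonempty → (layerPass G τ F s).Ok (Inv (t + 1)) 3 N := by
    rintro t ⟨R, l⟩ ⟨i1, i2, i3, i4⟩ -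
    dsimp only at i1 i2 i3 i4
    refine ((Run.ok_select hP).bind (R' := 1 + (1 + 0)) (V' := Inv (t + 1)) ?_).mono
      (fun _ h => h) (by norm_num) le_rfl
    intro good hgood
    refine (Run.ok_select hX).bind ?_
    intro Z hZ
    refine (Run.ok_select hX).bind ?_
    intro R' hR'
    apply Run.ok_pure
    have hmem : ∀ e, e ∈ Z ↔ e ∈ R ∧ G.IsSNCIn τ F R e := by
      intro e
      rw [hZ, ← isSNCIn_iff_forall_tuple]
      simp only [hgood]
    have hsplit : R = Z ∪ R' := by
      ext e
      rw [Finset.mem_union, hR', hmem]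
      tauto
    have hdisj : Disjoint Z R' := by
      rw [Finset.disjoint_left]
      intro e he he'
      exact ((hR' e).1 he').2 he
    refine ⟨by simp [i1], ?_, ?_, ?_⟩
    · intro e he
      obtain ⟨heR, heZ⟩ := (hR' e).1 he
      refine Finset.mem_filter.2 ⟨i2 heR, fun hs => heZ ((hmem e).2 ⟨heR, hs.isSNCIn i2⟩)⟩
    · dsimp only
      rw [layerUnion_append, Finset.union_assoc, ← hsplit, i3]
    · exact i4.append hsplit hdisj fun e he => ((hmem e).1 he).2
  have hT : ∀ t s, Inv t s → s.1.Nonempty → t < G.layerDepth τ := by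
    rintro t ⟨R, l⟩ ⟨-, i2, -⟩ hne
    by_contra! hle
    have hanti : ∀ k, G.layerDepth τ ≤ k → G.residual τ k = ∅ := by
      intro k hk
      induction k, hk using Nat.le_induction with
      | base => exact residual_layerDepth h
      | succ k _ ih => simp [WeightedSetSystem.residual, ih]
    rw [hanti t hle] at i2
    exact hne.ne_empty (Finset.subset_empty.1 i2)
  have h0 : Inv 0 (E, []) := by
    refine ⟨rfl, ?_, ?_, trivial⟩
    · simp [WeightedSetSystem.residual]
    · simp [layerUnion]
  have hl := Run.ok_whileLoop h1 hbody hT h0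
  refine (hl.bind (R' := 0) (V' := fun l => layerUnion l = E ∧ Layered G τ F ∅ l ∧
    l.length ≤ G.layerDepth τ) ?_).mono (fun _ h => h) ?_ le_rfl
  · rintro ⟨R, l⟩ ⟨hne, t, ht, i1, i2, i3, i4⟩
    have hR : R = ∅ := Finset.not_nonempty_iff_eq_empty.1 hne
    subst hR
    apply Run.ok_pure
    refine ⟨by simpa using i3, i4, by simpa [i1] using ht⟩
  · rw [add_zero]
    norm_num

end Layers

/-! ### The forward phase -/

section Forward

variable {X S : Type} (G : WeightedSetSystem X S)

open WeightedSetSystem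

/-- The invariant of the forward phase on the instance `(E, F)`: the dual variables are feasible,
and almost tight on every picked set. -/
structure ForwardInv (ε : ℝ) (E : Finset X) (F : Finset S) (s : ForwardState X S) : Prop where
  dual_nonneg : ∀ e, 0 ≤ s.dual e
  feasible : ∀ i ∈ F, ∑ e ∈ G.carrier i, s.dual e ≤ G.weight i
  tight : ∀ i ∈ s.picked, (1 - ε) * G.weight i ≤ ∑ e ∈ G.carrier i, s.dual e
  picked_subset : s.picked ⊆ F
  mem_uncov : ∀ e, e ∈ s.uncov ↔ e ∈ E ∧ e ∉ G.covered s.picked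
  mem_avail : ∀ i, i ∈ s.avail ↔ i ∈ F ∧ i ∉ s.picked
  resid_eq : ∀ i ∈ s.avail, s.resid i = G.weight i - ∑ e ∈ G.carrier i, s.dual e
  le_resid : ∀ i ∈ s.avail, ε * G.weight i ≤ s.resid i

/-- The invariant of the epoch of the layer `Z`, which starts in the state `s₀` with the increment
`q`, after `t` passes. The dual variable of an uncovered element of `Z` grows geometrically. -/
structure EpochInv (ε q : ℝ) (E : Finset X) (F : Finset S) (Z : Finset X)
    (s₀ : ForwardState X S) (t : ℕ) (s : ForwardState X S) : Prop
    extends ForwardInv G ε E F s where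
  mem_picked : ∀ i, i ∈ s.picked ↔ i ∈ s₀.picked ∨ i ∈ s.epoch
  passes_eq : s.passes = t
  incr_eq : s.incr = if t = 0 then q else q * ε * (1 + ε) ^ (t - 1)
  dual_eq_start : ∀ e, ¬ (e ∈ s₀.uncov ∧ e ∈ Z) → s.dual e = s₀.dual e
  dual_eq : ∀ e ∈ s.uncov, e ∈ Z → s.dual e = if t = 0 then 0 else q * (1 + ε) ^ (t - 1)
  start : t = 0 → s.avail = s₀.avail ∧ s.uncov = s₀.uncov ∧ s.resid = s₀.resid
  nonempty : 1 ≤ t → (s₀.uncov ∩ Z).Nonempty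
  lt_resid : 1 ≤ t → ∀ i ∈ s.avail, ε * G.weight i < s.resid i

variable {G}

theorem mem_uncov_start {ε q : ℝ} {E Z : Finset X} {F : Finset S} {s₀ s : ForwardState X S} {t : ℕ}
    (h₀ : ForwardInv G ε E F s₀) (h : EpochInv G ε q E F Z s₀ t s) {e : X} (he : e ∈ s.uncov) :
    e ∈ s₀.uncov := by
  obtain ⟨h1, h2⟩ := (h.mem_uncov e).1 he
  refine (h₀.mem_uncov e).2 ⟨h1, fun hc => h2 ?_⟩
  exact covered_mono (fun i hi => (h.mem_picked i).2 (Or.inl hi)) hc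

/-- A set that is available meets uncovered elements of `Z` whose dual variables grow by `s.incr`
each; the total growth is at most what is left of its weight. -/
theorem incr_mul_card_le {ε q : ℝ} (hε : 0 < ε) {E Z : Finset X} {F : Finset S}
    {s₀ s : ForwardState X S} {t : ℕ} (h : EpochInv G ε q E F Z s₀ t s)
    (hq1 : ∀ i ∈ s₀.avail, q * (G.carrier i ∩ s₀.uncov ∩ Z).card ≤ s₀.resid i)
    {i : S} (hi : i ∈ s.avail) :
    s.incr * (G.carrier i ∩ s.uncov ∩ Z).card ≤ s.resid i := by
  rw [h.incr_eq]
  split_ifs with ht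
  · obtain ⟨h1, h2, h3⟩ := h.start ht
    rw [h2, h3]
    exact hq1 i (h1 ▸ hi)
  · have h1 : ∑ e ∈ G.carrier i ∩ s.uncov ∩ Z, s.dual e
        = (G.carrier i ∩ s.uncov ∩ Z).card * (q * (1 + ε) ^ (t - 1)) := by
      rw [← nsmul_eq_mul]
      refine Finset.sum_eq_card_nsmul fun e he => ?_
      obtain ⟨he1, he2⟩ := Finset.mem_inter.1 he
      rw [h.dual_eq e (Finset.mem_inter.1 he1).2 he2, if_neg ht]
    have h2 : ∑ e ∈ G.carrier i ∩ s.uncov ∩ Z, s.dual e ≤ ∑ e ∈ G.carrier i, s.dual e :=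
      Finset.sum_le_sum_of_subset_of_nonneg
        (Finset.inter_subset_left.trans Finset.inter_subset_left) fun e _ _ => h.dual_nonneg e
    have h3 := h.resid_eq i hi
    have h4 := h.le_resid i hi
    have h5 := mul_nonneg hε.le (G.weight_nonneg i)
    calc q * ε * (1 + ε) ^ (t - 1) * (G.carrier i ∩ s.uncov ∩ Z).card
        = ε * ∑ e ∈ G.carrier i ∩ s.uncov ∩ Z, s.dual e := by rw [h1]; ring
      _ ≤ ε * ∑ e ∈ G.carrier i, s.dual e := by gcongr
      _ = ε * (G.weight i - s.resid i) := by rw [h3]; ring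
      _ ≤ s.resid i := by nlinarith

/-- A bound on the number of passes of an epoch in which dual variables grow by at most the factor
`ρ` after the first pass. -/
def passBound (ε ρ : ℝ) : ℕ := ⌊Real.logb (1 + ε) ρ⌋₊ + 2

/-- While an element of `Z` is uncovered, its dual variable `q (1 + ε) ^ (t - 1)` is at most the
weight of any set that contains it. -/
theorem lt_passBound {ε q lo ρ : ℝ} (hε : 0 < ε) (hρ : 0 < ρ)
    {E Z : Finset X} {F : Finset S} (hZE : Z ⊆ E) {s₀ s : ForwardState X S} {t : ℕ}
    (h : EpochInv G ε q E F Z s₀ t s) (hEF : E ⊆ G.covered F)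
    (hw : ∀ i ∈ F, G.weight i ≤ lo * ρ) (hq2 : (s₀.uncov ∩ Z).Nonempty → lo ≤ q)
    (hcond : ¬ Z ⊆ G.covered s.picked) : t < passBound ε ρ := by
  rcases Nat.eq_zero_or_pos t with rfl | ht
  · simp [passBound]
  obtain ⟨e, heZ, hec⟩ := Finset.not_subset.1 hcond
  have heu := (h.mem_uncov e).2 ⟨hZE heZ, hec⟩
  obtain ⟨i, hiF, hei⟩ := mem_covered.1 (hEF (hZE heZ))
  have hav : i ∈ s.avail := (h.mem_avail i).2 ⟨hiF, fun hp => hec (mem_covered.2 ⟨i, hp, hei⟩)⟩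
  have h1 := h.lt_resid ht i hav
  have h2 := h.resid_eq i hav
  have h3 : 0 ≤ ∑ e ∈ G.carrier i, s.dual e := Finset.sum_nonneg fun e _ => h.dual_nonneg e
  have h4 : s.dual e ≤ ∑ e ∈ G.carrier i, s.dual e :=
    Finset.single_le_sum (fun e _ => h.dual_nonneg e) hei
  have h5 := h.dual_eq e heu heZ
  rw [if_neg ht.ne'] at h5
  have hq := hq2 (h.nonempty ht)
  have h6 := hw i hiF
  have hwpos : 0 < G.weight i := by
    have := mul_nonneg hε.le (G.weight_nonneg i)
    linarith
  have hlo : 0 < lo := by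
    by_contra! hle
    nlinarith
  have hpow : 0 < (1 + ε) ^ (t - 1) := by positivity
  have h7 : lo * (1 + ε) ^ (t - 1) ≤ lo * ρ := by
    have h8 : lo * (1 + ε) ^ (t - 1) ≤ q * (1 + ε) ^ (t - 1) := by gcongr
    have h9 := mul_nonneg hε.le (G.weight_nonneg i)
    linarith
  have h8 : (1 + ε) ^ (t - 1) ≤ ρ := le_of_mul_le_mul_left h7 hlo
  have h9 : ((t - 1 : ℕ) : ℝ) ≤ Real.logb (1 + ε) ρ := by
    rw [Real.le_logb_iff_rpow_le (by linarith) hρ, Real.rpow_natCast]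
    exact h8
  have h10 := Nat.le_floor h9
  rw [passBound]
  omega

variable [Fintype X] [Fintype S]

/-- A pass preserves feasibility by `incr_mul_card_le`. A set that stays available keeps more than
the fraction `ε` of its weight, and one that is picked has lost the rest of it. -/
theorem ok_forwardPass {ε q : ℝ} (hε : 0 < ε) (hq : 0 ≤ q) {E Z : Finset X} {F : Finset S}
    (hZE : Z ⊆ E) {s₀ s : ForwardState X S} {t : ℕ} (h₀ : ForwardInv G ε E F s₀)
    (h : EpochInv G ε q E F Z s₀ t s)
    (hq1 : ∀ i ∈ s₀.avail, q * (G.carrier i ∩ s₀.uncov ∩ Z).card ≤ s₀.resid i)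
    (hcond : ¬ Z ⊆ G.covered s.picked) {N : ℕ∞}
    (hX : (Fintype.card X : ℕ∞) ≤ N) (hS : (Fintype.card S : ℕ∞) ≤ N) (hN : 1 ≤ N) :
    (forwardPass G ε q Z s).Ok (EpochInv G ε q E F Z s₀ (t + 1)) 8 N := by
  refine ((Run.ok_par hX).bind (R' := 1 + (1 + (1 + (1 + (1 + (1 + (1 + 0)))))))
    (V' := EpochInv G ε q E F Z s₀ (t + 1)) ?_).mono (fun _ h => h) (by norm_num) le_rfl
  intro y hy
  refine (Run.ok_par hS).bind ?_
  intro w' hw'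
  refine (Run.ok_select hS).bind ?_
  intro C' hC'
  refine (Run.ok_select hS).bind ?_
  intro C hC
  refine (Run.ok_select hS).bind ?_
  intro A hA
  refine (Run.ok_select hX).bind ?_
  intro X' hX'
  refine (Run.ok_select hS).bind ?_
  intro S' hS'
  refine (Run.ok_solo hN).bind ?_
  intro α hα
  apply Run.ok_pure
  have hincr : 0 ≤ s.incr := by
    rw [h.incr_eq]
    split_ifs
    · exact hq
    · positivity
  have hsum : ∀ i, ∑ e ∈ G.carrier i, y e
      = ∑ e ∈ G.carrier i, s.dual e + s.incr * (G.carrier i ∩ s.uncov ∩ Z).card := by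
    intro i
    have h1 : ∀ e, y e = s.dual e + if e ∈ s.uncov ∧ e ∈ Z then s.incr else 0 := by
      intro e
      rw [hy]
      dsimp only
      split_ifs <;> simp
    simp_rw [h1]
    rw [Finset.sum_add_distrib, ← Finset.sum_filter, Finset.sum_const, nsmul_eq_mul, mul_comm]
    congr 4
    ext e
    simp
  have hpicked : ∀ i ∈ s.picked, ∑ e ∈ G.carrier i, y e = ∑ e ∈ G.carrier i, s.dual e := by
    intro i hi
    have : G.carrier i ∩ s.uncov ∩ Z = ∅ := by
      refine Finset.eq_empty_of_forall_notMem fun e he => ?_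
      obtain ⟨he1, he2⟩ := Finset.mem_inter.1 (Finset.mem_inter.1 he).1
      exact ((h.mem_uncov e).1 he2).2 (mem_covered.2 ⟨i, hi, he1⟩)
    rw [hsum, this]
    simp
  have havail : ∀ i ∈ s.avail, w' i = G.weight i - ∑ e ∈ G.carrier i, y e := by
    intro i hi
    rw [hw']
    simp [hi]
  have hcov : G.covered A = G.covered s.picked ∪ G.covered C' := by
    rw [← covered_union]
    congr 1
    ext i
    rw [hA, Finset.mem_union]
  have hlt : ∀ i ∈ S', ε * G.weight i < w' i := by
    intro i hi
    obtain ⟨h1, h2⟩ := (hS' i).1 hi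
    by_contra! hle
    exact h2 ((hC' i).2 ⟨h1, hle⟩)
  constructor
  · constructor
    · intro e
      dsimp only
      rw [hy]
      dsimp only
      have := h.dual_nonneg e
      split_ifs <;> linarith
    · intro i hi
      dsimp only
      by_cases hp : i ∈ s.picked
      · rw [hpicked i hp]
        exact h.feasible i hi
      · have hav := (h.mem_avail i).2 ⟨hi, hp⟩
        have h1 := incr_mul_card_le hε h hq1 hav
        have h2 := h.resid_eq i hav
        rw [hsum]
        linarith
    · intro i hi
      dsimp only at hi ⊢
      rcases (hA i).1 hi with hp | hc
      · rw [hpicked i hp]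
        exact h.tight i hp
      · obtain ⟨h1, h2⟩ := (hC' i).1 hc
        have h3 := havail i h1
        linarith
    · intro i hi
      rcases (hA i).1 hi with hp | hc
      · exact h.picked_subset hp
      · exact ((h.mem_avail i).1 ((hC' i).1 hc).1).1
    · intro e
      dsimp only
      rw [hX', h.mem_uncov, hcov, Finset.mem_union]
      tauto
    · intro i
      dsimp only
      rw [hS', h.mem_avail, hA]
      tauto
    · intro i hi
      exact havail i ((hS' i).1 hi).1
    · intro i hi
      exact (hlt i hi).le
  · intro i
    dsimp only
    rw [hA, hC, h.mem_picked]
    tauto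
  · simp [h.passes_eq]
  · simp [hα, h.passes_eq]
  · intro e he
    dsimp only
    rw [hy]
    dsimp only
    rw [if_neg, h.dual_eq_start e he]
    exact fun hc => he ⟨mem_uncov_start h₀ h hc.1, hc.2⟩
  · intro e he heZ
    dsimp only at he ⊢
    have he' := ((hX' e).1 he).1
    rw [hy]
    dsimp only
    rw [if_pos ⟨he', heZ⟩, h.dual_eq e he' heZ, h.incr_eq, if_neg (Nat.succ_ne_zero t),
      Nat.add_sub_cancel]
    split_ifs with ht
    · simp [ht]
    · obtain ⟨k, rfl⟩ := Nat.exists_eq_succ_of_ne_zero ht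
      simp only [Nat.succ_eq_add_one, Nat.add_sub_cancel]
      ring
  · intro hc
    exact absurd hc (Nat.succ_ne_zero t)
  · intro _
    obtain ⟨e, heZ, hec⟩ := Finset.not_subset.1 hcond
    exact ⟨e, Finset.mem_inter.2 ⟨mem_uncov_start h₀ h ((h.mem_uncov e).2 ⟨hZE heZ, hec⟩), heZ⟩⟩
  · intro _
    exact hlt

/-- The first increment is at least `lo`, because an available set keeps the fraction `ε` of its
weight and has at most as many elements as there are; no weight exceeds `lo * ρ`. -/
theorem ok_forwardEpoch {ε lo ρ : ℝ} (hε : 0 < ε) (hρ : 0 < ρ)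
    {E Z : Finset X} {F : Finset S} (hZE : Z ⊆ E) (hEF : E ⊆ G.covered F)
    (hw : ∀ i ∈ F, G.weight i ≤ lo * ρ) (hlo : ∀ i ∈ F, lo * Fintype.card X ≤ ε * G.weight i)
    {s₀ : ForwardState X S} (h₀ : ForwardInv G ε E F s₀)
    (hZ0 : ∀ e ∈ Z, e ∈ s₀.uncov → s₀.dual e = 0) {N : ℕ∞}
    (hX : (Fintype.card X : ℕ∞) ≤ N) (hS : (Fintype.card S : ℕ∞) ≤ N) (hN : 1 ≤ N) :
    (forwardEpoch G ε Z s₀).Ok (fun s => ForwardInv G ε E F s ∧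
      (∀ i, i ∈ s.picked ↔ i ∈ s₀.picked ∨ i ∈ s.epoch) ∧
      (∀ e, ¬ (e ∈ s₀.uncov ∧ e ∈ Z) → s.dual e = s₀.dual e) ∧ Z ⊆ G.covered s.picked)
      (passBound ε ρ * 9 + 3) N := by
  set V' : ForwardState X S → Prop := fun s => ForwardInv G ε E F s ∧
      (∀ i, i ∈ s.picked ↔ i ∈ s₀.picked ∨ i ∈ s.epoch) ∧
      (∀ e, ¬ (e ∈ s₀.uncov ∧ e ∈ Z) → s.dual e = s₀.dual e) ∧ Z ⊆ G.covered s.picked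
  refine ((Run.ok_par hS).bind (R' := 1 + (passBound ε ρ * (1 + 8) + 1))
    (V' := V') ?_).mono (fun _ h => h) (le_of_eq (by ring)) le_rfl
  rintro ratio rfl
  refine (Run.ok_solo hN).bind ?_
  intro q hqdef
  have hnn : ∀ i ∈ s₀.avail, 0 ≤ s₀.resid i := fun i hi =>
    (mul_nonneg hε.le (G.weight_nonneg i)).trans (h₀.le_resid i hi)
  have hq : 0 ≤ q := by
    rw [hqdef]
    exact Real.iInf_nonneg fun i => div_nonneg (hnn _ i.2.1) (Nat.cast_nonneg _)
  have hq1 : ∀ i ∈ s₀.avail, q * (G.carrier i ∩ s₀.uncov ∩ Z).card ≤ s₀.resid i := by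
    intro i hi
    rcases (G.carrier i ∩ s₀.uncov ∩ Z).eq_empty_or_nonempty with he | hne
    · rw [he]
      simpa using hnn i hi
    · have hpos : (0 : ℝ) < (G.carrier i ∩ s₀.uncov ∩ Z).card := by
        exact_mod_cast Finset.card_pos.2 hne
      rw [← le_div_iff₀ hpos, hqdef]
      exact ciInf_le (f := fun i : {i : S // i ∈ s₀.avail ∧
        (G.carrier i ∩ s₀.uncov ∩ Z).Nonempty} =>
          s₀.resid i.1 / ((G.carrier i.1 ∩ s₀.uncov ∩ Z).card : ℝ))
        (Set.finite_range _).bddBelow ⟨i, hi, hne⟩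
  have hq2 : (s₀.uncov ∩ Z).Nonempty → lo ≤ q := by
    rintro ⟨e, he⟩
    obtain ⟨heu, heZ⟩ := Finset.mem_inter.1 he
    obtain ⟨heE, hec⟩ := (h₀.mem_uncov e).1 heu
    obtain ⟨i, hiF, hei⟩ := mem_covered.1 (hEF heE)
    have hav : i ∈ s₀.avail :=
      (h₀.mem_avail i).2 ⟨hiF, fun hp => hec (mem_covered.2 ⟨i, hp, hei⟩)⟩
    have : Nonempty {i : S // i ∈ s₀.avail ∧ (G.carrier i ∩ s₀.uncov ∩ Z).Nonempty} :=
      ⟨i, hav, e, by simp [hei, heu, heZ]⟩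
    rw [hqdef]
    refine le_ciInf fun j => ?_
    have hpos : (0 : ℝ) < (G.carrier j.1 ∩ s₀.uncov ∩ Z).card := by
      exact_mod_cast Finset.card_pos.2 j.2.2
    rw [le_div_iff₀ hpos]
    rcases le_or_gt lo 0 with hl | hl
    · exact (mul_nonpos_of_nonpos_of_nonneg hl hpos.le).trans (hnn _ j.2.1)
    · refine le_trans ?_ (h₀.le_resid _ j.2.1)
      refine le_trans ?_ (hlo _ ((h₀.mem_avail _).1 j.2.1).1)
      gcongr
      exact Finset.card_le_univ _
  have hinit : EpochInv G ε q E F Z s₀ 0 { s₀ with epoch := ∅, incr := q, passes := 0 } := by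
    refine ⟨⟨h₀.dual_nonneg, h₀.feasible, h₀.tight, h₀.picked_subset, h₀.mem_uncov, h₀.mem_avail,
      h₀.resid_eq, h₀.le_resid⟩, by simp, rfl, by simp, by simp, ?_, by simp, by simp, by simp⟩
    intro e he heZ
    simpa using hZ0 e heZ he
  refine (Run.ok_whileLoop hN (Inv := EpochInv G ε q E F Z s₀)
    (fun t s hs hc => ok_forwardPass hε hq hZE h₀ hs hq1 hc hX hS hN)
    (fun t s hs hc => lt_passBound hε hρ hZE hs hEF hw hq2 hc) hinit).mono ?_ le_rfl le_rfl
  rintro s ⟨hc, t, -, hs⟩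
  exact ⟨hs.toForwardInv, hs.mem_picked, hs.dual_eq_start, not_not.1 hc⟩

variable (G)

/-- The dual variables `y` are almost tight on every picked set, and an element of positive dual
variable is in no set that was picked before the epoch of its layer. -/
def DualFits (ε : ℝ) (F : Finset S) (y : X → ℝ) : List (Finset X × Finset S) → Prop
  | [] => True
  | (_, C) :: rest => C ⊆ F ∧ (∀ i ∈ C, (1 - ε) * G.weight i ≤ ∑ e ∈ G.carrier i, y e) ∧
      (∀ e ∈ layerUnion (rest.map Prod.fst), y e ≠ 0 → e ∉ G.covered C) ∧ DualFits ε F y rest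

/-- Every layer is covered at the end of its epoch; the elements of `P` are covered at the
beginning. -/
def CoversFrom (P : Finset X) : List (Finset X × Finset S) → Prop
  | [] => True
  | (Z, C) :: rest => Z ⊆ P ∪ G.covered C ∧ CoversFrom (P ∪ G.covered C) rest

variable {G}

theorem ok_forwardPhase {ε lo ρ : ℝ} {τ : ℕ} (hε : 0 < ε) (hρ : 0 < ρ)
    {E : Finset X} {F : Finset S} (hEF : E ⊆ G.covered F)
    (hw : ∀ i ∈ F, G.weight i ≤ lo * ρ) (hlo : ∀ i ∈ F, lo * Fintype.card X ≤ ε * G.weight i)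
    {N : ℕ∞} (hX : (Fintype.card X : ℕ∞) ≤ N) (hS : (Fintype.card S : ℕ∞) ≤ N) (hN : 1 ≤ N) :
    ∀ (Zs : List (Finset X)) (s : ForwardState X S), ForwardInv G ε E F s →
      Layered G τ F ∅ Zs → layerUnion Zs ⊆ E → (∀ e ∈ layerUnion Zs, s.dual e = 0) →
      (forwardPhase G ε Zs s).Ok (fun l => l.map Prod.fst = Zs ∧
        CoversFrom G (G.covered s.picked) l ∧ ∃ y : X → ℝ, (∀ e, 0 ≤ y e) ∧
          (∀ i ∈ F, ∑ e ∈ G.carrier i, y e ≤ G.weight i) ∧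
          (∀ e, ¬ (e ∈ s.uncov ∧ e ∈ layerUnion Zs) → y e = s.dual e) ∧ DualFits G ε F y l)
        (Zs.length * (passBound ε ρ * 9 + 3)) N
  | [], s, hs, _, _, _ => by
    refine (Run.ok_pure ?_).mono (fun _ h => h) (by simp) le_rfl
    exact ⟨rfl, trivial, s.dual, hs.dual_nonneg, hs.feasible, fun _ _ => rfl, trivial⟩
  | Z :: Zs, s, hs, ⟨hd, _, hL⟩, hE, h0 => by
    rw [Finset.union_empty] at hd
    have hZ : Z ⊆ layerUnion (Z :: Zs) := Finset.subset_union_left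
    have hZs : layerUnion Zs ⊆ layerUnion (Z :: Zs) := Finset.subset_union_right
    refine ((ok_forwardEpoch hε hρ (hZ.trans hE) hEF hw hlo hs
      (fun e he _ => h0 e (hZ he)) hX hS hN).bind
        (R' := Zs.length * (passBound ε ρ * 9 + 3) + 0) ?_).mono (fun _ h => h) ?_ le_rfl
    · rintro s' ⟨hs', hp, hdual, hcov⟩
      have h0' : ∀ e ∈ layerUnion Zs, s'.dual e = 0 := by
        intro e he
        rw [hdual e fun hc => Finset.disjoint_left.1 hd hc.2 he]
        exact h0 e (hZs he)
      refine (ok_forwardPhase hε hρ hEF hw hlo hX hS hN Zs s' hs' hL (hZs.trans hE) h0').bind ?_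
      rintro l ⟨hl, hcf, y, hy0, hyF, hyd, hfit⟩
      apply Run.ok_pure
      have hpc : G.covered s'.picked = G.covered s.picked ∪ G.covered s'.epoch := by
        rw [← covered_union]
        congr 1
        ext i
        rw [hp, Finset.mem_union]
      have hep : s'.epoch ⊆ s'.picked := fun i hi => (hp i).2 (Or.inr hi)
      refine ⟨by simp [hl], ⟨hpc ▸ hcov, hpc ▸ hcf⟩, y, hy0, hyF, ?_,
        hep.trans hs'.picked_subset, ?_, ?_, hfit⟩
      · intro e he
        have h1 : e ∈ s'.uncov → e ∈ s.uncov := fun h2 => by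
          obtain ⟨h3, h4⟩ := (hs'.mem_uncov e).1 h2
          exact (hs.mem_uncov e).2 ⟨h3, fun h5 => h4 (hpc ▸ Finset.mem_union_left _ h5)⟩
        rw [hyd e fun hc => he ⟨h1 hc.1, hZs hc.2⟩, hdual e fun hc => he ⟨hc.1, hZ hc.2⟩]
      · intro i hi
        refine (hs'.tight i (hep hi)).trans (le_of_eq (Finset.sum_congr rfl fun e he => ?_))
        refine (hyd e fun hc => ?_).symm
        exact ((hs'.mem_uncov e).1 hc.1).2 (mem_covered.2 ⟨i, hep hi, he⟩)
      · intro e he hne hc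
        rw [hl] at he
        refine hne ?_
        rw [hyd e fun hc' => ?_, h0' e he]
        exact ((hs'.mem_uncov e).1 hc'.1).2 (covered_mono hep hc)
    · rw [List.length_cons]
      push_cast
      rw [add_zero, add_mul, one_mul, add_comm]

end Forward

/-! ### Independent sets and base group sets -/

section Base

variable {X S : Type} {G : WeightedSetSystem X S}

open WeightedSetSystem

/-- In a layered list, every element is `τ`-SNC among the elements of its layer and of the later
ones. -/
theorem Layered.isSNCIn_fromLayerOf {τ : ℕ} {F : Finset S} :
    ∀ {Zs : List (Finset X)}, Layered G τ F ∅ Zs → ∀ e ∈ layerUnion Zs,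
      G.IsSNCIn τ F (fromLayerOf e Zs) e
  | [], _, e, he => by simp [layerUnion] at he
  | Z :: Zs, ⟨_, h2, h3⟩, e, he => by
    rw [fromLayerOf]
    split_ifs with hZ
    · simpa [layerUnion] using h2 e hZ
    · refine h3.isSNCIn_fromLayerOf e ?_
      exact (Finset.mem_union.1 he).resolve_left hZ

theorem mem_fromLayerOf {e : X} :
    ∀ {Zs : List (Finset X)}, e ∈ layerUnion Zs → e ∈ fromLayerOf e Zs
  | [], he => by simp [layerUnion] at he
  | Z :: Zs, he => by
    rw [fromLayerOf]
    split_ifs with hZ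
    · exact he
    · exact mem_fromLayerOf ((Finset.mem_union.1 he).resolve_left hZ)

theorem IsMIS.mem_or_adj {H : SimpleGraph X} {V J : Finset X} (h : IsMIS H V J) {x : X}
    (hx : x ∈ V) : x ∈ J ∨ ∃ e ∈ J, H.Adj x e := by
  by_contra! hcon
  obtain ⟨h1, h2⟩ := hcon
  have h3 : insert x J ⊆ J := by
    refine h.2 ⟨Finset.insert_subset hx h.1.1, ?_⟩ (Finset.subset_insert _ _)
    rw [Finset.coe_insert]
    refine h.1.2.insert fun y hy _ => ⟨h2 y hy, fun hadj => h2 y hy hadj.symm⟩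
  exact h1 (h3 (Finset.mem_insert_self _ _))

theorem IsMIS.not_adj {H : SimpleGraph X} {V J : Finset X} (h : IsMIS H V J) {a b : X}
    (ha : a ∈ J) (hb : b ∈ J) : ¬ H.Adj a b := fun hadj =>
  h.1.2 (Finset.mem_coe.2 ha) (Finset.mem_coe.2 hb) hadj.ne hadj

variable [Fintype X]

/-- The set `I` that is found is independent, and every element is in it or adjacent to an
element of `I` of the same or an earlier layer. -/
theorem spec_independentSet {τ : ℕ} {F : Finset S} {M : MISProc X} {δ : ℝ≥0∞} {R N : ℕ∞}
    (hM : ∀ H V, (M H V).Spec δ (IsMIS H V) R N) (hX : (Fintype.card X : ℕ∞) ≤ N)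
    (B : Finset S) (D : X → Finset X) :
    ∀ (Zs : List (Finset X)) (I : Finset X), Layered G τ F ∅ Zs →
      (∀ a ∈ I, ∀ b ∈ I, ¬ (G.nbrGraph B).Adj a b) → (∀ e ∈ I, layerUnion Zs ⊆ D e) →
      (∀ e ∈ layerUnion Zs, D e = fromLayerOf e Zs) →
      (independentSet G M B Zs I).Spec (Zs.length * δ) (fun I' => I ⊆ I' ∧
        I' ⊆ I ∪ layerUnion Zs ∧ (∀ a ∈ I', ∀ b ∈ I', ¬ (G.nbrGraph B).Adj a b) ∧
        ∀ x ∈ layerUnion Zs, x ∈ I' ∨ ∃ e ∈ I', (G.nbrGraph B).Adj x e ∧ x ∈ D e)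
        (Zs.length * (2 + R)) N
  | [], I, _, hI, _, _ => by
    refine (Par.spec_pure ?_).mono (by simp) (fun _ h => h) (by simp) le_rfl
    exact ⟨subset_rfl, Finset.subset_union_left, hI, by simp [layerUnion]⟩
  | Z :: Zs, I, ⟨hd, _, hL⟩, hI, hID, hD => by
    rw [Finset.union_empty] at hd
    refine (Par.spec_lift_bind (Run.ok_select hX) (δ := δ + Zs.length * δ)
      (R' := R + (1 + Zs.length * (2 + R))) ?_).mono ?_ (fun _ h => h) ?_ le_rfl
    · intro V hV
      refine (hM _ V).bind ?_
      intro J hJ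
      refine Par.spec_lift_bind (Run.ok_select hX) ?_
      intro I' hI'
      have hJZ : ∀ e ∈ J, e ∈ Z := fun e he => ((hV e).1 (hJ.1.1 he)).1
      have hZs : layerUnion Zs ⊆ layerUnion (Z :: Zs) := Finset.subset_union_right
      have hDZ : ∀ e ∈ Z, D e = layerUnion (Z :: Zs) := fun e he => by
        rw [hD e (Finset.mem_union_left _ he), fromLayerOf, if_pos he]
      have hI'I : I ⊆ I' := fun e he => (hI' e).2 (Or.inl he)
      refine (spec_independentSet hM hX B D Zs I' hL ?_ ?_ ?_).mono le_rfl ?_ le_rfl le_rfl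
      · intro a ha b hb
        rcases (hI' a).1 ha with ha | ha <;> rcases (hI' b).1 hb with hb | hb
        · exact hI a ha b hb
        · exact fun h => ((hV b).1 (hJ.1.1 hb)).2 a ha h.symm
        · exact ((hV a).1 (hJ.1.1 ha)).2 b hb
        · exact hJ.not_adj ha hb
      · intro e he
        rcases (hI' e).1 he with he | he
        · exact hZs.trans (hID e he)
        · rw [hDZ e (hJZ e he)]
          exact hZs
      · intro e he
        rw [hD e (hZs he), fromLayerOf, if_neg fun h => Finset.disjoint_left.1 hd h he]
      · rintro I'' ⟨h1, h2, h3, h4⟩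
        refine ⟨hI'I.trans h1, fun e he => ?_, h3, fun x hx => ?_⟩
        · rcases Finset.mem_union.1 (h2 he) with h5 | h5
          · rcases (hI' e).1 h5 with h6 | h6
            · exact Finset.mem_union_left _ h6
            · exact Finset.mem_union_right _ (Finset.mem_union_left _ (hJZ e h6))
          · exact Finset.mem_union_right _ (hZs h5)
        · rcases Finset.mem_union.1 hx with hxZ | hxZ
          · by_cases hxI : ∃ e ∈ I, (G.nbrGraph B).Adj x e
            · obtain ⟨e, he, hadj⟩ := hxI
              exact Or.inr ⟨e, h1 (hI'I he), hadj, hID e he hx⟩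
            · have hxV : x ∈ V := (hV x).2 ⟨hxZ, fun e he hadj => hxI ⟨e, he, hadj⟩⟩
              rcases hJ.mem_or_adj hxV with h5 | ⟨e, he, hadj⟩
              · exact Or.inl (h1 ((hI' x).2 (Or.inr h5)))
              · refine Or.inr ⟨e, h1 ((hI' e).2 (Or.inr he)), hadj, ?_⟩
                rw [hDZ e (hJZ e he)]
                exact hx
          · exact h4 x hxZ
    · rw [List.length_cons]
      push_cast
      rw [add_mul, one_mul, add_comm]
    · rw [List.length_cons]
      push_cast
      refine le_of_eq ?_
      ring

variable [Fintype S]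

omit [Fintype X] [Fintype S] in
/-- Some tuple of sets gives a base group set. -/
theorem exists_tuple_isBaseGroup [Nonempty S] {τ : ℕ} {F B : Finset S} {Y : Finset X} {e : X}
    (h : G.IsSNCIn τ F Y e) (hB : B ⊆ F) : ∃ f : Fin τ → S,
      G.IsBaseGroup τ e Y B (G.containing B e ∩ Finset.univ.image f) := by
  obtain ⟨C, hC, hCτ, hCc⟩ := h (G.containing B e) ((Finset.filter_subset _ _).trans hB)
    fun s hs => (mem_containing.1 hs).2
  obtain ⟨f, -, hf⟩ := exists_tuple_of_card_le C hCτ (Classical.arbitrary S)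
  refine ⟨f, Finset.inter_subset_left, ?_, fun x hx => ?_⟩
  · refine (Finset.card_le_card Finset.inter_subset_right).trans ?_
    exact Finset.card_image_le.trans (by simp)
  · obtain ⟨⟨s, hs, hes, hxs⟩, hxY⟩ := mem_restrictedNbhd.1 hx
    obtain ⟨b, hb, hxb⟩ := mem_covered.1
      (hCc (mem_restrictedNbhd.2 ⟨⟨s, mem_containing.2 ⟨hs, hes⟩, hes, hxs⟩, hxY⟩))
    obtain ⟨i, rfl⟩ := hf b hb
    exact mem_covered.2 ⟨f i, Finset.mem_inter.2 ⟨(mem_containing.1 (hC hb)).1,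
      Finset.mem_image_of_mem _ (Finset.mem_univ _)⟩, hxb⟩

/-- In the collection `B`, every set contains exactly one element of `I`, and every element of `I`
is in at most `τ` sets. -/
structure Anchored (G : WeightedSetSystem X S) (τ : ℕ) (I : Finset X) (B : Finset S) : Prop where
  exists_mem : ∀ i ∈ B, ∃ e ∈ I, e ∈ G.carrier i
  unique : ∀ i ∈ B, ∀ e ∈ I, ∀ e' ∈ I, e ∈ G.carrier i → e' ∈ G.carrier i → e = e'
  card_le : ∀ e ∈ I, (G.containing B e).card ≤ τ

omit [Fintype X] [Fintype S] in
theorem Anchored.subset {τ : ℕ} {I : Finset X} {B B' : Finset S} (h : Anchored G τ I B)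
    (hB : B' ⊆ B) : Anchored G τ I B' :=
  ⟨fun i hi => h.exists_mem i (hB hi), fun i hi => h.unique i (hB hi),
    fun e he => (Finset.card_le_card (containing_mono hB e)).trans (h.card_le e he)⟩

theorem ok_baseGroups [Nonempty S] {τ : ℕ} {c : ChoiceRule X S τ} {F B : Finset S}
    {Zs : List (Finset X)} {I : Finset X} (hL : Layered G τ F ∅ Zs) (hB : B ⊆ F)
    (hIZ : I ⊆ layerUnion Zs) (hI : ∀ a ∈ I, ∀ b ∈ I, ¬ (G.nbrGraph B).Adj a b)
    (hdom : ∀ x ∈ layerUnion Zs,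
      x ∈ I ∨ ∃ e ∈ I, (G.nbrGraph B).Adj x e ∧ x ∈ fromLayerOf e Zs) {N : ℕ∞}
    (hX : (Fintype.card X : ℕ∞) ≤ N) (hS : (Fintype.card S : ℕ∞) ≤ N)
    (hP : (Fintype.card (X × (Fin τ → S)) : ℕ∞) ≤ N) :
    (baseGroups G c Zs I B).Ok (fun B' => B' ⊆ B ∧ Anchored G τ I B' ∧
      G.covered B ∩ layerUnion Zs ⊆ G.covered B') 3 N := by
  refine ((Run.ok_select hP).bind (R' := 1 + 1) (V' := fun B' => B' ⊆ B ∧ Anchored G τ I B' ∧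
      G.covered B ∩ layerUnion Zs ⊆ G.covered B') ?_).mono (fun _ h => h) (by norm_num) le_rfl
  intro good hgood
  refine (Run.ok_par hX).bind ?_
  intro base hbase
  refine (Run.ok_select hS).mono ?_ le_rfl le_rfl
  intro B' hB'
  have hbg : ∀ e ∈ I, G.IsBaseGroup τ e (fromLayerOf e Zs) B (base e) := by
    intro e he
    obtain ⟨f, hf⟩ := exists_tuple_isBaseGroup (hL.isSNCIn_fromLayerOf e (hIZ he)) hB
    have hne : (Finset.univ.filter fun f => (e, f) ∈ good).Nonempty :=
      ⟨f, by simpa [hgood] using hf⟩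
    have h2 := (hgood _).1 (Finset.mem_filter.1 (c.pickTuple_mem e _ hne)).2
    rw [hbase]
    exact h2
  have hsub : B' ⊆ B := by
    intro i hi
    obtain ⟨e, he, hie⟩ := (hB' i).1 hi
    exact (mem_containing.1 ((hbg e he).1 hie)).1
  have huniq : ∀ i ∈ B, ∀ e ∈ I, ∀ e' ∈ I, e ∈ G.carrier i → e' ∈ G.carrier i → e = e' := by
    intro i hi e he e' he' h1 h2
    by_contra hne
    exact hI e he e' he' ⟨hne, i, hi, h1, h2⟩
  refine ⟨hsub, ⟨?_, fun i hi => huniq i (hsub hi), ?_⟩, ?_⟩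
  · intro i hi
    obtain ⟨e, he, hie⟩ := (hB' i).1 hi
    exact ⟨e, he, (mem_containing.1 ((hbg e he).1 hie)).2⟩
  · intro e he
    refine (Finset.card_le_card fun i hi => ?_).trans (hbg e he).2.1
    obtain ⟨hi1, hi2⟩ := mem_containing.1 hi
    obtain ⟨e', he', hie'⟩ := (hB' i).1 hi1
    rwa [huniq i (hsub hi1) e he e' he' hi2 (mem_containing.1 ((hbg e' he').1 hie')).2]
  · intro x hx
    obtain ⟨hxB, hxZ⟩ := Finset.mem_inter.1 hx
    have key : ∀ e ∈ I, (∃ s ∈ B, e ∈ G.carrier s ∧ x ∈ G.carrier s) → x ∈ fromLayerOf e Zs →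
        x ∈ G.covered B' := by
      intro e he h1 h2
      obtain ⟨b, hb, hxb⟩ := mem_covered.1 ((hbg e he).2.2 (mem_restrictedNbhd.2 ⟨h1, h2⟩))
      exact mem_covered.2 ⟨b, (hB' b).2 ⟨e, he, hb⟩, hxb⟩
    rcases hdom x hxZ with hxI | ⟨e, he, ⟨-, s, hs, h1, h2⟩, h3⟩
    · obtain ⟨s, hs, hxs⟩ := mem_covered.1 hxB
      refine key x hxI ⟨s, hs, hxs, hxs⟩ ?_
      exact mem_fromLayerOf hxZ
    · exact key e he ⟨s, hs, h2, h1⟩ h3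

omit [Fintype X] [Fintype S] in
/-- Every set of the collection contains at most one element of `I`. -/
theorem Anchored.card_filter_le {τ : ℕ} {I : Finset X} {B D : Finset S} (h : Anchored G τ I B)
    (hD : D ⊆ B) : (I.filter fun a => ∃ d ∈ D, a ∈ G.carrier d).card ≤ D.card := by
  have h1 : (I.filter fun a => ∃ d ∈ D, a ∈ G.carrier d) ⊆
      D.biUnion fun d => I.filter fun a => a ∈ G.carrier d := by
    intro a ha
    obtain ⟨haI, d, hd, had⟩ := Finset.mem_filter.1 ha
    exact Finset.mem_biUnion.2 ⟨d, hd, Finset.mem_filter.2 ⟨haI, had⟩⟩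
  refine (Finset.card_le_card h1).trans ?_
  refine (Finset.card_biUnion_le_card_mul _ _ 1 fun d hd => ?_).trans (by simp)
  refine Finset.card_le_one.2 fun a ha b hb => ?_
  obtain ⟨ha1, ha2⟩ := Finset.mem_filter.1 ha
  obtain ⟨hb1, hb2⟩ := Finset.mem_filter.1 hb
  exact h.unique d (hD hd) a ha1 b hb1 ha2 hb2

omit [Fintype X] [Fintype S] in
/-- The sets that contain `e` are reached from the at most `τ` elements of `I` that lie in the sets
of a base group set of `e`. -/
theorem Anchored.card_containing_le {τ : ℕ} {I U : Finset X} {B F : Finset S}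
    (h : Anchored G τ I B) (hIU : I ⊆ U) (hB : B ⊆ F) {e : X} (he : G.IsSNCIn τ F U e) :
    (G.containing B e).card ≤ τ * τ := by
  obtain ⟨D, hD, hDτ, hDc⟩ := he (G.containing B e) ((Finset.filter_subset _ _).trans hB)
    fun s hs => (mem_containing.1 hs).2
  have hDB : D ⊆ B := fun d hd => (mem_containing.1 (mem_containing.1 (hD hd)).1).1
  have h1 : G.containing B e ⊆
      (I.filter fun a => ∃ d ∈ D, a ∈ G.carrier d).biUnion (G.containing B) := by
    intro i hi
    obtain ⟨hiB, hei⟩ := mem_containing.1 hi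
    obtain ⟨a, haI, hai⟩ := h.exists_mem i hiB
    refine Finset.mem_biUnion.2 ⟨a, Finset.mem_filter.2 ⟨haI, ?_⟩, mem_containing.2 ⟨hiB, hai⟩⟩
    exact mem_covered.1 (hDc (mem_restrictedNbhd.2 ⟨⟨i, hi, hei, hai⟩, hIU haI⟩))
  refine (Finset.card_le_card h1).trans ?_
  refine (Finset.card_biUnion_le_card_mul _ _ τ fun a ha =>
    h.card_le a (Finset.mem_filter.1 ha).1).trans ?_
  gcongr
  exact (h.card_filter_le hDB).trans hDτ

end Base

/-! ### Random deletion -/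

namespace Par

variable {α : Type}

theorem prob_exists_le (p : Par α) {ι : Type} (s : Finset ι) (E : ι → Run α → Prop) :
    p.prob (fun r => ∃ i ∈ s, E i r) ≤ ∑ i ∈ s, p.prob (E i) := by
  induction s using Finset.induction_on with
  | empty =>
    rw [prob_eq_expect]
    simp [expect]
  | insert a s ha ih =>
    rw [Finset.sum_insert ha]
    refine le_trans ?_ ((prob_or_le p _ _).trans (add_le_add_right ih _))
    refine prob_mono ?_
    rintro r ⟨i, hi, hr⟩
    rcases Finset.mem_insert.1 hi with rfl | hi
    · exact Or.inl hr
    · exact Or.inr ⟨i, hi, hr⟩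

/-- A sure specification together with a bound on the probability of a further event. -/
theorem Spec.and_prob {p : Par α} {δ δ' : ℝ≥0∞} {V V' : α → Prop} {R N : ℕ∞}
    (h : p.Spec δ V R N) (h' : p.prob (fun r => ¬ V' r.val) ≤ δ') :
    p.Spec (δ + δ') (fun a => V a ∧ V' a) R N := by
  refine le_trans (prob_mono fun r hr => ?_) ((prob_or_le p _ _).trans (add_le_add h h'))
  by_contra! hcon
  exact hr ⟨⟨hcon.1.1, hcon.2⟩, hcon.1.2⟩

variable {ι β : Type} [Fintype ι] [Fintype β]

theorem prodPMF_apply (p : ι → PMF β) (f : ι → β) : prodPMF p f = ∏ i, p i (f i) :=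
  PMF.ofFintype_apply _ _

theorem expect_draw (p : ι → PMF β) (φ : Run (ι → β) → ℝ≥0∞) :
    (draw p).expect φ = ∑' f, prodPMF p f * φ (Run.par f) := tsum_map_mul _ _ _

theorem spec_draw {p : ι → PMF β} {V : (ι → β) → Prop} {N : ℕ∞}
    (hN : (Fintype.card ι : ℕ∞) ≤ N) (h : ∀ f, (∀ i, f i ∈ (p i).support) → V f) :
    (draw p).Spec 0 V 1 N := by
  rw [Spec, prob_eq_expect, expect_draw, nonpos_iff_eq_zero, ENNReal.tsum_eq_zero]
  intro f
  by_cases hf : prodPMF p f = 0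
  · rw [hf, zero_mul]
  · have hV : V f := by
      refine h f fun i => ?_
      rw [prodPMF_apply, Finset.prod_eq_zero_iff] at hf
      rw [PMF.mem_support_iff]
      exact fun h0 => hf ⟨i, Finset.mem_univ i, h0⟩
    have : (Run.par f).Ok V 1 N := ⟨hV, ENat.one_ne_top, le_rfl, hN⟩
    simp [this]

/-- The probability that independent random variables lie in given sets. -/
theorem tsum_prodPMF_box (p : ι → PMF β) (t : ι → Finset β)
    [∀ f : ι → β, Decidable (∀ i, f i ∈ t i)] :
    ∑' f, prodPMF p f * (if ∀ i, f i ∈ t i then 1 else 0) = ∏ i, ∑ a ∈ t i, p i a := by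
  rw [tsum_fintype, Finset.prod_univ_sum]
  simp_rw [mul_ite, mul_one, mul_zero, prodPMF_apply]
  rw [← Finset.sum_filter]
  refine Finset.sum_congr ?_ fun _ _ => rfl
  ext f
  simp

end Par

section Trim

variable {X S : Type} {G : WeightedSetSystem X S}

open WeightedSetSystem

theorem subset_of_mem_support_randomSub {N Q : Finset S} (h : Q ∈ (randomSub N).support) :
    Q ⊆ N := by
  rw [randomSub, PMF.mem_support_bind_iff] at h
  obtain ⟨b, -, hb⟩ := h
  split_ifs at hb
  · rw [PMF.mem_support_uniformOfFinset_iff] at hb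
    exact (Finset.mem_powersetCard.1 hb).1
  · rw [PMF.mem_support_pure_iff] at hb
    exact hb.subset

theorem randomSub_self_ge (N : Finset S) : 2⁻¹ ≤ randomSub N N := by
  rw [randomSub, PMF.bind_apply]
  refine le_trans ?_ (ENNReal.le_tsum false)
  simp [PMF.uniformOfFintype_apply]

theorem randomSub_erase_ge {N : Finset S} {s : S} (hs : s ∈ N) :
    2⁻¹ * (N.card : ℝ≥0∞)⁻¹ ≤ randomSub N (N.erase s) := by
  rw [randomSub, PMF.bind_apply]
  refine le_trans ?_ (ENNReal.le_tsum true)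
  have h1 : N.erase s ∈ N.powersetCard (N.card - 1) :=
    Finset.mem_powersetCard.2 ⟨Finset.erase_subset _ _, Finset.card_erase_of_mem hs⟩
  have h2 : N.card.choose (N.card - 1) = N.card := by
    have hpos := Finset.card_pos.2 ⟨s, hs⟩
    rw [Nat.choose_symm_of_eq_add (b := 1) (by omega), Nat.choose_one_right]
  simp [PMF.uniformOfFintype_apply, PMF.uniformOfFinset_apply_of_mem _ h1,
    Finset.card_powersetCard, h2]

variable [Fintype S]

theorem sum_powerset_randomSub (N : Finset S) : ∑ Q ∈ N.powerset, randomSub N Q = 1 := by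
  rw [← (randomSub N).tsum_coe, tsum_fintype]
  refine Finset.sum_subset (Finset.subset_univ _) fun Q _ hQ => ?_
  rw [PMF.apply_eq_zero_iff]
  exact fun h => hQ (Finset.mem_powerset.2 (subset_of_mem_support_randomSub h))

/-- The law of the collection `Q(e)` in a pass of the deletion phase. -/
def trimLaw (G : WeightedSetSystem X S) (I : Finset X) (B : Finset S) (e : X) : PMF (Finset S) :=
  if e ∈ I then randomSub (G.containing B e) else PMF.pure ∅

/-- What is left of `B` after the deletion of the redundant sets, if the collections `Q(e)` are
drawn. -/
def trimmed (G : WeightedSetSystem X S) (U I : Finset X) (B : Finset S) (Q : X → Finset S) :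
    Finset S :=
  B.filter fun i => ¬ ((¬ ∃ e ∈ I, i ∈ Q e) ∧
    G.carrier i ∩ U ⊆ G.covered (Finset.univ.filter fun i => ∃ e ∈ I, i ∈ Q e))

/-- The deterministic part of a pass, after the collections `Q(e)` are drawn. -/
theorem ok_trimPass_tail {U I : Finset X} {B : Finset S} (Q : X → Finset S) {N : ℕ∞}
    (hS : (Fintype.card S : ℕ∞) ≤ N) :
    (do let K ← Run.select fun i => ∃ e ∈ I, i ∈ Q e
        let R ← Run.select fun i => i ∈ B ∧ i ∉ K ∧ G.carrier i ∩ U ⊆ G.covered K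
        Run.select fun i => i ∈ B ∧ i ∉ R : Run (Finset S)).Ok
      (fun B' => B' = trimmed G U I B Q) 3 N := by
  refine ((Run.ok_select hS).bind (R' := 1 + 1) (V' := fun B' => B' = trimmed G U I B Q)
    ?_).mono (fun _ h => h) (by norm_num) le_rfl
  intro K hK
  refine (Run.ok_select hS).bind ?_
  intro R hR
  refine (Run.ok_select hS).mono ?_ le_rfl le_rfl
  intro B' hB'
  have hK' : K = Finset.univ.filter fun i => ∃ e ∈ I, i ∈ Q e := by
    ext i
    rw [hK]
    simp
  ext i
  rw [hB', hR, trimmed, Finset.mem_filter, ← hK', hK]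
  tauto

variable [Fintype X]

theorem spec_trimPass {U I : Finset X} {B : Finset S} {N : ℕ∞}
    (hX : (Fintype.card X : ℕ∞) ≤ N) (hS : (Fintype.card S : ℕ∞) ≤ N) :
    (trimPass G U I B).Spec 0 (fun B' => B' ⊆ B ∧ G.covered B ∩ U ⊆ G.covered B') 4 N := by
  have hdraw : (Par.draw fun e => trimLaw G I B e).Spec 0
      (fun Q => ∀ e ∈ I, Q e ⊆ G.containing B e) 1 N := by
    refine Par.spec_draw hX fun Q hQ e he => ?_
    have := hQ e
    rw [trimLaw, if_pos he] at this
    exact subset_of_mem_support_randomSub this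
  refine (hdraw.bind (δ' := 0) (R' := 1 + (1 + 1)) (V' := fun B' => B' ⊆ B ∧
    G.covered B ∩ U ⊆ G.covered B') fun Q hQ => ?_).mono (by simp) (fun _ h => h)
    (by norm_num) le_rfl
  refine Par.spec_lift_bind (Run.ok_select hS) ?_
  intro K hK
  refine Par.spec_lift_bind (Run.ok_select hS) ?_
  intro R hR
  refine Par.spec_lift ((Run.ok_select hS).mono ?_ le_rfl le_rfl)
  intro B' hB'
  refine ⟨fun i hi => ((hB' i).1 hi).1, fun x hx => ?_⟩
  obtain ⟨hxB, hxU⟩ := Finset.mem_inter.1 hx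
  obtain ⟨i, hi, hxi⟩ := mem_covered.1 hxB
  by_cases hiR : i ∈ R
  · obtain ⟨k, hk, hxk⟩ := mem_covered.1 (((hR i).1 hiR).2.2 (Finset.mem_inter.2 ⟨hxi, hxU⟩))
    obtain ⟨e, he, hke⟩ := (hK k).1 hk
    exact mem_covered.2 ⟨k, (hB' k).2 ⟨(mem_containing.1 (hQ e he hke)).1,
      fun h => ((hR k).1 h).2.1 hk⟩, hxk⟩
  · exact mem_covered.2 ⟨i, (hB' i).2 ⟨hi, hiR⟩, hxi⟩

theorem expect_trimPass {U I : Finset X} {B : Finset S} (φ : Finset S → ℝ≥0∞) :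
    (trimPass G U I B).expect (fun r => φ r.val)
      = ∑' Q, prodPMF (trimLaw G I B) Q * φ (trimmed G U I B Q) := by
  have h : (trimPass G U I B).expect (fun r => φ r.val) =
      (Par.draw fun e => trimLaw G I B e).expect fun r => φ (trimmed G U I B r.val) := by
    refine (Par.expect_bind _ _ _).trans ?_
    congr 1
    funext r
    have h1 := (ok_trimPass_tail (G := G) (U := U) (I := I) (B := B) r.val (N := ⊤) le_top).1
    rw [← h1, Par.expect_bind, Par.expect_lift, Par.expect_bind, Par.expect_lift,
      Par.expect_lift]
    rfl
  rw [h, Par.expect_draw]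
  rfl

omit [Fintype X] in
/-- If the collections `Q(e)` contain the collection `D` that is as good as all sets containing `e`,
but not the set `s`, then `s` is deleted. -/
theorem card_containing_trimmed_lt {U I : Finset X} {B D : Finset S} {Q : X → Finset S} {e : X}
    {s : S} (hs : s ∈ G.containing B e) (hsQ : ∀ a ∈ I, s ∉ Q a)
    (hD : ∀ d ∈ D, ∃ a ∈ I, d ∈ Q a)
    (hDc : G.restrictedNbhd e U (G.containing B e) ⊆ G.covered D) :
    (G.containing (trimmed G U I B Q) e).card < (G.containing B e).card := by
  obtain ⟨hsB, hes⟩ := mem_containing.1 hs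
  refine Finset.card_lt_card ⟨containing_mono (Finset.filter_subset _ _) e, fun hsub => ?_⟩
  have h1 := (Finset.mem_filter.1 (mem_containing.1 (hsub hs)).1).2
  refine h1 ⟨fun ⟨a, ha, hsa⟩ => hsQ a ha hsa, fun x hx => ?_⟩
  obtain ⟨hxs, hxU⟩ := Finset.mem_inter.1 hx
  refine covered_mono (fun d hd => ?_)
    (hDc (mem_restrictedNbhd.2 ⟨⟨s, hs, hes, hxs⟩, hxU⟩))
  exact Finset.mem_filter.2 ⟨Finset.mem_univ _, hD d hd⟩

/-- While an element is in more than `τ` sets, a pass deletes one of them with probability at least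
`1 / (τ 2 ^ (τ + 1))`: some set `s` is redundant given at most `τ` of the others. It suffices that
the element of `I` in `s` proposes `s`, and that the at most `τ` elements of `I` in the others
propose nothing. -/
theorem le_prob_card_containing_lt {τ : ℕ} {F : Finset S} {U I : Finset X} {B : Finset S}
    (hB : Anchored G τ I B) (hBF : B ⊆ F) {e : X} (he : G.IsSNCIn τ F U e)
    (hcard : τ < (G.containing B e).card) :
    2⁻¹ * (τ : ℝ≥0∞)⁻¹ * 2⁻¹ ^ τ ≤ ∑' Q, prodPMF (trimLaw G I B) Q *
      (if (G.containing (trimmed G U I B Q) e).card < (G.containing B e).card then 1 else 0) := by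
  obtain ⟨D, hD, hDτ, hDc⟩ := he (G.containing B e) ((Finset.filter_subset _ _).trans hBF)
    fun s hs => (mem_containing.1 hs).2
  have hDN : D ⊆ G.containing B e := fun d hd => (mem_containing.1 (hD hd)).1
  have hDB : D ⊆ B := fun d hd => (mem_containing.1 (hDN hd)).1
  obtain ⟨s, hs, hsD⟩ : ∃ s ∈ G.containing B e, s ∉ D := by
    by_contra! hcon
    exact absurd (Finset.card_le_card (fun s hs => hcon s hs : G.containing B e ⊆ D)) (by omega)
  obtain ⟨hsB, hes⟩ := mem_containing.1 hs
  obtain ⟨a, haI, has⟩ := hB.exists_mem s hsB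
  have hsa : s ∈ G.containing B a := mem_containing.2 ⟨hsB, has⟩
  set W : Finset X := (I.filter fun b => ∃ d ∈ D, b ∈ G.carrier d).erase a with hW
  have hWτ : W.card ≤ τ :=
    (Finset.card_le_card (Finset.erase_subset _ _)).trans ((hB.card_filter_le hDB).trans hDτ)
  let t : X → Finset (Finset S) := fun b =>
    if b = a then {(G.containing B a).erase s}
    else if b ∈ W then {G.containing B b} else (G.containing B b).powerset
  have hgood : ∀ Q : X → Finset S, (∀ b, Q b ∈ t b) →
      (G.containing (trimmed G U I B Q) e).card < (G.containing B e).card := by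
    intro Q hQ
    have hQa : Q a = (G.containing B a).erase s := by simpa [t] using hQ a
    have hQW : ∀ b ∈ W, Q b = G.containing B b := fun b hb => by
      have := hQ b
      simp only [t] at this
      rw [if_neg (Finset.ne_of_mem_erase hb), if_pos hb] at this
      exact Finset.mem_singleton.1 this
    have hQs : ∀ b, Q b ⊆ G.containing B b := by
      intro b
      by_cases hba : b = a
      · rw [hba, hQa]
        exact Finset.erase_subset _ _
      · by_cases hbW : b ∈ W
        · rw [hQW b hbW]
        · have := hQ b
          simp only [t] at this
          rw [if_neg hba, if_neg hbW] at this
          exact Finset.mem_powerset.1 this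
    refine card_containing_trimmed_lt hs (fun b hb hsb => ?_) (fun d hd => ?_) hDc
    · have hba := hB.unique s hsB b hb a haI (mem_containing.1 (hQs b hsb)).2 has
      rw [hba, hQa] at hsb
      exact (Finset.mem_erase.1 hsb).1 rfl
    · obtain ⟨b, hb, hbd⟩ := hB.exists_mem d (hDB hd)
      refine ⟨b, hb, ?_⟩
      have hdb : d ∈ G.containing B b := mem_containing.2 ⟨hDB hd, hbd⟩
      by_cases hba : b = a
      · rw [hba, hQa]
        refine Finset.mem_erase.2 ⟨fun h => hsD (h ▸ hd), hba ▸ hdb⟩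
      · rwa [hQW b (Finset.mem_erase.2 ⟨hba, Finset.mem_filter.2 ⟨hb, d, hd, hbd⟩⟩)]
  calc 2⁻¹ * (τ : ℝ≥0∞)⁻¹ * 2⁻¹ ^ τ
      ≤ ∏ b, ((if b = a then 2⁻¹ * (τ : ℝ≥0∞)⁻¹ else 1) * if b ∈ W then 2⁻¹ else 1) := by
        rw [Finset.prod_mul_distrib, Finset.prod_ite_eq' Finset.univ a,
          if_pos (Finset.mem_univ a), Finset.prod_ite_mem, Finset.univ_inter, Finset.prod_const]
        exact mul_le_mul' le_rfl
          (pow_le_pow_right_of_le_one' (ENNReal.inv_le_one.2 one_le_two) hWτ)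
    _ ≤ ∏ b, ∑ q ∈ t b, trimLaw G I B b q := by
        refine Finset.prod_le_prod' fun b _ => ?_
        by_cases hba : b = a
        · have haW : a ∉ W := Finset.notMem_erase _ _
          subst hba
          simp only [t, if_true, if_neg haW, mul_one, Finset.sum_singleton]
          rw [trimLaw, if_pos haI]
          refine le_trans ?_ (randomSub_erase_ge hsa)
          gcongr
          exact_mod_cast hB.card_le b haI
        · by_cases hbW : b ∈ W
          · have hbI : b ∈ I := (Finset.mem_filter.1 (Finset.mem_of_mem_erase hbW)).1
            simp only [t, if_neg hba, if_pos hbW, one_mul, Finset.sum_singleton]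
            rw [trimLaw, if_pos hbI]
            exact randomSub_self_ge _
          · simp only [t, if_neg hba, if_neg hbW, one_mul]
            rw [trimLaw]
            split_ifs
            · rw [sum_powerset_randomSub]
            · refine le_trans ?_ (Finset.single_le_sum (fun _ _ => zero_le)
                (Finset.empty_mem_powerset _))
              simp
    _ = ∑' Q, prodPMF (trimLaw G I B) Q * (if ∀ b, Q b ∈ t b then 1 else 0) :=
        (Par.tsum_prodPMF_box _ _).symm
    _ ≤ _ := by
        refine ENNReal.tsum_le_tsum fun Q => ?_
        gcongr
        split_ifs with h1 h2
        · exact le_rfl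
        · exact absurd (hgood Q h1) h2
        · exact zero_le
        · exact le_rfl

/-- The potential of an element that is in `c` sets: it is halved when one of these is deleted. -/
def trimPotential (τ c : ℕ) : ℝ≥0∞ := if c ≤ τ then 0 else 2 ^ c

theorem trimPotential_ne_top (τ c : ℕ) : trimPotential τ c ≠ ⊤ := by
  rw [trimPotential]
  split_ifs <;> simp

theorem trimPotential_mono (τ : ℕ) {c c' : ℕ} (h : c ≤ c') :
    trimPotential τ c ≤ trimPotential τ c' := by
  rw [trimPotential, trimPotential]
  split_ifs
  · exact le_rfl
  · exact zero_le
  · omega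
  · gcongr
    norm_num

theorem two_mul_trimPotential_le (τ : ℕ) {c c' : ℕ} (h : c < c') :
    2 * trimPotential τ c ≤ trimPotential τ c' := by
  rw [trimPotential, trimPotential]
  split_ifs
  · simp
  · simp
  · omega
  · rw [← pow_succ']
    gcongr
    · norm_num
    · exact h

/-- The factor by which the expected potential of an element decreases in every pass. -/
def trimFactor (τ : ℕ) : ℝ := 1 - 1 / (τ * 2 ^ (τ + 2))

theorem ofReal_trimFactor_add {τ : ℕ} (hτ : 1 ≤ τ) :
    ENNReal.ofReal (trimFactor τ) + 2⁻¹ * (2⁻¹ * (τ : ℝ≥0∞)⁻¹ * 2⁻¹ ^ τ) = 1 := by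
  have hτ' : (1 : ℝ) ≤ τ := by exact_mod_cast hτ
  have h1 : (2⁻¹ : ℝ≥0∞) * (2⁻¹ * (τ : ℝ≥0∞)⁻¹ * 2⁻¹ ^ τ)
      = ENNReal.ofReal (1 / (τ * 2 ^ (τ + 2))) := by
    have h2 : (1 : ℝ) / (τ * 2 ^ (τ + 2)) = 2⁻¹ * (2⁻¹ * (τ : ℝ)⁻¹ * 2⁻¹ ^ τ) := by
      rw [pow_add, inv_pow]
      field_simp
    have h3 : (2⁻¹ : ℝ≥0∞) = ENNReal.ofReal 2⁻¹ := by
      rw [ENNReal.ofReal_inv_of_pos (by norm_num)]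
      simp
    have h4 : (τ : ℝ≥0∞)⁻¹ = ENNReal.ofReal (τ : ℝ)⁻¹ := by
      rw [ENNReal.ofReal_inv_of_pos (by linarith)]
      simp
    rw [h2, h3, h4, ← ENNReal.ofReal_pow (by norm_num), ← ENNReal.ofReal_mul (by norm_num),
      ← ENNReal.ofReal_mul (by positivity), ← ENNReal.ofReal_mul (by norm_num)]
  have h5 : (1 : ℝ) / (τ * 2 ^ (τ + 2)) ≤ 1 := by
    rw [div_le_one (by positivity)]
    have : (1 : ℝ) ≤ 2 ^ (τ + 2) := one_le_pow₀ (by norm_num)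
    nlinarith
  rw [h1, ← ENNReal.ofReal_add (by rw [trimFactor]; linarith) (by positivity), trimFactor]
  simp

theorem expect_trimPass_potential_le {τ : ℕ} (hτ : 1 ≤ τ) {F : Finset S} {U I : Finset X}
    {B : Finset S} (hB : Anchored G τ I B) (hBF : B ⊆ F) {e : X} (he : G.IsSNCIn τ F U e) :
    (trimPass G U I B).expect (fun r => trimPotential τ (G.containing r.val e).card)
      ≤ ENNReal.ofReal (trimFactor τ) * trimPotential τ (G.containing B e).card := by
  rw [expect_trimPass fun B' => trimPotential τ (G.containing B' e).card]
  set φ := trimPotential τ (G.containing B e).card with hφ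
  set c := (2⁻¹ : ℝ≥0∞) * (2⁻¹ * (τ : ℝ≥0∞)⁻¹ * 2⁻¹ ^ τ) with hc
  have hle : ∀ Q, trimPotential τ (G.containing (trimmed G U I B Q) e).card ≤ φ := fun Q =>
    trimPotential_mono τ (Finset.card_le_card (containing_mono (Finset.filter_subset _ _) e))
  by_cases hcard : (G.containing B e).card ≤ τ
  · have h0 : φ = 0 := by rw [hφ, trimPotential, if_pos hcard]
    have h1 : ∀ Q, trimPotential τ (G.containing (trimmed G U I B Q) e).card = 0 := fun Q =>
      nonpos_iff_eq_zero.1 ((hle Q).trans h0.le)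
    simp [h1]
  · have h1 := le_prob_card_containing_lt (U := U) hB hBF he (not_le.1 hcard)
    have hcφ : c * φ ≠ ⊤ := by
      refine ENNReal.mul_ne_top ?_ (trimPotential_ne_top _ _)
      have := (ofReal_trimFactor_add hτ)
      intro htop
      rw [← hc, htop] at this
      simp at this
    refine (ENNReal.add_le_add_iff_right hcφ).1 ?_
    rw [← add_mul, hc, ofReal_trimFactor_add hτ, one_mul]
    calc _ ≤ ∑' Q, prodPMF (trimLaw G I B) Q *
              trimPotential τ (G.containing (trimmed G U I B Q) e).card
            + 2⁻¹ * (∑' Q, prodPMF (trimLaw G I B) Q * (if (G.containing (trimmed G U I B Q) e).card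
                < (G.containing B e).card then 1 else 0)) * φ := by gcongr
      _ = ∑' Q, prodPMF (trimLaw G I B) Q *
            (trimPotential τ (G.containing (trimmed G U I B Q) e).card
              + 2⁻¹ * (if (G.containing (trimmed G U I B Q) e).card
                < (G.containing B e).card then 1 else 0) * φ) := by
          rw [← ENNReal.tsum_mul_left, ← ENNReal.tsum_mul_right, ← ENNReal.tsum_add]
          refine tsum_congr fun Q => ?_
          ring
      _ ≤ ∑' Q, prodPMF (trimLaw G I B) Q * φ := by
          refine ENNReal.tsum_le_tsum fun Q => ?_
          gcongr
          split_ifs with hlt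
          · have h2 := two_mul_trimPotential_le τ hlt
            rw [← hφ] at h2
            have h3 : trimPotential τ (G.containing (trimmed G U I B Q) e).card ≤ 2⁻¹ * φ := by
              rw [mul_comm, ← div_eq_mul_inv, ENNReal.le_div_iff_mul_le (by simp) (by simp),
                mul_comm]
              exact h2
            calc _ ≤ 2⁻¹ * φ + 2⁻¹ * 1 * φ := by gcongr
              _ = φ := by rw [mul_one, ← add_mul, ENNReal.inv_two_add_inv_two, one_mul]
          · simpa using hle Q
      _ = φ := by rw [ENNReal.tsum_mul_right, PMF.tsum_coe, one_mul]

theorem spec_trimLoop {U I : Finset X} {N : ℕ∞}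
    (hX : (Fintype.card X : ℕ∞) ≤ N) (hS : (Fintype.card S : ℕ∞) ≤ N) :
    ∀ (k : ℕ) (B : Finset S), (trimLoop G U I k B).Spec 0
      (fun B' => B' ⊆ B ∧ G.covered B ∩ U ⊆ G.covered B') (k * 4) N
  | 0, B => (Par.spec_pure ⟨subset_rfl, Finset.inter_subset_left⟩).mono le_rfl (fun _ h => h)
      (by simp) le_rfl
  | k + 1, B => by
    refine ((spec_trimPass hX hS).bind (δ' := 0) (R' := k * 4) fun B' hB' => ?_).mono (by simp)
      (fun _ h => h) (by push_cast; rw [add_mul, one_mul, add_comm]) le_rfl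
    refine (spec_trimLoop hX hS k B').mono le_rfl ?_ le_rfl le_rfl
    intro B'' hB''
    refine ⟨hB''.1.trans hB'.1, fun x hx => hB''.2 (Finset.mem_inter.2 ⟨hB'.2 hx, ?_⟩)⟩
    exact (Finset.mem_inter.1 hx).2

theorem expect_trimLoop_potential_le {τ : ℕ} (hτ : 1 ≤ τ) {F : Finset S} {U I : Finset X} {e : X}
    (he : G.IsSNCIn τ F U e) : ∀ (k : ℕ) (B : Finset S), Anchored G τ I B → B ⊆ F →
      (trimLoop G U I k B).expect (fun r => trimPotential τ (G.containing r.val e).card)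
        ≤ ENNReal.ofReal (trimFactor τ) ^ k * trimPotential τ (G.containing B e).card
  | 0, B, _, _ => by
    rw [trimLoop, Par.expect_pure, pow_zero, one_mul]
    exact le_rfl
  | k + 1, B, hB, hBF => by
    rw [trimLoop, Par.expect_bind]
    have hsub : ∀ r ∈ (trimPass G U I B).outcomes, r.val ⊆ B := fun r hr =>
      (Par.spec_zero_iff.1 (spec_trimPass (N := ⊤) le_top le_top) r hr).1.1
    refine (Par.expect_mono fun r hr => expect_trimLoop_potential_le hτ he k r.val
      (hB.subset (hsub r hr)) ((hsub r hr).trans hBF)).trans ?_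
    rw [Par.expect_mul_left, pow_succ, mul_assoc]
    gcongr
    exact expect_trimPass_potential_le hτ hB hBF he

/-- After `k` passes, an element is in more than `τ` sets with small probability. For `τ = 1`, it is
in at most `τ * τ = τ` sets from the beginning. -/
theorem prob_trimLoop_le {τ : ℕ} (hτ : 1 ≤ τ) {F : Finset S} {U I : Finset X} (hIU : I ⊆ U) {e : X}
    (he : G.IsSNCIn τ F U e) (k : ℕ) {B : Finset S} (hB : Anchored G τ I B) (hBF : B ⊆ F) :
    2 ^ (τ + 1) * (trimLoop G U I k B).prob (fun r => ¬ (G.containing r.val e).card ≤ τ)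
      ≤ ENNReal.ofReal (trimFactor τ) ^ k * (if τ = 1 then 0 else 2 ^ (τ * τ)) := by
  refine (Par.prob_mul_le_expect (φ := fun r => trimPotential τ (G.containing r.val e).card)
    fun r hr => ?_).trans ((expect_trimLoop_potential_le hτ he k B hB hBF).trans ?_)
  · rw [trimPotential, if_neg hr]
    gcongr
    · norm_num
    · omega
  · gcongr
    have h1 := hB.card_containing_le hIU hBF he
    rw [trimPotential]
    split_ifs with h2 h3 h3
    · exact le_rfl
    · exact zero_le
    · subst h3
      omega
    · gcongr
      norm_num

end Trim

/-! ### The deletion phase -/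

section Deletion

variable {X S : Type} {G : WeightedSetSystem X S} [Fintype X] [Fintype S]

open WeightedSetSystem

/-- The bound on the number of sets is claimed if `b` holds, up to a failure probability `δ` for
each element. -/
theorem spec_trimLoop_card {τ : ℕ} (hτ : 1 ≤ τ) {F : Finset S} {U I Z : Finset X} (hIU : I ⊆ U)
    (hZ : ∀ e ∈ Z, G.IsSNCIn τ F U e) (k : ℕ) {B : Finset S} (hB : Anchored G τ I B) (hBF : B ⊆ F)
    (b : Prop) {δ : ℝ≥0∞}
    (hδ : b → ENNReal.ofReal (trimFactor τ) ^ k * (if τ = 1 then 0 else 2 ^ (τ * τ))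
      ≤ 2 ^ (τ + 1) * δ) {N : ℕ∞}
    (hX : (Fintype.card X : ℕ∞) ≤ N) (hS : (Fintype.card S : ℕ∞) ≤ N) :
    (trimLoop G U I k B).Spec (Z.card * δ)
      (fun B' => (B' ⊆ B ∧ G.covered B ∩ U ⊆ G.covered B') ∧
        (b → ∀ e ∈ Z, (G.containing B' e).card ≤ τ)) (k * 4) N := by
  refine ((spec_trimLoop hX hS k B).and_prob (δ' := Z.card * δ) ?_).mono (by simp)
    (fun _ h => h) le_rfl le_rfl
  by_cases hb : b
  · refine (Par.prob_mono (E' := fun r => ∃ e ∈ Z, ¬ (G.containing r.val e).card ≤ τ)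
      fun r hr => ?_).trans ((Par.prob_exists_le _ Z
        fun e r => ¬ (G.containing r.val e).card ≤ τ).trans ?_)
    · by_contra! hcon
      exact hr fun _ => hcon
    · refine (Finset.sum_le_card_nsmul Z _ δ fun e he => ?_).trans (by rw [nsmul_eq_mul])
      have h1 := (prob_trimLoop_le hτ hIU (hZ e he) k hB hBF).trans (hδ hb)
      exact (ENNReal.mul_le_mul_iff_right (by positivity) (by finiteness)).1 h1
  · have : ∀ r : Run (Finset S), ¬ ¬ (b → ∀ e ∈ Z, (G.containing r.val e).card ≤ τ) :=
      fun r h => h fun h' => absurd h' hb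
    rw [Par.prob_eq_expect]
    simp only [this, if_false, Par.expect_const, zero_le]

/-- The induction runs over the layers from the last one to the first. Coverage holds relative to any
collection of elements covered before the first of these layers. An element of positive dual
variable is in none of the sets that earlier epochs contribute, so that the bound on its number of
sets survives the later iterations; that bound is claimed under the condition `b`. -/
theorem spec_deletionPhase [Nonempty S] {τ : ℕ} (hτ : 1 ≤ τ) {c : ChoiceRule X S τ} {F : Finset S}
    {ε : ℝ} {y : X → ℝ} {M : MISProc X} {δM : ℝ≥0∞} {R N : ℕ∞}
    (hM : ∀ H V, (M H V).Spec δM (IsMIS H V) R N) (n : ℕ) (b : Prop) {δ : ℝ≥0∞}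
    (hδ : b → ENNReal.ofReal (trimFactor τ) ^ trimCount τ n *
      (if τ = 1 then 0 else 2 ^ (τ * τ)) ≤ 2 ^ (τ + 1) * δ)
    (hX : (Fintype.card X : ℕ∞) ≤ N) (hS : (Fintype.card S : ℕ∞) ≤ N)
    (hP : (Fintype.card (X × (Fin τ → S)) : ℕ∞) ≤ N) :
    ∀ l : List (Finset X × Finset S), Layered G τ F ∅ (l.map Prod.fst) → DualFits G ε F y l →
      (deletionPhase G c M n l).Spec
        ((layerUnion (l.map Prod.fst)).card * δ + (l.length ^ 2 : ℕ) * δM)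
        (fun A => (∀ i ∈ A, i ∈ F ∧ (1 - ε) * G.weight i ≤ ∑ e ∈ G.carrier i, y e) ∧
          (∀ P, CoversFrom G P l → layerUnion (l.map Prod.fst) ⊆ P ∪ G.covered A) ∧
          (b → ∀ e ∈ layerUnion (l.map Prod.fst), y e ≠ 0 → (G.containing A e).card ≤ τ))
        ((l.length ^ 2 : ℕ) * (2 + R) + l.length * (trimCount τ n * 4 + 4)) N
  | [], _, _ => by
    refine (Par.spec_pure ?_).mono (by simp) (fun _ h => h) (by simp) le_rfl
    simp [layerUnion]
  | (Z, C) :: rest, hL, ⟨hCF, hCt, hCy, hfit⟩ => by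
    set Ys := rest.map Prod.fst with hYs
    have hLc : Layered G τ F ∅ (Z :: Ys) := hL
    obtain ⟨hd, hZ, hL'⟩ := hL
    rw [Finset.union_empty] at hd hZ
    have hmap : ((Z, C) :: rest).map Prod.fst = Z :: Ys := rfl
    have hlen : Ys.length = rest.length := by simp [hYs]
    have hU : layerUnion (Z :: Ys) = Z ∪ layerUnion Ys := rfl
    rw [hmap]
    refine ((spec_deletionPhase hτ hM n b hδ hX hS hP rest hL' hfit).bind
      (δ' := (Z :: Ys).length * δM + Z.card * δ)
      (R' := 1 + ((Z :: Ys).length * (2 + R) + (3 + trimCount τ n * 4)))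
      ?_).mono ?_ (fun _ h => h) ?_ le_rfl
    · rintro A ⟨hAF, hAc, hAy⟩
      refine Par.spec_lift_bind (Run.ok_select hS) ?_
      intro B hB
      have hBF : B ⊆ F := fun i hi => ((hB i).1 hi).elim (fun h => (hAF i h).1) fun h => hCF h
      have hBt : ∀ i ∈ B, (1 - ε) * G.weight i ≤ ∑ e ∈ G.carrier i, y e := fun i hi =>
        ((hB i).1 hi).elim (fun h => (hAF i h).2) fun h => hCt i h
      refine (spec_independentSet hM hX B (fun e => fromLayerOf e (Z :: Ys)) (Z :: Ys) ∅ hLc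
        (by simp) (by simp) (fun _ _ => rfl)).bind ?_
      rintro I ⟨-, hIU, hI, hdom⟩
      rw [Finset.empty_union] at hIU
      refine Par.spec_lift_bind (ok_baseGroups (c := c) hLc hBF hIU hI hdom hX hS hP) ?_
      rintro B' ⟨hB'B, hanch, hcov⟩
      refine (spec_trimLoop_card hτ hIU hZ (trimCount τ n) hanch (hB'B.trans hBF) b hδ
        hX hS).mono le_rfl ?_ le_rfl le_rfl
      rintro A' ⟨⟨hA'B, hA'c⟩, hA'n⟩
      have hsub : A' ⊆ B := hA'B.trans hB'B
      refine ⟨fun i hi => ⟨hBF (hsub hi), hBt i (hsub hi)⟩, fun P hPc x hx => ?_, fun hb e he hye => ?_⟩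
      · have hxB : x ∈ P ∨ x ∈ G.covered B := by
          have hBC : G.covered C ⊆ G.covered B := covered_mono fun i hi => (hB i).2 (Or.inr hi)
          have hBA : G.covered A ⊆ G.covered B := covered_mono fun i hi => (hB i).2 (Or.inl hi)
          rcases Finset.mem_union.1 hx with hxZ | hxY
          · exact (Finset.mem_union.1 (hPc.1 hxZ)).imp_right fun h => hBC h
          · rcases Finset.mem_union.1 (hAc _ hPc.2 hxY) with h | h
            · exact (Finset.mem_union.1 h).imp_right fun h => hBC h
            · exact Or.inr (hBA h)
        refine Finset.mem_union.2 (hxB.imp_right fun h => ?_)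
        exact hA'c (Finset.mem_inter.2 ⟨hcov (Finset.mem_inter.2 ⟨h, hx⟩), hx⟩)
      · rcases Finset.mem_union.1 he with heZ | heY
        · exact hA'n hb e heZ
        · refine (Finset.card_le_card fun i hi => ?_).trans (hAy hb e heY hye)
          obtain ⟨hi1, hi2⟩ := mem_containing.1 hi
          refine mem_containing.2 ⟨((hB i).1 (hsub hi1)).resolve_right fun hiC => ?_, hi2⟩
          exact hCy e heY hye (mem_covered.2 ⟨i, hiC, hi2⟩)
    · rw [hU, Finset.card_union_of_disjoint hd, List.length_cons, List.length_cons, hlen]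
      calc _ = ((Z.card + (layerUnion Ys).card : ℕ) : ℝ≥0∞) * δ
              + ((rest.length ^ 2 + (rest.length + 1) : ℕ) : ℝ≥0∞) * δM := by push_cast; ring
        _ ≤ _ := by
            gcongr
            nlinarith
    · rw [List.length_cons, List.length_cons, hlen]
      calc _ = ((rest.length ^ 2 + (rest.length + 1) : ℕ) : ℕ∞) * (2 + R)
              + ((rest.length + 1 : ℕ) : ℕ∞) * (trimCount τ n * 4 + 4) := by
            push_cast
            ring
        _ ≤ _ := by
            gcongr
            nlinarith

end Deletion

/-- The number of passes suffices to reduce the potential of an element from `2 ^ (τ * τ)` to less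
than `2 ^ (τ + 1) / n ^ 3`: it drops by the factor `n ^ (τ * τ)`, because the product of the number
of passes and `1 / (τ 2 ^ (τ + 2))` is at least `τ ^ 2 * logb 2 n`. -/
theorem trimFactor_pow_trimCount_le {τ n : ℕ} (hτ : 1 ≤ τ) (hn : 2 ≤ n) :
    ENNReal.ofReal (trimFactor τ) ^ trimCount τ n * (if τ = 1 then 0 else 2 ^ (τ * τ))
      ≤ 2 ^ (τ + 1) * ((n : ℝ≥0∞) ^ 3)⁻¹ := by
  split_ifs with h1
  · simp
  have hτ2 : 2 ≤ τ := by omega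
  have hn' : (2 : ℝ) ≤ n := by exact_mod_cast hn
  have hn0 : (0 : ℝ) < n := by linarith
  have hτ' : (2 : ℝ) ≤ τ := by exact_mod_cast hτ2
  set p : ℝ := 1 / (τ * 2 ^ (τ + 2)) with hp
  have hlog0 : 0 ≤ Real.log n := Real.log_nonneg (by linarith)
  have hlogb : Real.log n ≤ Real.logb 2 n := by
    rw [Real.logb, le_div_iff₀ (Real.log_pos (by norm_num))]
    have : Real.log 2 ≤ 1 := by linarith [Real.log_two_lt_d9]
    nlinarith
  have hcount : (τ : ℝ) ^ 2 * Real.log n ≤ p * trimCount τ n := by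
    have h2 : 4 * (τ : ℝ) ^ 3 * 2 ^ τ * Real.logb 2 n ≤ trimCount τ n := by
      rw [trimCount]
      push_cast
      exact (Nat.lt_floor_add_one _).le
    calc (τ : ℝ) ^ 2 * Real.log n ≤ (τ : ℝ) ^ 2 * Real.logb 2 n := by gcongr
      _ = p * (4 * (τ : ℝ) ^ 3 * 2 ^ τ * Real.logb 2 n) := by
          rw [hp, pow_add]
          field_simp
          norm_num
      _ ≤ _ := by gcongr
  have hfac : trimFactor τ ≤ Real.exp (-p) := by
    have := Real.add_one_le_exp (-p)
    rw [trimFactor]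
    linarith
  have hpow : Real.exp (-p) ^ trimCount τ n ≤ ((n : ℝ) ^ (τ * τ))⁻¹ := by
    rw [← Real.exp_nat_mul]
    have h3 : ((n : ℝ) ^ (τ * τ))⁻¹ = Real.exp (-((τ : ℝ) ^ 2 * Real.log n)) := by
      rw [Real.exp_neg, ← Real.exp_log (show (0 : ℝ) < (n : ℝ) ^ (τ * τ) by positivity),
        Real.log_pow]
      push_cast
      ring_nf
    rw [h3]
    refine Real.exp_le_exp.2 ?_
    linarith
  have hreal : Real.exp (-p) ^ trimCount τ n * 2 ^ (τ * τ) ≤ 2 ^ (τ + 1) * ((n : ℝ) ^ 3)⁻¹ := by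
    refine (mul_le_mul_of_nonneg_right hpow (by positivity)).trans ?_
    rw [inv_mul_le_iff₀ (by positivity), ← div_eq_mul_inv, mul_div_assoc', le_div_iff₀
      (by positivity)]
    -- Since `2 ≤ n`, the powers of `2` in the excess `τ * τ - (τ + 1)` are powers of `n` at most.
    obtain ⟨k, hk⟩ : ∃ k, τ * τ = τ + 1 + k := ⟨τ * τ - (τ + 1), by
      have : 2 * τ ≤ τ * τ := Nat.mul_le_mul_right τ hτ2
      omega⟩
    have h4 : (2 : ℝ) ^ k ≤ (n : ℝ) ^ k := by gcongr
    have h5 : (n : ℝ) ^ 3 ≤ (n : ℝ) ^ (τ + 1) := pow_le_pow_right₀ (by linarith) (by omega)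
    calc (2 : ℝ) ^ (τ * τ) * (n : ℝ) ^ 3 = 2 ^ (τ + 1) * (2 ^ k * (n : ℝ) ^ 3) := by
          rw [hk, pow_add]; ring
      _ ≤ 2 ^ (τ + 1) * ((n : ℝ) ^ k * (n : ℝ) ^ (τ + 1)) := by gcongr
      _ = (n : ℝ) ^ (τ * τ) * 2 ^ (τ + 1) := by rw [hk, pow_add (n : ℝ)]; ring
  calc _ ≤ ENNReal.ofReal (Real.exp (-p)) ^ trimCount τ n * 2 ^ (τ * τ) := by gcongr
    _ = ENNReal.ofReal (Real.exp (-p) ^ trimCount τ n * 2 ^ (τ * τ)) := by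
        rw [ENNReal.ofReal_mul (by positivity), ENNReal.ofReal_pow (by positivity),
          ENNReal.ofReal_pow (by positivity)]
        simp
    _ ≤ ENNReal.ofReal (2 ^ (τ + 1) * ((n : ℝ) ^ 3)⁻¹) := ENNReal.ofReal_le_ofReal hreal
    _ = _ := by
        rw [ENNReal.ofReal_mul (by positivity), ENNReal.ofReal_inv_of_pos (by positivity),
          ENNReal.ofReal_pow (by positivity), ENNReal.ofReal_pow (by positivity)]
        simp

/-! ### Luby's procedure -/

section Luby

variable {X : Type} (H : SimpleGraph X)

theorem isMIS_of {V I : Finset X} (h1 : I ⊆ V) (h2 : ∀ a ∈ I, ∀ b ∈ I, ¬ H.Adj a b)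
    (h3 : ∀ x ∈ V, x ∉ I → ∃ e ∈ I, H.Adj x e) : IsMIS H V I := by
  refine ⟨⟨h1, fun a ha b hb _ => h2 a ha b hb⟩, fun J hJ hIJ x hx => ?_⟩
  by_contra hxI
  obtain ⟨e, he, hadj⟩ := h3 x (hJ.1 hx) hxI
  exact hJ.2 (Finset.mem_coe.2 hx) (Finset.mem_coe.2 (hIJ he)) hadj.ne hadj

variable [Fintype X]

/-- The vertices of `V` that rank before all their neighbors in `V`. -/
def lubyPick (V : Finset X) (π : X ≃ Fin (Fintype.card X)) : Finset X :=
  V.filter fun e => ∀ e' ∈ V, H.Adj e e' → π e < π e'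

/-- The vertices that are left after a pass of Luby's procedure with the ranking `π`. -/
def lubyRest (V : Finset X) (π : X ≃ Fin (Fintype.card X)) : Finset X :=
  V.filter fun e => e ∉ lubyPick H V π ∧ ∀ e' ∈ lubyPick H V π, ¬ H.Adj e e'

variable {H}

theorem mem_lubyPick {V : Finset X} {π : X ≃ Fin (Fintype.card X)} {e : X} :
    e ∈ lubyPick H V π ↔ e ∈ V ∧ ∀ e' ∈ V, H.Adj e e' → π e < π e' := Finset.mem_filter

theorem mem_lubyRest {V : Finset X} {π : X ≃ Fin (Fintype.card X)} {e : X} :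
    e ∈ lubyRest H V π ↔
      e ∈ V ∧ e ∉ lubyPick H V π ∧ ∀ e' ∈ lubyPick H V π, ¬ H.Adj e e' := Finset.mem_filter

theorem card_lubyRest_lt {V : Finset X} (hV : V.Nonempty) (π : X ≃ Fin (Fintype.card X)) :
    (lubyRest H V π).card < V.card := by
  obtain ⟨e, he, hmin⟩ := Finset.exists_min_image V π hV
  refine Finset.card_lt_card ⟨Finset.filter_subset _ _, fun hs => ?_⟩
  refine (mem_lubyRest.1 (hs he)).2.1 (mem_lubyPick.2 ⟨he, fun e' he' hadj => ?_⟩)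
  exact lt_of_le_of_ne (hmin e' he') fun h => hadj.ne (π.injective h)

theorem isMIS_union_of_lubyRest {V I : Finset X} {π : X ≃ Fin (Fintype.card X)}
    (h : IsMIS H (lubyRest H V π) I) : IsMIS H V (lubyPick H V π ∪ I) := by
  have hI : ∀ a ∈ I, a ∈ lubyRest H V π := fun a ha => h.1.1 ha
  have hpick : ∀ a ∈ lubyPick H V π, ∀ b ∈ lubyPick H V π, ¬ H.Adj a b := fun a ha b hb hadj =>
    lt_asymm ((mem_lubyPick.1 ha).2 b (mem_lubyPick.1 hb).1 hadj)
      ((mem_lubyPick.1 hb).2 a (mem_lubyPick.1 ha).1 hadj.symm)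
  refine isMIS_of H ?_ ?_ ?_
  · exact Finset.union_subset (Finset.filter_subset _ _)
      fun a ha => (mem_lubyRest.1 (hI a ha)).1
  · intro a ha b hb
    rcases Finset.mem_union.1 ha with ha | ha <;> rcases Finset.mem_union.1 hb with hb | hb
    · exact hpick a ha b hb
    · exact fun hadj => (mem_lubyRest.1 (hI b hb)).2.2 a ha hadj.symm
    · exact (mem_lubyRest.1 (hI a ha)).2.2 b hb
    · exact h.not_adj ha hb
  · intro x hx hxn
    by_contra! hcon
    have hxr : x ∈ lubyRest H V π := mem_lubyRest.2 ⟨hx,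
      fun hxp => hxn (Finset.mem_union_left _ hxp), fun e he => hcon e (Finset.mem_union_left _ he)⟩
    rcases h.mem_or_adj hxr with hxI | ⟨e, he, hadj⟩
    · exact hxn (Finset.mem_union_right _ hxI)
    · exact hcon e (Finset.mem_union_right _ he) hadj

theorem select_lubyPick (V : Finset X) (π : X ≃ Fin (Fintype.card X)) :
    (Run.select fun e => e ∈ V ∧ ∀ e' ∈ V, H.Adj e e' → π e < π e').val = lubyPick H V π := by
  ext e
  rw [mem_lubyPick]
  simp [Run.select]

theorem select_lubyRest (V : Finset X) (π : X ≃ Fin (Fintype.card X)) :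
    (Run.select fun e => e ∈ V ∧ e ∉ lubyPick H V π ∧
      ∀ e' ∈ lubyPick H V π, ¬ H.Adj e e').val = lubyRest H V π := by
  ext e
  rw [mem_lubyRest]
  simp [Run.select]

theorem Par.spec_soloDraw {α : Type} (p : PMF α) {N : ℕ∞} (hN : 1 ≤ N) :
    (Par.soloDraw p).Spec 0 (fun _ => True) 1 N := by
  rw [Par.spec_zero_iff]
  intro r hr
  obtain ⟨a, -, rfl⟩ := (PMF.mem_support_map_iff _ _ _).1 hr
  exact (Run.ok_solo hN).mono (fun _ _ => trivial) le_rfl le_rfl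

/-- Luby's procedure ends with a maximal independent set. -/
theorem spec_lubyLoop {N : ℕ∞} (hX : (Fintype.card X : ℕ∞) ≤ N) (hN : 1 ≤ N) :
    ∀ (fuel : ℕ) (V : Finset X), V.card ≤ fuel →
      (lubyLoop H fuel V).Spec 0 (IsMIS H V) ⊤ N
  | 0, V, hV => by
    have hV0 : V = ∅ := Finset.card_eq_zero.1 (by omega)
    subst hV0
    exact (Par.spec_pure (isMIS_of H (by simp) (by simp) (by simp))).mono le_rfl (fun _ h => h)
      le_top le_rfl
  | fuel + 1, V, hV => by
    refine (Par.spec_lift_bind (Run.ok_solo hN) (R' := ⊤) ?_).mono le_rfl (fun _ h => h)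
      le_top le_rfl
    rintro left rfl
    by_cases hne : V.Nonempty
    · simp only [hne, decide_true, if_true]
      refine ((Par.spec_soloDraw (randomRanking X) hN).bind (δ' := 0) (R' := ⊤) ?_).mono (by simp)
        (fun _ h => h) le_top le_rfl
      intro π _
      have h1 : (Run.select fun e => e ∈ V ∧ ∀ e' ∈ V, H.Adj e e' → π e < π e').Ok
          (fun J => J = lubyPick H V π) 1 N := ⟨select_lubyPick V π, (Run.ok_select hX).2⟩
      refine (Par.spec_lift_bind h1 (R' := ⊤) ?_).mono le_rfl (fun _ h => h) le_top le_rfl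
      rintro J rfl
      have h2 : (Run.select fun e => e ∈ V ∧ e ∉ lubyPick H V π ∧
          ∀ e' ∈ lubyPick H V π, ¬ H.Adj e e').Ok
          (fun V' => V' = lubyRest H V π) 1 N := ⟨select_lubyRest V π, (Run.ok_select hX).2⟩
      refine (Par.spec_lift_bind h2 (R' := ⊤) ?_).mono le_rfl (fun _ h => h) le_top le_rfl
      rintro V' rfl
      have hlt := card_lubyRest_lt (H := H) hne π
      refine ((spec_lubyLoop hX hN fuel (lubyRest H V π) (by omega)).bind (δ' := 0) (R' := 1)
        ?_).mono (by simp) (fun _ h => h) le_top le_rfl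
      intro I hI
      refine Par.spec_lift ((Run.ok_select hX).mono ?_ le_rfl le_rfl)
      intro I' hI'
      have : I' = lubyPick H V π ∪ I := by
        ext e
        rw [hI', Finset.mem_union]
      rw [this]
      exact isMIS_union_of_lubyRest hI
    · have hV0 : V = ∅ := Finset.not_nonempty_iff_eq_empty.1 hne
      subst hV0
      simp only [Finset.not_nonempty_empty, decide_false, Bool.false_eq_true, if_false]
      exact (Par.spec_pure (isMIS_of H (by simp) (by simp) (by simp))).mono le_rfl (fun _ h => h)
        le_top le_rfl

theorem spec_luby {N : ℕ∞} (hX : (Fintype.card X : ℕ∞) ≤ N) (hN : 1 ≤ N) (V : Finset X) :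
    (luby X H V).Spec 0 (IsMIS H V) ⊤ N := spec_lubyLoop hX hN _ V le_rfl

theorem luby_correct : (luby X).Correct := fun H V r hr => by
  have := Par.spec_zero_iff.1 (spec_luby (H := H) (N := ⊤) le_top le_top V) r hr
  exact ⟨this.2.1, this.1⟩

/-- Among the elements of `W`, every element is equally likely to come first in a ranking. -/
theorem card_equiv_le_mul_card_first {W : Finset X} {u : X} (hu : u ∈ W) :
    Fintype.card (X ≃ Fin (Fintype.card X)) ≤ W.card *
      (Finset.univ.filter fun π : X ≃ Fin (Fintype.card X) =>
        ∀ w ∈ W, w ≠ u → π u < π w).card := by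
  set P : X → Finset (X ≃ Fin (Fintype.card X)) := fun v =>
    Finset.univ.filter fun π => ∀ w ∈ W, w ≠ v → π v < π w with hP
  have hcov : (Finset.univ : Finset (X ≃ Fin (Fintype.card X))) ⊆ W.biUnion P := by
    intro π _
    obtain ⟨v, hv, hmin⟩ := Finset.exists_min_image W π ⟨u, hu⟩
    refine Finset.mem_biUnion.2 ⟨v, hv, Finset.mem_filter.2 ⟨Finset.mem_univ _, fun w hw hne => ?_⟩⟩
    exact lt_of_le_of_ne (hmin w hw) fun h => hne (π.injective h).symm
  refine (Finset.card_le_card hcov).trans (Finset.card_biUnion_le_card_mul _ _ _ fun v hv => ?_)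
  refine Finset.card_le_card_of_injOn (fun π => (Equiv.swap u v).trans π) ?_ ?_
  · intro π hπ
    have hπ' := (Finset.mem_filter.1 (Finset.mem_coe.1 hπ)).2
    refine Finset.mem_coe.2 (Finset.mem_filter.2 ⟨Finset.mem_univ _, fun w hw hne => ?_⟩)
    simp only [Equiv.trans_apply, Equiv.swap_apply_left]
    refine hπ' _ ?_ ?_
    · rw [Equiv.swap_apply_def]
      split_ifs
      · exact hv
      · exact hu
      · exact hw
    · intro h
      have := congrArg (Equiv.swap u v) h
      exact hne (by simpa using this)
  · intro π _ π' _ h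
    ext x
    have := congrArg (fun ρ : X ≃ Fin (Fintype.card X) => ρ ((Equiv.swap u v) x)) h
    simpa using congrArg Fin.val this

variable (H)

omit [Fintype X] in
/-- The edges of the graph on `V`, each with both orientations. -/
def darts (V : Finset X) : Finset (X × X) := (V ×ˢ V).filter fun p => H.Adj p.1 p.2

omit [Fintype X] in
/-- The neighbors of `v` in `V`. -/
def nbrs (V : Finset X) (v : X) : Finset X := V.filter fun x => H.Adj v x

/-- The vertex `u` ranks before all other neighbors of `u` and of `v`. -/
def First (V : Finset X) (u v : X) (π : X ≃ Fin (Fintype.card X)) : Prop :=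
  ∀ w ∈ nbrs H V u ∪ nbrs H V v, w ≠ u → π u < π w

variable {H}

omit [Fintype X] in
theorem mem_nbrs {V : Finset X} {v x : X} : x ∈ nbrs H V v ↔ x ∈ V ∧ H.Adj v x :=
  Finset.mem_filter

omit [Fintype X] in
theorem card_darts (V : Finset X) : (darts H V).card = ∑ v ∈ V, (nbrs H V v).card := by
  rw [darts, Finset.card_filter, Finset.sum_product]
  refine Finset.sum_congr rfl fun v _ => ?_
  rw [nbrs, Finset.card_filter]

/-- In a pass with the ranking `π`, a vertex `v` is discarded if some neighbor is first among the
neighbors of both, and at most one neighbor is. The darts that start in `v` are then discarded. -/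
theorem sum_first_add_card_darts_le (V : Finset X) (π : X ≃ Fin (Fintype.card X)) :
    (∑ v ∈ V, ∑ u ∈ nbrs H V v, if First H V u v π then (nbrs H V v).card else 0)
      + (darts H (lubyRest H V π)).card ≤ (darts H V).card := by
  have h1 : (darts H (lubyRest H V π)).card ≤ ∑ v ∈ lubyRest H V π, (nbrs H V v).card := by
    rw [card_darts]
    refine Finset.sum_le_sum fun v _ => Finset.card_le_card ?_
    exact Finset.filter_subset_filter _ (Finset.filter_subset _ _)
  have hsub : lubyRest H V π ⊆ V := Finset.filter_subset _ _
  have hfirst : ∀ v ∈ V, ∀ u ∈ nbrs H V v, First H V u v π → v ∉ lubyRest H V π := by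
    intro v hv u hu hF hr
    obtain ⟨huV, hadj⟩ := mem_nbrs.1 hu
    refine (mem_lubyRest.1 hr).2.2 u (mem_lubyPick.2 ⟨huV, fun w hw hw' => ?_⟩) hadj
    exact hF w (Finset.mem_union_left _ (mem_nbrs.2 ⟨hw, hw'⟩)) hw'.ne'
  have h2 : (∑ v ∈ lubyRest H V π, ∑ u ∈ nbrs H V v,
      if First H V u v π then (nbrs H V v).card else 0) = 0 := by
    refine Finset.sum_eq_zero fun v hv => Finset.sum_eq_zero fun u hu => ?_
    rw [if_neg fun hF => hfirst v (hsub hv) u hu hF hv]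
  have h3 := Finset.sum_sdiff hsub (f := fun v => (nbrs H V v).card)
  have h4 := Finset.sum_sdiff hsub (f := fun v => ∑ u ∈ nbrs H V v,
    if First H V u v π then (nbrs H V v).card else 0)
  suffices h5 : (∑ v ∈ V \ lubyRest H V π, ∑ u ∈ nbrs H V v,
      if First H V u v π then (nbrs H V v).card else 0)
        ≤ ∑ v ∈ V \ lubyRest H V π, (nbrs H V v).card by
    rw [card_darts V]
    omega
  refine Finset.sum_le_sum fun v _ => ?_
  rw [← Finset.sum_filter, Finset.sum_const, smul_eq_mul]
  refine (Nat.mul_le_mul_right _ (Finset.card_le_one.2 ?_)).trans (one_mul _).le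
  intro a ha b hb
  obtain ⟨ha1, ha2⟩ := Finset.mem_filter.1 ha
  obtain ⟨hb1, hb2⟩ := Finset.mem_filter.1 hb
  by_contra hne
  exact lt_asymm (ha2 b (Finset.mem_union_right _ hb1) (Ne.symm hne))
    (hb2 a (Finset.mem_union_right _ ha1) hne)

/-- The number of rankings in which `u` is first among its neighbors and those of `v`. -/
def firstCount (H : SimpleGraph X) (V : Finset X) (u v : X) : ℕ :=
  (Finset.univ.filter fun π : X ≃ Fin (Fintype.card X) => First H V u v π).card

theorem card_equiv_le_mul_firstCount {V : Finset X} {u v : X} (hu : u ∈ nbrs H V v) :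
    Fintype.card (X ≃ Fin (Fintype.card X)) ≤
      ((nbrs H V u).card + (nbrs H V v).card) * firstCount H V u v := by
  refine (card_equiv_le_mul_card_first (W := nbrs H V u ∪ nbrs H V v)
    (Finset.mem_union_right _ hu)).trans ?_
  refine Nat.mul_le_mul (Finset.card_union_le _ _) (Finset.card_le_card fun π hπ => ?_)
  exact Finset.mem_filter.2 ⟨Finset.mem_univ _, (Finset.mem_filter.1 hπ).2⟩

/-- The dart `(v, u)` contributes the degree of `v` times the number of rankings in which `u` is
first. As each end of an edge is first with probability at least the reciprocal of the sum of both
degrees, the two orientations together contribute at least the number of all rankings. -/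
theorem card_equiv_mul_card_darts_le (V : Finset X) :
    Fintype.card (X ≃ Fin (Fintype.card X)) * (darts H V).card ≤
      2 * ∑ v ∈ V, ∑ u ∈ nbrs H V v, (nbrs H V v).card * firstCount H V u v := by
  have hswap : (∑ v ∈ V, ∑ u ∈ nbrs H V v, (nbrs H V v).card * firstCount H V u v)
      = ∑ v ∈ V, ∑ u ∈ nbrs H V v, (nbrs H V u).card * firstCount H V v u := by
    simp_rw [nbrs, Finset.sum_filter]
    rw [Finset.sum_comm]
    refine Finset.sum_congr rfl fun v _ => Finset.sum_congr rfl fun u _ => ?_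
    simp_rw [H.adj_comm u v]
  rw [two_mul]
  nth_rewrite 2 [hswap]
  rw [← Finset.sum_add_distrib, card_darts, Finset.mul_sum]
  refine Finset.sum_le_sum fun v hv => ?_
  rw [← Finset.sum_add_distrib, mul_comm]
  refine Finset.card_nsmul_le_sum (nbrs H V v) _ _ fun u hu => ?_
  obtain ⟨huV, hadj⟩ := mem_nbrs.1 hu
  have h1 := card_equiv_le_mul_firstCount hu
  have h2 := card_equiv_le_mul_firstCount (H := H) (V := V) (u := v) (v := u)
    (mem_nbrs.2 ⟨hv, hadj.symm⟩)
  rcases le_total (firstCount H V u v) (firstCount H V v u) with h3 | h3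
  · nlinarith [Nat.mul_le_mul_left (nbrs H V u).card h3]
  · nlinarith [Nat.mul_le_mul_left (nbrs H V v).card h3]

/-- A pass of Luby's procedure discards at least half of the edges on average. -/
theorem two_mul_sum_card_darts_le (V : Finset X) :
    2 * ∑ π, (darts H (lubyRest H V π)).card ≤
      Fintype.card (X ≃ Fin (Fintype.card X)) * (darts H V).card := by
  have h1 := Finset.sum_le_sum fun (π : X ≃ Fin (Fintype.card X)) (_ : π ∈ Finset.univ) =>
    sum_first_add_card_darts_le (H := H) V π
  rw [Finset.sum_add_distrib, Finset.sum_const, smul_eq_mul, Finset.card_univ] at h1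
  have h2 : (∑ π, ∑ v ∈ V, ∑ u ∈ nbrs H V v, if First H V u v π then (nbrs H V v).card else 0)
      = ∑ v ∈ V, ∑ u ∈ nbrs H V v, (nbrs H V v).card * firstCount H V u v := by
    rw [Finset.sum_comm]
    refine Finset.sum_congr rfl fun v _ => ?_
    rw [Finset.sum_comm]
    refine Finset.sum_congr rfl fun u _ => ?_
    rw [← Finset.sum_filter, Finset.sum_const, smul_eq_mul, mul_comm, firstCount]
  rw [h2] at h1
  have h3 := card_equiv_mul_card_darts_le (H := H) V
  omega

theorem tsum_randomRanking_darts_le (V : Finset X) :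
    ∑' π, randomRanking X π * (darts H (lubyRest H V π)).card ≤ 2⁻¹ * (darts H V).card := by
  have h1 : ∀ π, randomRanking X π
      = (Fintype.card (X ≃ Fin (Fintype.card X)) : ℝ≥0∞)⁻¹ := fun π => by
    have : Nonempty (X ≃ Fin (Fintype.card X)) := ⟨Fintype.equivFin X⟩
    exact PMF.uniformOfFintype_apply π
  have hpos : 0 < Fintype.card (X ≃ Fin (Fintype.card X)) :=
    Fintype.card_pos_iff.2 ⟨Fintype.equivFin X⟩
  simp_rw [h1]
  rw [ENNReal.tsum_mul_left, tsum_fintype, ← Nat.cast_sum]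
  rw [← ENNReal.div_eq_inv_mul, ← ENNReal.div_eq_inv_mul,
    ENNReal.div_le_iff (by exact_mod_cast hpos.ne') (by simp), ← ENNReal.mul_div_right_comm,
    ENNReal.le_div_iff_mul_le (by simp) (by simp)]
  have := two_mul_sum_card_darts_le (H := H) V
  rw [mul_comm, mul_comm (Fintype.card _)] at this
  exact_mod_cast this

theorem expect_lubyLoop_succ (fuel : ℕ) {V : Finset X} (hV : V.Nonempty) (ψ : ℕ∞ → ℝ≥0∞) :
    (lubyLoop H (fuel + 1) V).expect (fun r => ψ r.rounds) =
      ∑' π, randomRanking X π *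
        (lubyLoop H fuel (lubyRest H V π)).expect fun r => ψ (r.rounds + 5) := by
  rw [lubyLoop, Par.expect_bind, Par.expect_lift]
  have h0 : (Run.solo (decide V.Nonempty)).val = true := by simp [Run.solo, hV]
  rw [h0]
  simp only [if_true]
  rw [Par.expect_bind]
  refine (Par.tsum_map_mul _ _ _).trans (tsum_congr fun π => ?_)
  congr 1
  rw [Par.expect_bind, Par.expect_lift]
  have h1 : (Run.solo π).val = π := rfl
  rw [h1, select_lubyPick, Par.expect_bind, Par.expect_lift, select_lubyRest, Par.expect_bind]
  congr 1
  funext r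
  rw [Par.expect_lift]
  congr 1
  show 1 + (1 + (1 + (1 + (r.rounds + 1)))) = r.rounds + 5
  ring

theorem rounds_lubyLoop_empty (fuel : ℕ) :
    ∀ r ∈ (lubyLoop H fuel ∅).outcomes, r.rounds ≤ 1 := by
  have : (lubyLoop H fuel ∅).Spec 0 (fun _ => True) 1 ⊤ := by
    cases fuel with
    | zero => exact (Par.spec_pure trivial).mono le_rfl (fun _ h => h) (by simp) le_rfl
    | succ fuel =>
      refine (Par.spec_lift_bind (Run.ok_solo le_top) (R' := 0) ?_).mono le_rfl (fun _ h => h)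
        (by simp) le_rfl
      rintro left rfl
      simp only [Finset.not_nonempty_empty, decide_false, Bool.false_eq_true, if_false]
      exact Par.spec_pure trivial
  exact fun r hr => (Par.spec_zero_iff.1 this r hr).2.2.1

omit [Fintype X] in
theorem not_adj_of_card_darts {V : Finset X} (h : (darts H V).card = 0) {a b : X} (ha : a ∈ V)
    (hb : b ∈ V) : ¬ H.Adj a b := fun hadj => by
  rw [Finset.card_eq_zero] at h
  have : (a, b) ∈ darts H V :=
    Finset.mem_filter.2 ⟨Finset.mem_product.2 ⟨ha, hb⟩, hadj⟩
  rw [h] at this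
  simp at this

/-- The expected number of darts is halved in each of the first `T` passes, and once no edge is left,
the procedure ends after one more pass. -/
theorem prob_rounds_lubyLoop_le : ∀ (fuel T : ℕ) (V : Finset X),
    (lubyLoop H fuel V).prob (fun r => ¬ r.rounds ≤ (5 * T + 6 : ℕ))
      ≤ 2⁻¹ ^ T * (darts H V).card
  | 0, T, V => by
    rw [Par.prob_eq_expect, lubyLoop, Par.expect_pure]
    have : (pure ∅ : Run (Finset X)).rounds ≤ (5 * T + 6 : ℕ) := zero_le
    simp only [this, not_true_eq_false, if_false, zero_le]
  | fuel + 1, T, V => by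
    rcases V.eq_empty_or_nonempty with rfl | hV
    · refine le_of_eq_of_le ((Par.prob_eq_zero_iff _ _).2 fun r hr => ?_) zero_le
      refine (rounds_lubyLoop_empty _ r hr).trans ?_
      norm_cast
      omega
    rw [Par.prob_eq_expect]
    refine (le_of_eq ?_).trans ((expect_lubyLoop_succ (H := H) fuel hV
      (fun k => if ¬ k ≤ (5 * T + 6 : ℕ) then 1 else 0)).trans_le ?_)
    · congr!
    cases T with
    | zero =>
      by_cases h0 : (darts H V).card = 0
      · have hrest : ∀ π, lubyRest H V π = ∅ := by
          intro π
          refine Finset.eq_empty_of_forall_notMem fun e he => ?_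
          obtain ⟨h1, h2, -⟩ := mem_lubyRest.1 he
          exact h2 (mem_lubyPick.2 ⟨h1, fun e' he' hadj =>
            absurd hadj (not_adj_of_card_darts h0 h1 he')⟩)
        rw [ENNReal.tsum_eq_zero.2 fun π => ?_]
        · exact zero_le
        rw [hrest π, mul_eq_zero]
        refine Or.inr (nonpos_iff_eq_zero.1 ?_)
        refine (Par.expect_mono (ψ := fun _ => 0) fun r hr => ?_).trans
          (Par.expect_const _ 0).le
        have h3 := rounds_lubyLoop_empty _ r hr
        have h4 : r.rounds + 5 ≤ (5 * 0 + 6 : ℕ) := by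
          refine (add_le_add_left h3 5).trans ?_
          norm_num
        rw [if_neg (not_not.2 h4)]
      · calc _ ≤ ∑' π, randomRanking X π * 1 := by
              refine ENNReal.tsum_le_tsum fun π => ?_
              gcongr
              refine (Par.expect_mono (ψ := fun _ => 1) fun r _ => ?_).trans
                (Par.expect_const _ 1).le
              split_ifs <;> simp
          _ = 1 := by rw [ENNReal.tsum_mul_right, PMF.tsum_coe, one_mul]
          _ ≤ _ := by
              rw [pow_zero, one_mul]
              exact_mod_cast Nat.one_le_iff_ne_zero.2 h0
    | succ T =>
      calc _ ≤ ∑' π, randomRanking X π *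
              (2⁻¹ ^ T * (darts H (lubyRest H V π)).card : ℝ≥0∞) := by
            refine ENNReal.tsum_le_tsum fun π => ?_
            gcongr
            refine le_trans ?_ (prob_rounds_lubyLoop_le fuel T (lubyRest H V π))
            rw [Par.prob_eq_expect]
            refine Par.expect_mono fun r _ => ?_
            by_cases hr : r.rounds ≤ (5 * T + 6 : ℕ)
            · have h4 : r.rounds + 5 ≤ (5 * (T + 1) + 6 : ℕ) := by
                refine (add_le_add_left hr 5).trans ?_
                norm_cast
              rw [if_neg (not_not.2 h4)]
              exact zero_le
            · rw [if_pos hr]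
              split_ifs <;> simp
        _ = 2⁻¹ ^ T * ∑' π, randomRanking X π * (darts H (lubyRest H V π)).card := by
            rw [← ENNReal.tsum_mul_left]
            refine tsum_congr fun π => ?_
            ring
        _ ≤ 2⁻¹ ^ T * (2⁻¹ * (darts H V).card) := by
            gcongr
            exact tsum_randomRanking_darts_le V
        _ = _ := by rw [pow_succ, mul_assoc]

theorem card_darts_le (V : Finset X) : (darts H V).card ≤ Fintype.card X ^ 2 := by
  refine (Finset.card_filter_le _ _).trans ?_
  rw [Finset.card_product, sq]
  exact Nat.mul_le_mul (Finset.card_le_univ _) (Finset.card_le_univ _)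

theorem spec_luby_rounds {N : ℕ∞} (hX : (Fintype.card X : ℕ∞) ≤ N) (hN : 1 ≤ N) (T : ℕ)
    (V : Finset X) :
    (luby X H V).Spec (2⁻¹ ^ T * (Fintype.card X : ℝ≥0∞) ^ 2) (IsMIS H V) (5 * T + 6 : ℕ) N := by
  have h1 := spec_luby (H := H) hX hN V
  have h2 : (luby X H V).prob (fun r => ¬ r.rounds ≤ (5 * T + 6 : ℕ))
      ≤ 2⁻¹ ^ T * (Fintype.card X : ℝ≥0∞) ^ 2 := by
    refine (prob_rounds_lubyLoop_le _ T V).trans ?_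
    gcongr
    exact_mod_cast card_darts_le V
  refine le_trans (Par.prob_mono fun r hr => ?_) ((Par.prob_or_le _ _ _).trans
    ((add_le_add h1 h2).trans_eq (zero_add _)))
  by_contra! hcon
  exact hr ⟨hcon.1.1, hcon.1.2.1, hcon.2, hcon.1.2.2.2⟩

end Luby

/-! ### The weight of the output -/

section Weight

variable {X S : Type} {G : WeightedSetSystem X S} [Fintype X]

open WeightedSetSystem

theorem sum_sum_carrier_eq (A : Finset S) (f : X → ℝ) :
    ∑ i ∈ A, ∑ e ∈ G.carrier i, f e = ∑ e, f e * (G.containing A e).card := by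
  have h1 : ∀ i, ∑ e ∈ G.carrier i, f e = ∑ e, if e ∈ G.carrier i then f e else 0 := fun i => by
    rw [← Finset.sum_filter]
    congr 1
    ext e
    simp
  simp_rw [h1]
  rw [Finset.sum_comm]
  refine Finset.sum_congr rfl fun e _ => ?_
  rw [← Finset.sum_filter, Finset.sum_const, nsmul_eq_mul, mul_comm]
  rfl

/-- The primal-dual bound: a collection on which the dual variables are almost tight, and which
covers every element of positive dual variable at most `τ` times, compared with a collection that
covers all these elements. -/
theorem totalWeight_le_of_dual {τ : ℕ} {ε : ℝ} {A C : Finset S} {y : X → ℝ} (hy : ∀ e, 0 ≤ y e)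
    (hA : ∀ i ∈ A, (1 - ε) * G.weight i ≤ ∑ e ∈ G.carrier i, y e)
    (hτ : ∀ e, y e ≠ 0 → (G.containing A e).card ≤ τ)
    (hC : ∀ i ∈ C, ∑ e ∈ G.carrier i, y e ≤ G.weight i) (hcov : ∀ e, y e ≠ 0 → e ∈ G.covered C) :
    (1 - ε) * G.totalWeight A ≤ τ * G.totalWeight C := by
  have h1 : (1 - ε) * G.totalWeight A ≤ ∑ e, y e * (G.containing A e).card := by
    rw [totalWeight, Finset.mul_sum, ← sum_sum_carrier_eq]
    exact Finset.sum_le_sum hA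
  have h2 : ∑ e, y e * (G.containing C e).card ≤ G.totalWeight C := by
    rw [← sum_sum_carrier_eq]
    exact Finset.sum_le_sum hC
  have h3 : ∑ e, y e * (G.containing A e).card ≤ τ * ∑ e, y e * (G.containing C e).card := by
    rw [Finset.mul_sum]
    refine Finset.sum_le_sum fun e _ => ?_
    by_cases h0 : y e = 0
    · simp [h0]
    · rw [mul_left_comm]
      refine mul_le_mul_of_nonneg_left ?_ (hy e)
      obtain ⟨i, hi, hei⟩ := mem_covered.1 (hcov e h0)
      have h4 : 1 ≤ (G.containing C e).card :=
        Finset.card_pos.2 ⟨i, mem_containing.2 ⟨hi, hei⟩⟩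
      have h5 := hτ e h0
      exact_mod_cast h5.trans (Nat.le_mul_of_pos_right τ h4)
  exact h1.trans (h3.trans (by gcongr))

variable [Fintype S]

variable (G)

/-- The least weight of a set that contains `e`. -/
def cheapest (e : X) : ℝ := ⨅ i : {i : S // e ∈ G.carrier i}, G.weight i.1

/-- The largest weight that has to be paid for a single element. -/
def maxCheapest : ℝ := ⨆ e, cheapest G e

variable {G}

omit [Fintype X] in
theorem cheapest_le {e : X} {i : S} (h : e ∈ G.carrier i) : cheapest G e ≤ G.weight i :=
  ciInf_le (f := fun i : {i : S // e ∈ G.carrier i} => G.weight i.1)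
    (Set.finite_range _).bddBelow ⟨i, h⟩

theorem exists_weight_le_maxCheapest (hc : ∀ e : X, ∃ i : S, e ∈ G.carrier i) (e : X) :
    ∃ i, e ∈ G.carrier i ∧ G.weight i ≤ maxCheapest G := by
  obtain ⟨i, hi⟩ := hc e
  have : Nonempty {i : S // e ∈ G.carrier i} := ⟨i, hi⟩
  obtain ⟨j, hj⟩ := exists_eq_ciInf_of_finite (f := fun i : {i : S // e ∈ G.carrier i} =>
    G.weight i.1)
  refine ⟨j.1, j.2, hj.trans_le ?_⟩
  exact le_ciSup (f := cheapest G) (Set.finite_range _).bddAbove e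

theorem maxCheapest_nonneg [Nonempty X] (hc : ∀ e : X, ∃ i : S, e ∈ G.carrier i) :
    0 ≤ maxCheapest G := by
  obtain ⟨i, -, hi⟩ := exists_weight_le_maxCheapest hc (Classical.arbitrary X)
  exact (G.weight_nonneg i).trans hi

omit [Fintype X] in
theorem maxCheapest_le_totalWeight [Nonempty X] {A : Finset S} (hA : G.IsCover A) :
    maxCheapest G ≤ G.totalWeight A := by
  refine ciSup_le fun e => ?_
  obtain ⟨i, hi, hei⟩ := mem_covered.1 (hA e)
  exact (cheapest_le hei).trans (Finset.single_le_sum (fun i _ => G.weight_nonneg i) hi)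

omit [Fintype X] in
theorem exists_isCover_totalWeight_eq (hc : ∀ e : X, ∃ i : S, e ∈ G.carrier i) :
    ∃ A, G.IsCover A ∧ G.totalWeight A = G.opt := by
  have : Nonempty {A : Finset S // G.IsCover A} :=
    ⟨Finset.univ, fun e => mem_covered.2 ((hc e).imp fun i hi => ⟨Finset.mem_univ i, hi⟩)⟩
  obtain ⟨A, hA⟩ := exists_eq_ciInf_of_finite (f := fun A : {A : Finset S // G.IsCover A} =>
    G.totalWeight A.1)
  exact ⟨A.1, A.2, hA⟩

theorem opt_le_card_mul_maxCheapest (hc : ∀ e : X, ∃ i : S, e ∈ G.carrier i) :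
    G.opt ≤ Fintype.card X * maxCheapest G := by
  choose f hf1 hf2 using exists_weight_le_maxCheapest hc
  have hcov : G.IsCover (Finset.univ.image f) := fun e =>
    mem_covered.2 ⟨f e, Finset.mem_image_of_mem _ (Finset.mem_univ _), hf1 e⟩
  refine (ciInf_le (f := fun A : {A : Finset S // G.IsCover A} => G.totalWeight A.1)
    (Set.finite_range _).bddBelow ⟨_, hcov⟩).trans ?_
  refine (Finset.sum_le_card_nsmul _ _ (maxCheapest G) fun i hi => ?_).trans ?_
  · obtain ⟨e, -, rfl⟩ := Finset.mem_image.1 hi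
    exact hf2 e
  · rw [nsmul_eq_mul]
    have h0 : 0 ≤ maxCheapest G ∨ IsEmpty X := by
      rcases isEmpty_or_nonempty X with h | h
      · exact Or.inr h
      · exact Or.inl (maxCheapest_nonneg hc)
    rcases h0 with h0 | h0
    · gcongr
      exact Finset.card_image_le
    · simp

end Weight

/-! ### The whole algorithm -/

section Whole

variable {X S : Type} {G : WeightedSetSystem X S} [Fintype X] [Fintype S]

open WeightedSetSystem

/-- The bound on the number of rounds of ParaMinSC-SNC, if the layer depth is `L`, a maximal
independent set is found in `R` rounds, an epoch has at most `P` passes, and the number of passes of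
the deletion phase is `t`. -/
def roundBound (L P t : ℕ) (R : ℕ∞) : ℕ∞ :=
  (L * 4 + 1) + (L * (P * 9 + 3) + ((L ^ 2 : ℕ) * (2 + R) + L * (t * 4 + 4)))

/-- The claim under the condition `b` is the existence of dual variables that certify the weight of
the output; only this claim may fail through the random deletion. -/
theorem spec_paraMinSC [Nonempty S] {τ : ℕ} (hτ : 1 ≤ τ) {c : ChoiceRule X S τ} (h : G.HasSNC τ)
    {E : Finset X} {F : Finset S} (hEF : E ⊆ G.covered F) {ε lo ρ : ℝ} (hε : 0 < ε) (hε1 : ε ≤ 1)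
    (hρ : 0 < ρ) (hw : ∀ i ∈ F, G.weight i ≤ lo * ρ)
    (hlo : ∀ i ∈ F, lo * Fintype.card X ≤ ε * G.weight i) {M : MISProc X} {δM : ℝ≥0∞} {R N : ℕ∞}
    (hM : ∀ H V, (M H V).Spec δM (IsMIS H V) R N) (n : ℕ) (b : Prop) {δ : ℝ≥0∞}
    (hδ : b → ENNReal.ofReal (trimFactor τ) ^ trimCount τ n *
      (if τ = 1 then 0 else 2 ^ (τ * τ)) ≤ 2 ^ (τ + 1) * δ)
    (hX : (Fintype.card X : ℕ∞) ≤ N) (hS : (Fintype.card S : ℕ∞) ≤ N)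
    (hP : (Fintype.card (X × (Fin τ → S)) : ℕ∞) ≤ N) (hN : 1 ≤ N) :
    (paraMinSC G c M ε n E F).Spec (Fintype.card X * δ + (G.layerDepth τ ^ 2 : ℕ) * δM)
      (fun A => E ⊆ G.covered A ∧ (b → ∃ y : X → ℝ, (∀ e, 0 ≤ y e) ∧
        (∀ i ∈ F, ∑ e ∈ G.carrier i, y e ≤ G.weight i) ∧ (∀ e, y e ≠ 0 → e ∈ E) ∧
        (∀ i ∈ A, (1 - ε) * G.weight i ≤ ∑ e ∈ G.carrier i, y e) ∧
        ∀ e, y e ≠ 0 → (G.containing A e).card ≤ τ))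
      (roundBound (G.layerDepth τ) (passBound ε ρ) (trimCount τ n) R) N := by
  refine Par.spec_lift_bind (ok_layerDecomposition h E F hX hP hN) ?_
  rintro Zs ⟨hZE, hL, hlen⟩
  have hinit : ForwardInv G ε E F ⟨fun _ => 0, G.weight, E, F, ∅, ∅, 0, 0⟩ := by
    refine ⟨by simp, ?_, by simp, by simp, by simp [covered], by simp, by simp, ?_⟩
    · intro i _
      simpa using G.weight_nonneg i
    · intro i _
      exact mul_le_of_le_one_left (G.weight_nonneg i) hε1
  refine Par.spec_lift_bind ((ok_forwardPhase hε hρ hEF hw hlo hX hS hN Zs _ hinit hL hZE.subset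
    (by simp)).mono (fun _ h => h) (by gcongr) le_rfl) ?_
  rintro l ⟨hl, hcf, y, hy0, hyF, hyd, hfit⟩
  have hll : l.length ≤ G.layerDepth τ := by
    rw [← hl, List.length_map] at hlen
    exact hlen
  refine (spec_deletionPhase hτ hM n b hδ hX hS hP l (hl ▸ hL) hfit).mono ?_ ?_ ?_ le_rfl
  · gcongr
    exact Finset.card_le_univ _
  · rintro A ⟨hA, hAc, hAn⟩
    rw [hl, hZE] at hAc hAn
    have hyE : ∀ e, y e ≠ 0 → e ∈ E := by
      intro e he
      by_contra hne
      exact he (hyd e fun hc => hne (hZE ▸ hc.2))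
    refine ⟨?_, fun hb => ⟨y, hy0, hyF, hyE, fun i hi => (hA i hi).2,
      fun e he => hAn hb e (hyE e he) he⟩⟩
    have := hAc _ hcf
    simpa [covered] using this
  · gcongr

/-- The output is a cover in any case, and its weight is bounded under the condition `b`: the sets of
negligible weight cost at most `ε * opt` together, and sets heavier than `opt` are
not needed. -/
theorem spec_modifiedParaMinSC [Nonempty X] [Nonempty S] {τ : ℕ} (hτ : 1 ≤ τ)
    {c : ChoiceRule X S τ} (h : G.HasSNC τ) (hc : ∀ e : X, ∃ i : S, e ∈ G.carrier i)
    {ε : ℝ} (hε : 0 < ε) (hε2 : ε < 1 / 2) {M : MISProc X} {δM : ℝ≥0∞} {R N : ℕ∞}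
    (hM : ∀ H V, (M H V).Spec δM (IsMIS H V) R N) (b : Prop) {δ : ℝ≥0∞}
    (hδ : b → ENNReal.ofReal (trimFactor τ) ^ trimCount τ (Fintype.card X) *
      (if τ = 1 then 0 else 2 ^ (τ * τ)) ≤ 2 ^ (τ + 1) * δ)
    (hX : (Fintype.card X : ℕ∞) ≤ N) (hS : (Fintype.card S : ℕ∞) ≤ N)
    (hP : (Fintype.card (X × (Fin τ → S)) : ℕ∞) ≤ N) (hN : 1 ≤ N) :
    (modifiedParaMinSC G c M ε).Spec (Fintype.card X * δ + (G.layerDepth τ ^ 2 : ℕ) * δM)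
      (fun B => G.IsCover B ∧ (b → G.totalWeight B ≤ τ * (1 + 3 * ε) * G.opt))
      (9 + roundBound (G.layerDepth τ) (passBound ε ((Fintype.card X : ℝ) ^ 3 / ε ^ 2))
        (trimCount τ (Fintype.card X)) R) N := by
  set Q := roundBound (G.layerDepth τ) (passBound ε ((Fintype.card X : ℝ) ^ 3 / ε ^ 2))
        (trimCount τ (Fintype.card X)) R with hQ
  have hn : (0 : ℝ) < Fintype.card X := by exact_mod_cast Fintype.card_pos
  refine (Par.spec_lift_bind (Run.ok_par hX)
    (R' := 1 + (1 + (1 + (1 + (1 + (1 + (1 + (Q + 1)))))))) ?_).mono le_rfl (fun _ h => h)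
    (le_of_eq (by ring)) le_rfl
  intro ch hch
  refine Par.spec_lift_bind (Run.ok_solo hN) ?_
  intro β hβ
  have hβ' : β = maxCheapest G := by
    rw [hβ, hch]
    rfl
  clear hβ
  subst hβ'
  refine Par.spec_lift_bind (Run.ok_select hS) ?_
  intro S1 hS1
  refine Par.spec_lift_bind (Run.ok_select hS) ?_
  intro S2 hS2
  refine Par.spec_lift_bind (Run.ok_select hX) ?_
  intro X1 hX1
  refine Par.spec_lift_bind (Run.ok_select hX) ?_
  intro X2 hX2
  refine Par.spec_lift_bind (Run.ok_par hX) ?_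
  rintro choice hchoice
  refine Par.spec_lift_bind (Run.ok_select hS) ?_
  intro B1 hB1
  set β := maxCheapest G with hβ
  have hβ0 : 0 ≤ β := maxCheapest_nonneg hc
  have hn1 : (1 : ℝ) ≤ Fintype.card X := by exact_mod_cast Fintype.card_pos (α := X)
  have hcX2 : X2 ⊆ G.covered S2 := by
    intro e he
    obtain ⟨i, hei, hi⟩ := exists_weight_le_maxCheapest hc e
    refine mem_covered.2 ⟨i, (hS2 i).2 ⟨?_, hi.trans (le_mul_of_one_le_left hβ0 hn1)⟩, hei⟩
    by_contra! hlt
    exact (hX2 e).1 he ((hX1 e).2 (mem_covered.2 ⟨i, (hS1 i).2 hlt, hei⟩))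
  have hlo : ∀ i ∈ S2, β * ε ^ 2 / (Fintype.card X : ℝ) ^ 2 * Fintype.card X
      ≤ ε * G.weight i := by
    intro i hi
    calc β * ε ^ 2 / (Fintype.card X : ℝ) ^ 2 * Fintype.card X
        = ε * (β * ε / Fintype.card X) := by field_simp
      _ ≤ _ := by
        gcongr
        exact ((hS2 i).1 hi).1
  have hhi : ∀ i ∈ S2, G.weight i
      ≤ β * ε ^ 2 / (Fintype.card X : ℝ) ^ 2 * ((Fintype.card X : ℝ) ^ 3 / ε ^ 2) := by
    intro i hi
    refine ((hS2 i).1 hi).2.trans_eq ?_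
    field_simp
  have hmem : ∀ e ∈ X1, choice e ∈ S1 ∧ e ∈ G.carrier (choice e) := by
    intro e he
    obtain ⟨i, hi, hei⟩ := mem_covered.1 ((hX1 e).1 he)
    rw [hchoice]
    exact mem_containing.1 (c.pickSet_mem e _ ⟨i, mem_containing.2 ⟨hi, hei⟩⟩)
  refine ((spec_paraMinSC hτ (c := c) h hcX2 hε (by linarith) (by positivity) hhi hlo hM _ b hδ
    hX hS hP hN).bind (δ' := 0) (R' := 1) ?_).mono (by simp) (fun _ h => h) le_rfl le_rfl
  rintro B2 ⟨hB2c, hB2⟩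
  refine Par.spec_lift ((Run.ok_select hS).mono ?_ le_rfl le_rfl)
  intro B hB
  have hBu : B = B1 ∪ B2 := by
    ext i
    rw [hB, Finset.mem_union]
  refine ⟨fun e => ?_, fun hb => ?_⟩
  · rw [hBu, covered_union, Finset.mem_union]
    by_cases he : e ∈ X1
    · exact Or.inl (mem_covered.2 ⟨choice e, (hB1 _).2 ⟨e, he, rfl⟩, (hmem e he).2⟩)
    · exact Or.inr (hB2c ((hX2 e).2 he))
  · obtain ⟨y, hy0, hyF, hyE, hyt, hyn⟩ := hB2 hb
    obtain ⟨A, hA, hAopt⟩ := exists_isCover_totalWeight_eq hc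
    have hβopt : β ≤ G.opt := hAopt ▸ maxCheapest_le_totalWeight hA
    have hoptβ := opt_le_card_mul_maxCheapest hc
    have hopt0 : 0 ≤ G.opt := hβ0.trans hβopt
    have h1 : G.totalWeight B1 ≤ ε * β := by
      have hsub : B1 ⊆ X1.image choice := by
        intro i hi
        obtain ⟨e, he, rfl⟩ := (hB1 i).1 hi
        exact Finset.mem_image_of_mem _ he
      refine (Finset.sum_le_card_nsmul B1 _ (β * ε / Fintype.card X) fun i hi => ?_).trans ?_
      · obtain ⟨e, he, rfl⟩ := (hB1 i).1 hi
        exact ((hS1 _).1 (hmem e he).1).le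
      · rw [nsmul_eq_mul]
        have hcard : (B1.card : ℝ) ≤ Fintype.card X := by
          exact_mod_cast (Finset.card_le_card hsub).trans
            (Finset.card_image_le.trans (Finset.card_le_univ _))
        calc (B1.card : ℝ) * (β * ε / Fintype.card X)
            ≤ Fintype.card X * (β * ε / Fintype.card X) := by gcongr
          _ = ε * β := by field_simp
    have h2 : (1 - ε) * G.totalWeight B2 ≤ τ * G.opt := by
      have hAle : ∀ i ∈ A, G.weight i ≤ G.opt := fun i hi =>
        (Finset.single_le_sum (f := G.weight) (fun i _ => G.weight_nonneg i) hi).trans_eq hAopt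
      refine (totalWeight_le_of_dual (C := A ∩ S2) hy0 hyt hyn
        (fun i hi => hyF i (Finset.mem_inter.1 hi).2) fun e he => ?_).trans ?_
      · obtain ⟨i, hi, hei⟩ := mem_covered.1 (hA e)
        refine mem_covered.2 ⟨i, Finset.mem_inter.2 ⟨hi, (hS2 i).2
          ⟨?_, (hAle i hi).trans hoptβ⟩⟩, hei⟩
        by_contra! hlt
        exact (hX2 e).1 (hyE e he) ((hX1 e).2 (mem_covered.2 ⟨i, (hS1 i).2 hlt, hei⟩))
      · rw [← hAopt]
        gcongr
        exact Finset.sum_le_sum_of_subset_of_nonneg Finset.inter_subset_left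
          fun i _ _ => G.weight_nonneg i
    have h3 : G.totalWeight B ≤ G.totalWeight B1 + G.totalWeight B2 := by
      have h4 : (∑ i ∈ B1 ∪ B2, G.weight i) + ∑ i ∈ B1 ∩ B2, G.weight i
          = ∑ i ∈ B1, G.weight i + ∑ i ∈ B2, G.weight i := Finset.sum_union_inter
      have h5 : 0 ≤ ∑ i ∈ B1 ∩ B2, G.weight i := Finset.sum_nonneg fun i _ => G.weight_nonneg i
      rw [hBu, totalWeight, totalWeight, totalWeight]
      linarith
    have hτ' : (1 : ℝ) ≤ τ := by exact_mod_cast hτ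
    have h6 : G.totalWeight B2 ≤ τ * (1 + 2 * ε) * G.opt := by
      -- `1 ≤ (1 - ε) * (1 + 2 * ε)` because `ε ≤ 1 / 2`
      have h7 : τ * G.opt ≤ (1 - ε) * (τ * (1 + 2 * ε) * G.opt) := by
        have h8 : 0 ≤ τ * G.opt := by positivity
        have h9 : 1 ≤ (1 - ε) * (1 + 2 * ε) := by nlinarith
        calc τ * G.opt ≤ τ * G.opt * ((1 - ε) * (1 + 2 * ε)) := le_mul_of_one_le_right h8 h9
          _ = _ := by ring
      exact le_of_mul_le_mul_left (h2.trans h7) (by linarith)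
    have h10 : ε * β ≤ τ * ε * G.opt := by
      calc ε * β ≤ ε * G.opt := by gcongr
        _ ≤ τ * (ε * G.opt) := le_mul_of_one_le_left (by positivity) hτ'
        _ = _ := by ring
    linarith

end Whole

/-! ### Rounds and probabilities -/

theorem Par.le_prob_of_spec {α : Type} {p : Par α} {δ δ' : ℝ≥0∞} {V : α → Prop} {R N : ℕ∞}
    {E : Run α → Prop} (h : p.Spec δ V R N) (hδ : δ ≤ δ') (hE : ∀ r, r.Ok V R N → E r) :
    1 - δ' ≤ p.prob E := by
  rw [tsub_le_iff_right, ← Par.prob_add_prob_not p fun r => r.Ok V R N]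
  exact add_le_add (Par.prob_mono hE) (h.trans hδ)

theorem Run.Ok.roundsLE {α : Type} {r : Run α} {V : α → Prop} {k : ℕ} {N : ℕ∞} {x : ℝ}
    (h : r.Ok V k N) (hx : (k : ℝ) ≤ x) : r.RoundsLE x := by
  obtain ⟨j, hj⟩ := ENat.ne_top_iff_exists.1 h.2.1
  have h1 : (j : ℕ∞) ≤ k := hj ▸ h.2.2.1
  exact ⟨j, hj.symm, le_trans (by exact_mod_cast h1) hx⟩

/-- The number of passes granted to Luby's procedure; every pass halves the expected number of
edges, so that it is at most `n ^ 2 / n ^ 6` after `6 log₂ n` passes. -/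
def lubyPasses (n : ℕ) : ℕ := 6 * Nat.clog 2 n

theorem card_mul_add_le_inv {n L : ℕ} (hn : 2 ≤ n) (hL : L ≤ n) :
    (n : ℝ≥0∞) * ((n : ℝ≥0∞) ^ 3)⁻¹ + (L ^ 2 : ℕ) * (2⁻¹ ^ lubyPasses n * (n : ℝ≥0∞) ^ 2)
      ≤ 1 / n := by
  have h0 : (n : ℝ≥0∞) ≠ 0 := by
    have : n ≠ 0 := by omega
    exact_mod_cast this
  have ht : (n : ℝ≥0∞) ≠ ⊤ := ENNReal.natCast_ne_top n
  have hpow : (2⁻¹ : ℝ≥0∞) ^ lubyPasses n ≤ ((n : ℝ≥0∞) ^ 6)⁻¹ := by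
    rw [← ENNReal.inv_pow, ENNReal.inv_le_inv, lubyPasses, mul_comm, pow_mul]
    gcongr
    exact_mod_cast Nat.le_pow_clog (by norm_num) n
  have h1 : (n : ℝ≥0∞) * ((n : ℝ≥0∞) ^ 3)⁻¹ = ((n : ℝ≥0∞) ^ 2)⁻¹ := by
    rw [pow_succ' _ 2, ENNReal.mul_inv (Or.inl h0) (Or.inl ht), ← mul_assoc,
      ENNReal.mul_inv_cancel h0 ht, one_mul]
  have h2 : ((L ^ 2 : ℕ) : ℝ≥0∞) * (2⁻¹ ^ lubyPasses n * (n : ℝ≥0∞) ^ 2)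
      ≤ ((n : ℝ≥0∞) ^ 2)⁻¹ := by
    calc _ ≤ (n : ℝ≥0∞) ^ 2 * (((n : ℝ≥0∞) ^ 6)⁻¹ * (n : ℝ≥0∞) ^ 2) := by
          gcongr
          exact_mod_cast Nat.pow_le_pow_left hL 2
      _ = ((n : ℝ≥0∞) ^ 4 * ((n : ℝ≥0∞) ^ 4)⁻¹) * ((n : ℝ≥0∞) ^ 2)⁻¹ := by
          rw [show (6 : ℕ) = 4 + 2 from rfl, pow_add _ 4 2, ENNReal.mul_inv (by simp [h0])
            (by simp [ht])]
          ring
      _ = _ := by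
          rw [ENNReal.mul_inv_cancel (pow_ne_zero _ h0) (ENNReal.pow_ne_top ht), one_mul]
  rw [h1]
  calc _ ≤ ((n : ℝ≥0∞) ^ 2)⁻¹ + ((n : ℝ≥0∞) ^ 2)⁻¹ := by gcongr
    _ = 2 * ((n : ℝ≥0∞)⁻¹ * (n : ℝ≥0∞)⁻¹) := by
        rw [← two_mul, sq, ENNReal.mul_inv (Or.inl h0) (Or.inl ht)]
    _ ≤ n * ((n : ℝ≥0∞)⁻¹ * (n : ℝ≥0∞)⁻¹) := by
        gcongr
        exact_mod_cast hn
    _ = 1 / n := by rw [← mul_assoc, ENNReal.mul_inv_cancel h0 ht, one_mul, one_div]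

/-- The bound of `roundBound` as a natural number, for Luby's procedure. -/
theorem exists_roundBound_luby {L P t T : ℕ} :
    ∃ k : ℕ, 9 + roundBound L P t (5 * T + 6 : ℕ) = k ∧
      k = 9 + ((L * 4 + 1) + (L * (P * 9 + 3) + (L ^ 2 * (2 + (5 * T + 6)) + L * (t * 4 + 4)))) :=
  ⟨_, by rw [roundBound]; push_cast; ring, rfl⟩

theorem roundBound_le {n τ L : ℕ} {ε : ℝ} (hn : 2 ≤ n) (hτ : 1 ≤ τ) (hL : 1 ≤ L) (hε : 0 < ε)
    (hε2 : ε < 1 / 2) :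
    ((9 + ((L * 4 + 1) + (L * (passBound ε ((n : ℝ) ^ 3 / ε ^ 2) * 9 + 3) +
      (L ^ 2 * (2 + (5 * lubyPasses n + 6)) + L * (trimCount τ n * 4 + 4)))) : ℕ) : ℝ) ≤
    100 * (L * Real.logb (1 + ε) ((n : ℝ) ^ 3 / ε ^ 2) +
      4 * (τ : ℝ) ^ 3 * 2 ^ τ * (L : ℝ) ^ 2 * Real.logb 2 n) := by
  have hn' : (2 : ℝ) ≤ n := by exact_mod_cast hn
  have hτ' : (1 : ℝ) ≤ τ := by exact_mod_cast hτ
  have hL' : (1 : ℝ) ≤ L := by exact_mod_cast hL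
  set lg := Real.logb 2 n with hlg
  set Λ := Real.logb (1 + ε) ((n : ℝ) ^ 3 / ε ^ 2) with hΛ
  set w : ℝ := 4 * (τ : ℝ) ^ 3 * 2 ^ τ with hw
  have hlg1 : 1 ≤ lg := by
    rw [hlg, Real.le_logb_iff_rpow_le (by norm_num) (by linarith), Real.rpow_one]
    exact hn'
  have hΛ1 : 1 ≤ Λ := by
    rw [hΛ, Real.le_logb_iff_rpow_le (by linarith) (by positivity), Real.rpow_one,
      le_div_iff₀ (by positivity)]
    have h1 : (8 : ℝ) ≤ (n : ℝ) ^ 3 := by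
      calc (8 : ℝ) = 2 ^ 3 := by norm_num
        _ ≤ _ := by gcongr
    nlinarith
  have hw8 : 8 ≤ w := by
    have h1 : (1 : ℝ) ≤ (τ : ℝ) ^ 3 := one_le_pow₀ hτ'
    have h2 : (2 : ℝ) ≤ 2 ^ τ := by
      calc (2 : ℝ) = 2 ^ 1 := by norm_num
        _ ≤ _ := pow_le_pow_right₀ (by norm_num) hτ
    rw [hw]
    nlinarith
  have hP : (passBound ε ((n : ℝ) ^ 3 / ε ^ 2) : ℝ) ≤ 3 * Λ := by
    have := Nat.floor_le (show 0 ≤ Λ by linarith)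
    rw [passBound]
    push_cast
    linarith
  have hT : (lubyPasses n : ℝ) ≤ 12 * lg := by
    have h1 : (Nat.clog 2 n : ℝ) ≤ lg + 1 := by
      have h2 := Real.natCeil_logb_natCast 2 n
      have h3 := Nat.ceil_lt_add_one (show 0 ≤ lg by linarith)
      rw [hlg] at h3 ⊢
      rw [← h2]
      exact_mod_cast h3.le
    rw [lubyPasses]
    push_cast
    linarith
  have ht : (trimCount τ n : ℝ) ≤ w * lg + 1 := by
    have h1 : 0 ≤ w * lg := by positivity
    have := Nat.floor_le h1
    rw [trimCount]
    push_cast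
    linarith
  have hL2 : (L : ℝ) ≤ (L : ℝ) ^ 2 := by nlinarith
  have e1 : (L : ℝ) ≤ L * Λ := le_mul_of_one_le_right (by linarith) hΛ1
  have e2 : (L : ℝ) ^ 2 ≤ (L : ℝ) ^ 2 * lg := le_mul_of_one_le_right (by positivity) hlg1
  have e3 : 8 * ((L : ℝ) ^ 2 * lg) ≤ w * (L : ℝ) ^ 2 * lg := by
    rw [mul_assoc]
    gcongr
  have e4 : (L : ℝ) * (w * lg) ≤ w * (L : ℝ) ^ 2 * lg := by
    calc (L : ℝ) * (w * lg) ≤ (L : ℝ) ^ 2 * (w * lg) := by gcongr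
      _ = _ := by ring
  push_cast
  calc (9 : ℝ) + ((L * 4 + 1) + (L * (passBound ε ((n : ℝ) ^ 3 / ε ^ 2) * 9 + 3) +
        ((L : ℝ) ^ 2 * (2 + (5 * lubyPasses n + 6)) + L * (trimCount τ n * 4 + 4))))
      ≤ 9 + ((L * 4 + 1) + (L * (3 * Λ * 9 + 3) +
        ((L : ℝ) ^ 2 * (2 + (5 * (12 * lg) + 6)) + L * ((w * lg + 1) * 4 + 4)))) := by gcongr
    _ = 10 + 15 * L + 27 * (L * Λ) + 60 * ((L : ℝ) ^ 2 * lg) + 8 * (L : ℝ) ^ 2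
        + 4 * (L * (w * lg)) := by ring
    _ ≤ 100 * (L * Λ + w * (L : ℝ) ^ 2 * lg) := by nlinarith

end

end SetCover

open SetCover in
/-- Performance of the parallel set cover algorithm on instances with the `τ`-SNC property. -/
theorem mainTheorem1 :
    ∃ K : ℝ, 0 < K ∧
      ∀ (X S : Type) [Fintype X] [Fintype S] [Nonempty X]
        (G : SetCover.WeightedSetSystem X S) (τ : ℕ) (ε : ℝ) (c : SetCover.ChoiceRule X S τ),
        (∀ e : X, ∃ i : S, e ∈ G.carrier i) → G.HasSNC τ → 0 < ε → ε < 1 / 2 →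
        -- any maximal independent set procedure
        (∀ M : SetCover.MISProc X, M.Correct →
          (∀ r ∈ (SetCover.modifiedParaMinSC G c M ε).outcomes,
            r.rounds ≠ ⊤ ∧ G.IsCover r.val) ∧
          1 - 1 / (Fintype.card X : ENNReal) ≤
            (SetCover.modifiedParaMinSC G c M ε).prob fun r =>
              G.totalWeight r.val ≤ τ * (1 + 3 * ε) * G.opt) ∧
        -- Luby's procedure
        (SetCover.luby X).Correct ∧
        (∀ r ∈ (SetCover.modifiedParaMinSC G c (SetCover.luby X) ε).outcomes,
          (r.machines : ℝ) ≤ K * (Fintype.card X * (Fintype.card S : ℝ) ^ τ)) ∧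
        1 - 1 / (Fintype.card X : ENNReal) ≤
          (SetCover.modifiedParaMinSC G c (SetCover.luby X) ε).prob fun r =>
            G.totalWeight r.val ≤ τ * (1 + 3 * ε) * G.opt ∧
            r.RoundsLE (K *
              (G.layerDepth τ * Real.logb (1 + ε) ((Fintype.card X : ℝ) ^ 3 / ε ^ 2) +
                4 * (τ : ℝ) ^ 3 * 2 ^ τ * (G.layerDepth τ : ℝ) ^ 2 *
                  Real.logb 2 (Fintype.card X))) := by
  refine ⟨100, by norm_num, ?_⟩
  intro X S _ _ _ G τ ε c hc h hε hε2
  have hτ : 1 ≤ τ := one_le_of_hasSNC hc h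
  obtain ⟨i₀, -⟩ := hc (Classical.arbitrary X)
  have : Nonempty S := ⟨i₀⟩
  have hL1 : 1 ≤ G.layerDepth τ := one_le_layerDepth h
  have hLn : G.layerDepth τ ≤ Fintype.card X := layerDepth_le_card h
  set n := Fintype.card X with hn
  have hn1 : 1 ≤ n := Fintype.card_pos
  have hm1 : 1 ≤ Fintype.card S := Fintype.card_pos
  set N : ℕ := n * Fintype.card S ^ τ with hNdef
  have hXN : n ≤ N := Nat.le_mul_of_pos_right n (Nat.pow_pos hm1)
  have hSN : Fintype.card S ≤ N :=
    (Nat.le_self_pow (by omega) _).trans (Nat.le_mul_of_pos_left _ hn1)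
  have hPN : Fintype.card (X × (Fin τ → S)) ≤ N := by
    rw [Fintype.card_prod, Fintype.card_fun, Fintype.card_fin]
  have hX : (n : ℕ∞) ≤ N := by exact_mod_cast hXN
  have hS : (Fintype.card S : ℕ∞) ≤ N := by exact_mod_cast hSN
  have hP : (Fintype.card (X × (Fin τ → S)) : ℕ∞) ≤ N := by exact_mod_cast hPN
  have hN : (1 : ℕ∞) ≤ N := by exact_mod_cast hn1.trans hXN
  -- For a single element, the probability bounds claim nothing.
  have hsmall : ¬ 2 ≤ n → ∀ x : ENNReal, 1 - 1 / (n : ENNReal) ≤ x := by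
    intro hlt x
    have : n = 1 := by omega
    rw [this]
    simp
  refine ⟨fun M hM => ?_, luby_correct, fun r hr => ?_, ?_⟩
  · have hM' : ∀ H V, (M H V).Spec 0 (IsMIS H V) ⊤ ⊤ := fun H V =>
      Par.spec_zero_iff.2 fun r hr => ⟨(hM H V r hr).2, (hM H V r hr).1, le_top, le_top⟩
    constructor
    · have h1 := spec_modifiedParaMinSC hτ (c := c) h hc hε hε2 hM' False (δ := 0)
        (fun hf => hf.elim) le_top le_top le_top le_top
      have h2 := h1.mono (δ' := 0) (by simp) (fun _ h => h) le_rfl le_rfl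
      exact fun r hr => ⟨(Par.spec_zero_iff.1 h2 r hr).2.1, (Par.spec_zero_iff.1 h2 r hr).1.1⟩
    · by_cases hn2 : 2 ≤ n
      · have h1 := spec_modifiedParaMinSC hτ (c := c) h hc hε hε2 hM' True
          (fun _ => trimFactor_pow_trimCount_le hτ hn2) le_top le_top le_top le_top
        refine Par.le_prob_of_spec h1 ?_ fun r hr => hr.1.2 trivial
        rw [mul_zero, add_zero]
        exact le_self_add.trans (card_mul_add_le_inv hn2 hLn)
      · exact hsmall hn2 _
  · have h1 := spec_modifiedParaMinSC hτ (c := c) h hc hε hε2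
      (fun H V => spec_luby (H := H) hX hN V) False (δ := 0) (fun hf => hf.elim) hX hS hP hN
    have h2 := h1.mono (δ' := 0) (by simp) (fun _ h => h) le_rfl le_rfl
    have h3 := (Par.spec_zero_iff.1 h2 r hr).2.2.2
    have h4 : (r.machines : ℝ) ≤ (N : ℝ) := by exact_mod_cast h3
    rw [hNdef] at h4
    push_cast at h4
    have h5 : (0 : ℝ) ≤ n * (Fintype.card S : ℝ) ^ τ := by positivity
    linarith
  · by_cases hn2 : 2 ≤ n
    · have h1 := spec_modifiedParaMinSC hτ (c := c) h hc hε hε2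
        (fun H V => spec_luby_rounds (H := H) hX hN (lubyPasses n) V) True
        (fun _ => trimFactor_pow_trimCount_le hτ hn2) hX hS hP hN
      refine Par.le_prob_of_spec h1 (card_mul_add_le_inv hn2 hLn) fun r hr => ?_
      obtain ⟨k, hk, hk'⟩ := exists_roundBound_luby (L := G.layerDepth τ)
        (P := passBound ε ((n : ℝ) ^ 3 / ε ^ 2)) (t := trimCount τ n) (T := lubyPasses n)
      rw [hk] at hr
      refine ⟨hr.1.2 trivial, hr.roundsLE ?_⟩
      rw [hk']
      exact roundBound_le hn2 hτ hL1 hε hε2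
    · exact hsmall hn2 _
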